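/- Let $M$ be an integral homology 3-sphere, that is, a closed smooth 3-manifold with $H_0(M;\mathbb Z)\cong H_3(M;\mathbb Z)\cong\mathbb Z$ and all other homology groups zero. Let $\alpha$ be a contact form on $M$, orient $M$ by $\alpha\wedge d\alpha$, let $R$ be the Reeb vector field ($\alpha(R)=1$, $d\alpha(R,\cdot)=0$) and let $\phi_t$ be its flow. Let $S$ be a global surface of section for $\phi_t$: a connected, compact, oriented smooth surface with boundary, smoothly embedded in $M$, such that (1) $R$ is positively transverse to the interior of $S$; (2) for every $p\in M$ there are $t^+>0$ and $t^-<0$ with $\phi_{t^+}(p),\phi_{t^-}(p)\in S$; (3) every connected component of $\partial S$ is a periodic orbit of $\phi_t$. Let $L_1,\dots,L_k$ be the boundary components of $S$, each regarded as an oriented knot (with any choice of orientations). For an oriented knot $L\subset M$ and a loop $\gamma$ in $M\setminus L$, the linking number $\mathrm{lk}(\gamma,L)\in\mathbb Z$ is the integer $n$ with $[\gamma]=n[\mu_L]$ in $H_1(M\setminus L;\mathbb Z)\cong\mathbb Z$, where the generator $[\mu_L]$ is the class of a positively oriented meridian of $L$; equivalently, it is the oriented number of intersections of $\gamma$ with a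 Seifert surface of $L$. Then for every periodic orbit $\gamma$ of $\phi_t$ (possibly multiply covered) whose image is none of the $L_i$, there is an $i\in\{1,\dots,k\}$ with $\mathrm{lk}(\gamma,L_i)\neq 0$. -/

import Mathlib

open Set Topology Manifold CategoryTheory
open scoped ContDiff

/-! ### Integral homology -/

/-- The singular homology functor `H_n( - ; ℤ)`. -/
noncomputable abbrev integralHomology (n : ℕ) : TopCat.{0} ⥤ ModuleCat.{0} ℤ :=
  (AlgebraicTopology.singularHomologyFunctor (ModuleCat.{0} ℤ) n).obj (ModuleCat.of ℤ ℤ)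

/-- `M` has the integral homology of the 3-sphere: `H₀ ≅ H₃ ≅ ℤ`, and all other groups vanish. -/
structure HasHomologyOfThreeSphere (M : Type) [TopologicalSpace M] : Prop where
  zero : Nonempty ((integralHomology 0).obj (TopCat.of M) ≅ ModuleCat.of ℤ ℤ)
  three : Nonempty ((integralHomology 3).obj (TopCat.of M) ≅ ModuleCat.of ℤ ℤ)
  other : ∀ n : ℕ, n ≠ 0 → n ≠ 3 → Limits.IsZero ((integralHomology n).obj (TopCat.of M))

/-! ### Contact forms and Reeb flows on 3-manifolds -/

section Forms

variable {E : Type} [NormedAddCommGroup E] [NormedSpace ℝ E]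
  {M : Type} [TopologicalSpace M] [ChartedSpace E M]

/-- The 1-form `α` written in the preferred chart at `x₀`, i.e. its pullback under the inverse of
this chart, as a map from the coordinate space to the covectors of the coordinate space. -/
noncomputable def formInChart (α : ∀ x : M, TangentSpace 𝓘(ℝ, E) x →L[ℝ] ℝ) (x₀ : M)
    (y : E) : E →L[ℝ] ℝ :=
  (α ((extChartAt 𝓘(ℝ, E) x₀).symm y)).comp
    (mfderiv 𝓘(ℝ, E) 𝓘(ℝ, E) (extChartAt 𝓘(ℝ, E) x₀).symm y)

/-- The 1-form `α` is smooth: it is smooth in charts. -/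
def IsSmoothForm (α : ∀ x : M, TangentSpace 𝓘(ℝ, E) x →L[ℝ] ℝ) : Prop :=
  ∀ x₀ : M, ContDiffOn ℝ ∞ (formInChart α x₀) (extChartAt 𝓘(ℝ, E) x₀).target

/-- The exterior derivative `dα` at `x`, evaluated on two tangent vectors. A tangent vector at `x`
is, by definition of `TangentSpace`, its coordinate vector in the preferred chart at `x`, and in
coordinates `dα(u, v) = D_u α (v) - D_v α (u)`. -/
noncomputable def extDerivForm (α : ∀ x : M, TangentSpace 𝓘(ℝ, E) x →L[ℝ] ℝ) (x : M)
    (u v : TangentSpace 𝓘(ℝ, E) x) : ℝ :=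
  let u' : E := u
  let v' : E := v
  fderiv ℝ (formInChart α x) (extChartAt 𝓘(ℝ, E) x x) u' v'
    - fderiv ℝ (formInChart α x) (extChartAt 𝓘(ℝ, E) x x) v' u'

/-- The 3-form `α ∧ dα` at `x`, evaluated on three tangent vectors. -/
noncomputable def contactVolume (α : ∀ x : M, TangentSpace 𝓘(ℝ, E) x →L[ℝ] ℝ) (x : M)
    (u v w : TangentSpace 𝓘(ℝ, E) x) : ℝ :=
  α x u * extDerivForm α x v w + α x v * extDerivForm α x w u + α x w * extDerivForm α x u v

/-- The tangent vector of `M` with coordinate vector `v` at the point with coordinates `y`, in the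
chart `e`. -/
noncomputable def chartVector (e : OpenPartialHomeomorph M E) (y v : E) :
    TangentSpace 𝓘(ℝ, E) (e.symm y) :=
  mfderiv 𝓘(ℝ, E) 𝓘(ℝ, E) e.symm y v

end Forms

section Contact

variable {M : Type} [TopologicalSpace M] [ChartedSpace (EuclideanSpace ℝ (Fin 3)) M]

/-- `α` is a contact form: a smooth 1-form such that `α ∧ dα` vanishes nowhere. The manifold is
always oriented by `α ∧ dα`: a frame `(u, v, w)` is positive if `0 < contactVolume α x u v w`. -/
structure IsContactForm (α : ∀ x : M, TangentSpace (𝓡 3) x →L[ℝ] ℝ) : Prop where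
  smooth : IsSmoothForm α
  nondegenerate : ∀ x : M, ∃ u v w : TangentSpace (𝓡 3) x, contactVolume α x u v w ≠ 0

/-- `R` is the Reeb vector field of `α`: `α(R) = 1` and `dα(R, ·) = 0`. -/
def IsReebField (α : ∀ x : M, TangentSpace (𝓡 3) x →L[ℝ] ℝ)
    (R : ∀ x : M, TangentSpace (𝓡 3) x) : Prop :=
  ∀ x : M, α x (R x) = 1 ∧ ∀ v : TangentSpace (𝓡 3) x, extDerivForm α x (R x) v = 0

/-- `φ` is the Reeb flow of `α`: the flow generated by the Reeb vector field `R` of `α`. -/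
structure IsReebFlow (α : ∀ x : M, TangentSpace (𝓡 3) x →L[ℝ] ℝ)
    (R : ∀ x : M, TangentSpace (𝓡 3) x) (φ : Flow ℝ M) : Prop where
  reeb : IsReebField α R
  generated : ∀ x : M, IsMIntegralCurve (I := 𝓡 3) (fun t : ℝ => φ t x) R

end Contact

/-! ### Periodic orbits -/

/-- A periodic orbit of a flow: a point together with a (not necessarily minimal) period. -/
structure PeriodicOrbit {M : Type} [TopologicalSpace M] (φ : Flow ℝ M) where
  pt : M
  period : ℝ
  period_pos : 0 < period
  closes : φ period pt = pt

namespace PeriodicOrbit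

variable {M : Type} [TopologicalSpace M] {φ : Flow ℝ M}

/-- The set of points of a periodic orbit. -/
def carrier (γ : PeriodicOrbit φ) : Set M := Set.range fun t : ℝ => φ t γ.pt

theorem periodic (γ : PeriodicOrbit φ) :
    Function.Periodic (fun t : ℝ => φ (γ.period * t) γ.pt) 1 := by
  intro t
  simp only [mul_add, mul_one]
  rw [φ.map_add, γ.closes]

/-- A periodic orbit of period `T` as the loop `θ ↦ φ_{Tθ}(p)` on `ℝ/ℤ`. -/
noncomputable def loop (γ : PeriodicOrbit φ) : C(UnitAddCircle, M) where
  toFun := γ.periodic.lift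
  continuous_toFun := by
    have h : Continuous fun t : ℝ => φ (γ.period * t) γ.pt :=
      φ.continuous (continuous_const.mul continuous_id) continuous_const
    exact h.quotient_lift _

end PeriodicOrbit

/-! ### Global surfaces of section -/

/-- An orientation of a surface with boundary `S`: an orientation of every tangent space, locally
constant in charts. (`tangentCoordChange (𝓡∂ 2) s s₀ s` carries a tangent vector at `s` to its
coordinates in the preferred chart at `s₀`.) -/
structure SurfaceOrientation (S : Type*) [TopologicalSpace S]
    [ChartedSpace (EuclideanHalfSpace 2) S] [IsManifold (𝓡∂ 2) ∞ S] where
  at' : ∀ s : S, Orientation ℝ (TangentSpace (𝓡∂ 2) s) (Fin 2)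
  locally_constant : ∀ s₀ : S, ∀ᶠ s in 𝓝 s₀,
    ∀ (b : Module.Basis (Fin 2) ℝ (TangentSpace (𝓡∂ 2) s))
      (b₀ : Module.Basis (Fin 2) ℝ (TangentSpace (𝓡∂ 2) s₀)),
      (∀ i, b₀ i = tangentCoordChange (𝓡∂ 2) s s₀ s (b i)) →
        (b.orientation = at' s ↔ b₀.orientation = at' s₀)

/-- The boundary of the surface `f : S → M`, as a subset of `M`. -/
def surfaceBoundary {M S : Type*} [TopologicalSpace S] [ChartedSpace (EuclideanHalfSpace 2) S]
    (f : S → M) : Set M :=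
  f '' (𝓡∂ 2).boundary S

/-- `f : S → M` is (the inclusion of) a global surface of section for the flow `φ` generated by
the vector field `R` on the 3-manifold `M`, which is oriented by `α ∧ dα`. -/
structure IsGlobalSurfaceOfSection {M : Type} [TopologicalSpace M]
    [ChartedSpace (EuclideanSpace ℝ (Fin 3)) M]
    (α : ∀ x : M, TangentSpace (𝓡 3) x →L[ℝ] ℝ) (R : ∀ x : M, TangentSpace (𝓡 3) x)
    (φ : Flow ℝ M)
    {S : Type*} [TopologicalSpace S] [ChartedSpace (EuclideanHalfSpace 2) S]
    [IsManifold (𝓡∂ 2) ∞ S] (f : S → M) : Prop where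
  compact : CompactSpace S
  connected : ConnectedSpace S
  embedded : IsSmoothEmbedding (𝓡∂ 2) (𝓡 3) ∞ f
  /-- `R` is positively transverse to the interior of the oriented surface `S`: at an interior
  point, `R` followed by a positive basis of the tangent plane is a positive frame. -/
  transverse : ∃ o : SurfaceOrientation S, ∀ s ∈ (𝓡∂ 2).interior S,
    ∀ b : Module.Basis (Fin 2) ℝ (TangentSpace (𝓡∂ 2) s), b.orientation = o.at' s →
      0 < contactVolume α (f s) (R (f s))
        (mfderiv (𝓡∂ 2) (𝓡 3) f s (b 0)) (mfderiv (𝓡∂ 2) (𝓡 3) f s (b 1))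
  /-- Every orbit meets `S` in the future and in the past. -/
  forward : ∀ p : M, ∃ t : ℝ, 0 < t ∧ φ t p ∈ Set.range f
  backward : ∀ p : M, ∃ t : ℝ, t < 0 ∧ φ t p ∈ Set.range f
  /-- Every connected component of the boundary of `S` is a periodic orbit. -/
  boundary_periodic : ∀ q ∈ surfaceBoundary f, ∃ γ : PeriodicOrbit φ,
    γ.carrier = connectedComponentIn (surfaceBoundary f) q

/-! ### Linking numbers -/

/-- An oriented knot in a 3-manifold: a smoothly embedded, parametrized circle `ℝ/ℤ`. -/
structure OrientedKnot (M : Type) [TopologicalSpace M]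
    [ChartedSpace (EuclideanSpace ℝ (Fin 3)) M] where
  toFun : ℝ → M
  smooth : ContMDiff 𝓘(ℝ, ℝ) (𝓡 3) ∞ toFun
  periodic : Function.Periodic toFun 1
  injOn : Set.InjOn toFun (Set.Ico 0 1)
  immersive : ∀ t : ℝ, mfderiv 𝓘(ℝ, ℝ) (𝓡 3) toFun t ≠ 0

namespace OrientedKnot

variable {M : Type} [TopologicalSpace M] [ChartedSpace (EuclideanSpace ℝ (Fin 3)) M]

/-- The set of points of a knot. -/
def carrier (K : OrientedKnot M) : Set M := Set.range K.toFun

/-- The loop `m` is a positive meridian of `K`, for the orientation of `M` by `α ∧ dα`: in some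
chart of `M` whose image contains the closed unit disc of the plane `z = 0`, which is positively
oriented at the origin, in which `K` is the `z`-axis, directed upwards, `m` is the unit circle of
the plane `z = 0`, traversed once counterclockwise. -/
def IsPositiveMeridian (α : ∀ x : M, TangentSpace (𝓡 3) x →L[ℝ] ℝ) (K : OrientedKnot M)
    (m : C(UnitAddCircle, M)) : Prop :=
  ∃ e ∈ IsManifold.maximalAtlas (𝓡 3) ∞ M,
    (∀ y : EuclideanSpace ℝ (Fin 3), y 2 = 0 → ‖y‖ ≤ 1 → y ∈ e.target) ∧
    (∀ q ∈ e.source, q ∈ K.carrier ↔ e q 0 = 0 ∧ e q 1 = 0) ∧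
    (∀ t : ℝ, K.toFun t ∈ e.source → e (K.toFun t) = 0 →
      0 < deriv (fun s : ℝ => e (K.toFun s) 2) t) ∧
    0 < contactVolume α (e.symm 0)
      (chartVector e 0 (EuclideanSpace.single 0 1))
      (chartVector e 0 (EuclideanSpace.single 1 1))
      (chartVector e 0 (EuclideanSpace.single 2 1)) ∧
    ∀ t : ℝ, m (t : UnitAddCircle) =
      e.symm !₂[Real.cos (2 * Real.pi * t), Real.sin (2 * Real.pi * t), 0]

/-- The map induced on `H₁( - ; ℤ)` by a loop `ℝ/ℤ → X`. It carries the fundamental class of the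
circle, a generator of `H₁(ℝ/ℤ; ℤ) ≅ ℤ`, to the homology class of the loop, so that an integral
relation between the homology classes of loops is the same relation between these maps. -/
noncomputable def loopClass {X : Type} [TopologicalSpace X] (c : C(UnitAddCircle, X)) :
    (integralHomology 1).obj (TopCat.of UnitAddCircle) ⟶ (integralHomology 1).obj (TopCat.of X) :=
  (integralHomology 1).map (TopCat.ofHom c)

/-- The loop `c` in the complement of the knot `K` has linking number `n` with `K`:
`[c] = n • [m]` in `H₁(M ∖ K; ℤ)`, where `m` is a positive meridian of `K`. -/
def HasLinkingNumber (α : ∀ x : M, TangentSpace (𝓡 3) x →L[ℝ] ℝ) (K : OrientedKnot M)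
    (c : C(UnitAddCircle, M)) (n : ℤ) : Prop :=
  ∃ c' m' : C(UnitAddCircle, {x : M // x ∉ K.carrier}),
    (∀ θ, (c' θ : M) = c θ) ∧
    IsPositiveMeridian α K ((⟨Subtype.val, continuous_subtype_val⟩ :
      C({x : M // x ∉ K.carrier}, M)).comp m') ∧
    loopClass c' = n • loopClass m'

end OrientedKnot

/-!
If every linking number of `γ` with a boundary knot `L i` were zero, `γ` would bound a 2-chain in
each complement `M ∖ L i`. The knots are closed orbits of the flow, so any two of them are equal or
disjoint, and since `H₂(M) = 0`, the Mayer-Vietoris argument `exists_bd_eq_of_inter` glues these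
chains into a single 2-chain in the complement of `∂S` with boundary `γ`
(`exists_bd_eq_compl_iUnion`). On that complement the signed count of crossings with `S` is a
1-cocycle, and `γ` meets `S` at least once and crosses it in the positive direction each time, so
its value on `γ` is positive and `γ` cannot bound there (`bd_ne_of_flowSlices`).

Three points need more than this.

* *Linking numbers exist.* The statement asks for an integer `n` such that `γ` is homologous to `n`
  meridians, so the first homology of a knot complement has to be generated by a meridian. The map
  from chains of the complement to their quotient by the boundaries and the meridian is a cocycle
  that vanishes on cycles near the knot, because the homology of a ball without its axis is
  generated by a circle. It therefore extends to a cocycle on `M`, where it vanishes on all cycles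
  since `H₁(M) = 0` (`SingularChain.exists_bd_eq_sub_smul_of_local`). A chart that straightens the knot is only
  constructed near one of its points (`OrientedKnot.exists_isPositiveMeridian`, from the inverse
  function theorem): the knot is an orbit, so the flow carries that chart to all its other points
  (`OrientedKnot.exists_hasLinkingNumber`).
* *The crossing cocycle.* Near an interior point, the surface is the zero set of a smooth function
  `h` that increases along the flow (`IsGlobalSurfaceOfSection.exists_isFlowSlice`). For the
  derivative of `h` along the flow to be positive on a neighbourhood, the Reeb field has to be
  continuous (`IsReebField.continuousAt`), which follows from `α ∧ dα ≠ 0`: in a chart, the field is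
  the kernel direction of `dα`, normalised by `α`. The cocycle is then given locally by the jumps of
  the indicator function of `h ≥ 0`, and is evaluated on chains subordinate to a cover.
* *Homology.* All chains are explicit finitely supported sums of singular simplices, with barycentric
  subdivision at hand. They are compared with Mathlib's singular homology in
  `SingularChain.exists_bd_eq_of_isZero` and `SingularChain.integralHomology_map_eq_smul_iff`.
-/

local notation "E3" => EuclideanSpace ℝ (Fin 3)

local notation "E2" => EuclideanSpace ℝ (Fin 2)

/-! ### Singular chains and barycentric subdivision -/

namespace SingularChain

/-- The standard topological `n`-simplex. -/
abbrev Simplex (n : ℕ) : Type := stdSimplex ℝ (Fin (n + 1))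

/-- Singular `n`-simplices of `X`. -/
abbrev Sing (n : ℕ) (X : Type*) [TopologicalSpace X] := C(Simplex n, X)

/-- Singular `n`-chains of `X` with integral coefficients. -/
abbrev Chain (n : ℕ) (X : Type*) [TopologicalSpace X] := Sing n X →₀ ℤ

/-- The inclusion of the `i`-th face of the standard simplex. -/
noncomputable def faceMap {n : ℕ} (i : Fin (n + 2)) : C(Simplex n, Simplex (n + 1)) :=
  ⟨stdSimplex.map i.succAbove, stdSimplex.continuous_map _⟩

variable {X Y Z : Type*} [TopologicalSpace X] [TopologicalSpace Y] [TopologicalSpace Z]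

/-- The `i`-th face of a singular simplex. -/
noncomputable def face {n : ℕ} (i : Fin (n + 2)) (σ : Sing (n + 1) X) : Sing n X :=
  σ.comp (faceMap i)

/-- The boundary operator. -/
noncomputable def bd {n : ℕ} : Chain (n + 1) X →ₗ[ℤ] Chain n X :=
  Finsupp.linearCombination ℤ fun σ => ∑ i : Fin (n + 2), (-1 : ℤ) ^ (i : ℕ) •
    Finsupp.single (face i σ) 1

theorem bd_single {n : ℕ} (σ : Sing (n + 1) X) :
    bd (Finsupp.single σ 1) = ∑ i : Fin (n + 2), (-1 : ℤ) ^ (i : ℕ) •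
      Finsupp.single (face i σ) 1 := by
  simp [bd]

/-- The map of chains induced by a continuous map. -/
noncomputable def push {n : ℕ} (f : C(X, Y)) : Chain n X →ₗ[ℤ] Chain n Y :=
  Finsupp.lmapDomain ℤ ℤ fun σ => f.comp σ

@[simp] theorem push_single {n : ℕ} (f : C(X, Y)) (σ : Sing n X) (a : ℤ) :
    push f (Finsupp.single σ a) = Finsupp.single (f.comp σ) a := by
  simp [push]

theorem push_push {n : ℕ} (g : C(Y, Z)) (f : C(X, Y)) (c : Chain n X) :
    push g (push f c) = push (g.comp f) c := by
  simp only [push, Finsupp.lmapDomain_apply, ← Finsupp.mapDomain_comp]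
  rfl

theorem bd_push {n : ℕ} (f : C(X, Y)) (c : Chain (n + 1) X) :
    bd (push f c) = push f (bd c) := by
  suffices h : bd ∘ₗ push f = push f ∘ₗ (bd (n := n)) from LinearMap.congr_fun h c
  refine Finsupp.lhom_ext' fun σ => LinearMap.ext_ring ?_
  simp only [LinearMap.comp_apply, Finsupp.lsingle_apply, push_single, bd_single, map_sum, map_smul]
  rfl

/-- The affine simplex in a topological vector space with given vertices. -/
noncomputable def affine {E : Type*} [AddCommGroup E] [Module ℝ E] [TopologicalSpace E]
    [ContinuousAdd E] [ContinuousSMul ℝ E] {n : ℕ} (v : Fin (n + 1) → E) : Sing n E where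
  toFun t := ∑ i, t i • v i
  continuous_toFun := continuous_finsetSum _ fun i _ =>
    ((continuous_apply i).comp continuous_subtype_val).smul continuous_const

theorem affine_faceMap {E : Type*} [AddCommGroup E] [Module ℝ E] [TopologicalSpace E]
    [ContinuousAdd E] [ContinuousSMul ℝ E] {n : ℕ} (v : Fin (n + 2) → E) (i : Fin (n + 2)) :
    face i (affine v) = affine (v ∘ i.succAbove) := by
  ext t
  simp only [face, affine, ContinuousMap.comp_apply, ContinuousMap.coe_mk, faceMap,
    stdSimplex.map_coe, Function.comp]
  rw [Fin.sum_univ_succAbove _ i]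
  have h1 : (FunOnFinite.linearMap ℝ ℝ i.succAbove (⇑t)) i = 0 := by
    rw [FunOnFinite.linearMap_apply_apply]
    exact Finset.sum_eq_zero fun j hj => absurd (Finset.mem_filter.1 hj).2 (Fin.succAbove_ne i j)
  have h2 (j) : (FunOnFinite.linearMap ℝ ℝ i.succAbove (⇑t)) (i.succAbove j) = t j := by
    rw [FunOnFinite.linearMap_apply_apply]
    rw [Finset.sum_eq_single_of_mem j (by simp)]
    intro k hk hkj
    exact absurd (Fin.succAbove_right_injective (Finset.mem_filter.1 hk).2) hkj
  simp [h1, h2]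

/-- The affine simplex of a standard simplex with given vertices. -/
noncomputable def affineIn {n m : ℕ} (v : Fin (n + 1) → Simplex m) : Sing n (Simplex m) where
  toFun t := ⟨affine (fun i => (v i : Fin (m + 1) → ℝ)) t,
    (convex_stdSimplex ℝ _).sum_mem (fun i _ => t.2.1 i) t.2.2 fun i _ => (v i).2⟩
  continuous_toFun := (affine fun i => (v i : Fin (m + 1) → ℝ)).continuous.subtype_mk _

theorem affineIn_coe {n m : ℕ} (v : Fin (n + 1) → Simplex m) (t : Simplex n) :
    (affineIn v t).1 = ∑ i, t.1 i • (v i).1 := rfl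

theorem face_affineIn {n m : ℕ} (v : Fin (n + 2) → Simplex m) (i : Fin (n + 2)) :
    face i (affineIn v) = affineIn (v ∘ i.succAbove) := by
  ext t : 1
  apply Subtype.ext
  exact DFunLike.congr_fun (affine_faceMap (fun i => (v i : Fin (m + 1) → ℝ)) i) t

theorem affineIn_comp {n m k : ℕ} (w : Fin (m + 1) → Simplex k) (v : Fin (n + 1) → Simplex m) :
    (affineIn w).comp (affineIn v) = affineIn fun i => affineIn w (v i) := by
  ext t : 1
  apply Subtype.ext
  simp only [ContinuousMap.comp_apply, affineIn_coe, Finset.sum_smul, Finset.smul_sum,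
    Finset.sum_apply, Pi.smul_apply, smul_eq_mul, mul_smul]
  exact Finset.sum_comm

/-- The vertices of the standard simplex. -/
noncomputable def vertices (n : ℕ) : Fin (n + 1) → Simplex n :=
  fun i => ⟨Pi.single i 1, single_mem_stdSimplex ℝ i⟩

theorem affineIn_vertices (n : ℕ) : affineIn (vertices n) = ContinuousMap.id _ := by
  ext t : 1
  apply Subtype.ext
  rw [affineIn_coe]
  ext j
  simp [vertices, Pi.single_apply]

theorem affineIn_apply_vertices {n m : ℕ} (v : Fin (n + 1) → Simplex m) (i : Fin (n + 1)) :
    affineIn v (vertices n i) = v i := by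
  apply Subtype.ext
  rw [affineIn_coe]
  simp [vertices, Pi.single_apply]

theorem faceMap_eq_affineIn {n : ℕ} (i : Fin (n + 2)) :
    faceMap i = affineIn (vertices (n + 1) ∘ i.succAbove) := by
  rw [← face_affineIn, affineIn_vertices]
  rfl

/-! #### Linear chains -/

/-- Linear `n`-chains of the standard `m`-simplex: formal combinations of tuples of vertices. -/
abbrev LChain (n m : ℕ) := (Fin (n + 1) → Simplex m) →₀ ℤ

/-- The boundary operator on linear chains. -/
noncomputable def lbd {n m : ℕ} : LChain (n + 1) m →ₗ[ℤ] LChain n m :=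
  Finsupp.linearCombination ℤ fun v => ∑ i : Fin (n + 2), (-1 : ℤ) ^ (i : ℕ) •
    Finsupp.single (v ∘ i.succAbove) 1

theorem lbd_single {n m : ℕ} (v : Fin (n + 2) → Simplex m) :
    lbd (Finsupp.single v 1) = ∑ i : Fin (n + 2), (-1 : ℤ) ^ (i : ℕ) •
      Finsupp.single (v ∘ i.succAbove) 1 := by
  simp [lbd]

/-- The map of linear chains induced by a map of vertices. -/
noncomputable def lpush {n m k : ℕ} (A : Simplex m → Simplex k) : LChain n m →ₗ[ℤ] LChain n k :=
  Finsupp.lmapDomain ℤ ℤ fun v => A ∘ v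

@[simp] theorem lpush_single {n m k : ℕ} (A : Simplex m → Simplex k) (v : Fin (n + 1) → Simplex m)
    (a : ℤ) : lpush A (Finsupp.single v a) = Finsupp.single (A ∘ v) a := by
  simp [lpush]

theorem lbd_lpush {n m k : ℕ} (A : Simplex m → Simplex k) (c : LChain (n + 1) m) :
    lbd (lpush A c) = lpush A (lbd c) := by
  suffices h : lbd ∘ₗ lpush A = lpush A ∘ₗ (lbd (n := n)) from LinearMap.congr_fun h c
  refine Finsupp.lhom_ext' fun σ => LinearMap.ext_ring ?_
  simp only [LinearMap.comp_apply, Finsupp.lsingle_apply, lpush_single, lbd_single, map_sum,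
    map_smul]
  rfl

/-- The singular chain obtained by restricting a singular simplex to the simplices of a linear
chain. -/
noncomputable def realize {n m : ℕ} (σ : Sing m X) : LChain n m →ₗ[ℤ] Chain n X :=
  Finsupp.lmapDomain ℤ ℤ fun v => σ.comp (affineIn v)

@[simp] theorem realize_single {n m : ℕ} (σ : Sing m X) (v : Fin (n + 1) → Simplex m) (a : ℤ) :
    realize σ (Finsupp.single v a) = Finsupp.single (σ.comp (affineIn v)) a := by
  simp [realize]

theorem bd_realize {n m : ℕ} (σ : Sing m X) (c : LChain (n + 1) m) :
    bd (realize σ c) = realize σ (lbd c) := by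
  suffices h : bd ∘ₗ realize σ = realize σ ∘ₗ (lbd (n := n)) from LinearMap.congr_fun h c
  refine Finsupp.lhom_ext' fun v => LinearMap.ext_ring ?_
  simp only [LinearMap.comp_apply, Finsupp.lsingle_apply, realize_single, lbd_single, bd_single,
    map_sum, map_smul, ← face_affineIn]
  rfl

theorem realize_comp {n m k : ℕ} (σ : Sing k X) (w : Fin (m + 1) → Simplex k) (c : LChain n m) :
    realize (σ.comp (affineIn w)) c = realize σ (lpush (affineIn w) c) := by
  suffices h : realize (σ.comp (affineIn w)) = realize σ ∘ₗ lpush (n := n) (affineIn w) from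
    LinearMap.congr_fun h c
  refine Finsupp.lhom_ext' fun v => LinearMap.ext_ring ?_
  simp only [LinearMap.comp_apply, Finsupp.lsingle_apply, realize_single, lpush_single,
    ContinuousMap.comp_assoc, affineIn_comp]
  rfl

/-- The cone of a linear chain from a point. -/
noncomputable def cone {n m : ℕ} (b : Simplex m) : LChain n m →ₗ[ℤ] LChain (n + 1) m :=
  Finsupp.lmapDomain ℤ ℤ fun v => Fin.cons b v

@[simp] theorem cone_single {n m : ℕ} (b : Simplex m) (v : Fin (n + 1) → Simplex m) (a : ℤ) :
    cone b (Finsupp.single v a) = Finsupp.single (Fin.cons b v : Fin (n + 2) → Simplex m) a := by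
  simp [cone]

theorem lbd_cone {n m : ℕ} (b : Simplex m) (c : LChain (n + 1) m) :
    lbd (cone b c) = c - cone b (lbd c) := by
  suffices h : lbd ∘ₗ cone b = LinearMap.id - cone b ∘ₗ (lbd (n := n)) from LinearMap.congr_fun h c
  refine Finsupp.lhom_ext' fun v => LinearMap.ext_ring ?_
  simp only [LinearMap.comp_apply, Finsupp.lsingle_apply, cone_single, lbd_single, map_sum,
    map_smul, LinearMap.sub_apply, LinearMap.id_apply]
  rw [Fin.sum_univ_succ, sub_eq_add_neg, ← Finset.sum_neg_distrib]
  congr 1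
  · simp only [Fin.val_zero, pow_zero, one_smul]
    congr 1
  · refine Finset.sum_congr rfl fun i _ => ?_
    rw [Fin.val_succ, pow_succ, mul_neg_one, neg_smul]
    congr 3
    ext j : 1
    refine Fin.cases ?_ (fun j => ?_) j <;> simp

/-- The sum of the coefficients of a linear chain. -/
noncomputable def augment {n m : ℕ} : LChain n m →ₗ[ℤ] ℤ :=
  Finsupp.linearCombination ℤ fun _ => 1

theorem lbd_cone_zero {m : ℕ} (b : Simplex m) (c : LChain 0 m) :
    lbd (cone b c) = c - augment c • Finsupp.single (fun _ => b) 1 := by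
  suffices h : lbd ∘ₗ cone b = LinearMap.id - augment.smulRight (Finsupp.single (fun _ => b) 1) from
    LinearMap.congr_fun h c
  refine Finsupp.lhom_ext' fun v => LinearMap.ext_ring ?_
  simp only [LinearMap.comp_apply, Finsupp.lsingle_apply, cone_single, lbd_single,
    LinearMap.sub_apply, LinearMap.id_apply, LinearMap.smulRight_apply, augment]
  rw [Fin.sum_univ_two]
  simp only [Fin.val_zero, pow_zero, one_smul, Fin.val_one, pow_one, neg_smul,
    Finsupp.linearCombination_single, ← sub_eq_add_neg]
  congr 2
  ext j : 1
  fin_cases j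
  rfl

theorem augment_lbd {m : ℕ} (c : LChain 1 m) : augment (lbd c) = 0 := by
  suffices h : augment ∘ₗ (lbd (n := 0) (m := m)) = 0 from LinearMap.congr_fun h c
  refine Finsupp.lhom_ext' fun v => LinearMap.ext_ring ?_
  simp [lbd_single, augment]

/-- The barycentre of a tuple of points. -/
noncomputable def barycentre {n m : ℕ} (v : Fin (n + 1) → Simplex m) : Simplex m :=
  affineIn v ⟨fun _ => ((n : ℝ) + 1)⁻¹, fun _ => by positivity, by
    simp [mul_inv_cancel₀ (by positivity : (n : ℝ) + 1 ≠ 0)]⟩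

theorem barycentre_coe {n m : ℕ} (v : Fin (n + 1) → Simplex m) :
    (barycentre v).1 = ∑ i, ((n : ℝ) + 1)⁻¹ • (v i).1 := rfl

theorem affineIn_barycentre {n m k : ℕ} (w : Fin (m + 1) → Simplex k)
    (v : Fin (n + 1) → Simplex m) :
    affineIn w (barycentre v) = barycentre (affineIn w ∘ v) :=
  DFunLike.congr_fun (affineIn_comp w v) _

/-- Barycentric subdivision of linear chains: the subdivision of a simplex is the cone, from its
barycentre, of the subdivision of its boundary. -/
noncomputable def lsd {m : ℕ} : (n : ℕ) → LChain n m →ₗ[ℤ] LChain n m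
  | 0 => LinearMap.id
  | n + 1 => Finsupp.linearCombination ℤ fun v =>
      cone (barycentre v) (lsd n (lbd (Finsupp.single v 1)))

/-- The chain homotopy between barycentric subdivision and the identity. -/
noncomputable def lht {m : ℕ} : (n : ℕ) → LChain n m →ₗ[ℤ] LChain (n + 1) m
  | 0 => 0
  | n + 1 => Finsupp.linearCombination ℤ fun v =>
      cone (barycentre v) (Finsupp.single v 1 - lht n (lbd (Finsupp.single v 1)))

theorem lsd_succ_single {n m : ℕ} (v : Fin (n + 2) → Simplex m) :
    lsd (n + 1) (Finsupp.single v 1) =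
      cone (barycentre v) (lsd n (lbd (Finsupp.single v 1))) := by
  simp [lsd]

theorem lht_succ_single {n m : ℕ} (v : Fin (n + 2) → Simplex m) :
    lht (n + 1) (Finsupp.single v 1) =
      cone (barycentre v) (Finsupp.single v 1 - lht n (lbd (Finsupp.single v 1))) := by
  simp [lht]

theorem lbd_lbd {m : ℕ} (n : ℕ) (c : LChain (n + 2) m) : lbd (lbd c) = 0 := by
  induction n with
  | zero =>
    suffices h : lbd ∘ₗ lbd = (0 : LChain 2 m →ₗ[ℤ] LChain 0 m) from LinearMap.congr_fun h c
    refine Finsupp.lhom_ext' fun v => LinearMap.ext_ring ?_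
    simp only [LinearMap.comp_apply, Finsupp.lsingle_apply, LinearMap.zero_apply]
    rw [← Fin.cons_self_tail v, ← cone_single, lbd_cone, map_sub, lbd_cone_zero, augment_lbd]
    simp
  | succ n ih =>
    suffices h : lbd ∘ₗ lbd = (0 : LChain (n + 3) m →ₗ[ℤ] LChain (n + 1) m) from
      LinearMap.congr_fun h c
    refine Finsupp.lhom_ext' fun v => LinearMap.ext_ring ?_
    simp only [LinearMap.comp_apply, Finsupp.lsingle_apply, LinearMap.zero_apply]
    rw [← Fin.cons_self_tail v, ← cone_single, lbd_cone, map_sub, lbd_cone, ih]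
    simp

theorem lbd_lsd {m : ℕ} (n : ℕ) (c : LChain (n + 1) m) : lbd (lsd (n + 1) c) = lsd n (lbd c) := by
  induction n with
  | zero =>
    suffices h : lbd ∘ₗ lsd 1 = lsd 0 ∘ₗ (lbd (m := m)) from LinearMap.congr_fun h c
    refine Finsupp.lhom_ext' fun v => LinearMap.ext_ring ?_
    simp only [LinearMap.comp_apply, Finsupp.lsingle_apply, lsd_succ_single]
    rw [lbd_cone_zero]
    simp [lsd, augment_lbd]
  | succ n ih =>
    suffices h : lbd ∘ₗ lsd (n + 2) = lsd (n + 1) ∘ₗ (lbd (m := m)) from LinearMap.congr_fun h c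
    refine Finsupp.lhom_ext' fun v => LinearMap.ext_ring ?_
    simp only [LinearMap.comp_apply, Finsupp.lsingle_apply, lsd_succ_single]
    rw [lbd_cone, ih, lbd_lbd]
    simp

theorem lbd_lht {m : ℕ} (n : ℕ) (c : LChain (n + 1) m) :
    lbd (lht (n + 1) c) = c - lsd (n + 1) c - lht n (lbd c) := by
  have key (n : ℕ) (h : ∀ c : LChain (n + 1) m, lbd (lht n (lbd c)) = lbd c - lsd n (lbd c)) :
      ∀ c : LChain (n + 1) m, lbd (lht (n + 1) c) = c - lsd (n + 1) c - lht n (lbd c) := by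
    intro c
    suffices h : lbd ∘ₗ lht (n + 1) =
        LinearMap.id - lsd (n + 1) - lht n ∘ₗ (lbd (m := m)) from LinearMap.congr_fun h c
    refine Finsupp.lhom_ext' fun v => LinearMap.ext_ring ?_
    simp only [LinearMap.comp_apply, Finsupp.lsingle_apply, lsd_succ_single, lht_succ_single,
      LinearMap.sub_apply, LinearMap.id_apply]
    rw [lbd_cone, map_sub, h]
    simp only [map_sub]
    abel
  induction n with
  | zero => exact key 0 (fun c => by simp [lht, lsd]) c
  | succ n ih =>
    refine key (n + 1) (fun c => ?_) c
    rw [ih, lbd_lbd]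
    simp

theorem cone_lpush {n m k : ℕ} (A : Simplex m → Simplex k) (b : Simplex m) (c : LChain n m) :
    cone (A b) (lpush A c) = lpush A (cone b c) := by
  suffices h : cone (A b) ∘ₗ lpush A = lpush A ∘ₗ (cone (n := n) b) from LinearMap.congr_fun h c
  refine Finsupp.lhom_ext' fun v => LinearMap.ext_ring ?_
  simp only [LinearMap.comp_apply, Finsupp.lsingle_apply, lpush_single, cone_single]
  congr 1
  ext j : 1
  refine Fin.cases ?_ (fun j => ?_) j <;> simp

theorem lsd_lpush {n m k : ℕ} (w : Fin (m + 1) → Simplex k) (c : LChain n m) :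
    lsd n (lpush (affineIn w) c) = lpush (affineIn w) (lsd n c) := by
  induction n with
  | zero => rfl
  | succ n ih =>
    suffices h : lsd (n + 1) ∘ₗ lpush (affineIn w) = lpush (affineIn w) ∘ₗ lsd (n + 1) from
      LinearMap.congr_fun h c
    refine Finsupp.lhom_ext' fun v => LinearMap.ext_ring ?_
    simp only [LinearMap.comp_apply, Finsupp.lsingle_apply, lpush_single, lsd_succ_single]
    rw [← lpush_single, lbd_lpush, ih, ← affineIn_barycentre, cone_lpush]

theorem lht_lpush {n m k : ℕ} (w : Fin (m + 1) → Simplex k) (c : LChain n m) :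
    lht n (lpush (affineIn w) c) = lpush (affineIn w) (lht n c) := by
  induction n with
  | zero => simp [lht]
  | succ n ih =>
    suffices h : lht (n + 1) ∘ₗ lpush (affineIn w) = lpush (affineIn w) ∘ₗ lht (n + 1) from
      LinearMap.congr_fun h c
    refine Finsupp.lhom_ext' fun v => LinearMap.ext_ring ?_
    simp only [LinearMap.comp_apply, Finsupp.lsingle_apply, lpush_single, lht_succ_single]
    rw [← lpush_single, lbd_lpush, ih, ← affineIn_barycentre, ← map_sub, cone_lpush]

/-! #### Subdivision of singular chains -/

theorem realize_vertices {n : ℕ} (σ : Sing n X) :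
    realize σ (Finsupp.single (vertices n) 1) = Finsupp.single σ 1 := by
  rw [realize_single, affineIn_vertices, ContinuousMap.comp_id]

theorem bd_bd {n : ℕ} (c : Chain (n + 2) X) : bd (bd c) = 0 := by
  suffices h : bd ∘ₗ bd = (0 : Chain (n + 2) X →ₗ[ℤ] Chain n X) from LinearMap.congr_fun h c
  refine Finsupp.lhom_ext' fun σ => LinearMap.ext_ring ?_
  simp only [LinearMap.comp_apply, Finsupp.lsingle_apply, LinearMap.zero_apply]
  rw [← realize_vertices σ, bd_realize, bd_realize, lbd_lbd, map_zero]

/-- Barycentric subdivision of singular chains. -/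
noncomputable def sd (n : ℕ) : Chain n X →ₗ[ℤ] Chain n X :=
  Finsupp.linearCombination ℤ fun σ => realize σ (lsd n (Finsupp.single (vertices n) 1))

/-- The natural chain homotopy between barycentric subdivision and the identity. -/
noncomputable def ht (n : ℕ) : Chain n X →ₗ[ℤ] Chain (n + 1) X :=
  Finsupp.linearCombination ℤ fun σ => realize σ (lht n (Finsupp.single (vertices n) 1))

theorem sd_single {n : ℕ} (σ : Sing n X) :
    sd n (Finsupp.single σ 1) = realize σ (lsd n (Finsupp.single (vertices n) 1)) := by
  simp [sd]

theorem ht_single {n : ℕ} (σ : Sing n X) :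
    ht n (Finsupp.single σ 1) = realize σ (lht n (Finsupp.single (vertices n) 1)) := by
  simp [ht]

theorem affineIn_comp_vertices {n m : ℕ} (v : Fin (n + 1) → Simplex m) :
    affineIn v ∘ vertices n = v :=
  funext (affineIn_apply_vertices v)

theorem sd_realize {n m : ℕ} (σ : Sing m X) (c : LChain n m) :
    sd n (realize σ c) = realize σ (lsd n c) := by
  suffices h : sd n ∘ₗ realize σ = realize σ ∘ₗ lsd n from LinearMap.congr_fun h c
  refine Finsupp.lhom_ext' fun v => LinearMap.ext_ring ?_
  simp only [LinearMap.comp_apply, Finsupp.lsingle_apply, realize_single, sd_single]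
  rw [realize_comp, ← lsd_lpush, lpush_single, affineIn_comp_vertices]

theorem ht_realize {n m : ℕ} (σ : Sing m X) (c : LChain n m) :
    ht n (realize σ c) = realize σ (lht n c) := by
  suffices h : ht n ∘ₗ realize σ = realize σ ∘ₗ lht n from LinearMap.congr_fun h c
  refine Finsupp.lhom_ext' fun v => LinearMap.ext_ring ?_
  simp only [LinearMap.comp_apply, Finsupp.lsingle_apply, realize_single, ht_single]
  rw [realize_comp, ← lht_lpush, lpush_single, affineIn_comp_vertices]

theorem bd_sd {n : ℕ} (c : Chain (n + 1) X) : bd (sd (n + 1) c) = sd n (bd c) := by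
  suffices h : bd ∘ₗ sd (n + 1) = sd n ∘ₗ (bd (X := X)) from LinearMap.congr_fun h c
  refine Finsupp.lhom_ext' fun σ => LinearMap.ext_ring ?_
  simp only [LinearMap.comp_apply, Finsupp.lsingle_apply]
  rw [← realize_vertices σ, sd_realize, bd_realize, bd_realize, sd_realize, lbd_lsd]

theorem bd_ht {n : ℕ} (c : Chain (n + 1) X) :
    bd (ht (n + 1) c) = c - sd (n + 1) c - ht n (bd c) := by
  suffices h : bd ∘ₗ ht (n + 1) = LinearMap.id - sd (n + 1) - ht n ∘ₗ (bd (X := X)) from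
    LinearMap.congr_fun h c
  refine Finsupp.lhom_ext' fun σ => LinearMap.ext_ring ?_
  simp only [LinearMap.comp_apply, Finsupp.lsingle_apply, LinearMap.sub_apply, LinearMap.id_apply]
  rw [← realize_vertices σ, ht_realize, sd_realize, bd_realize, bd_realize, ht_realize, lbd_lht]
  simp only [map_sub]

/-! #### Chains subordinate to a family of sets -/

/-- The submodule of chains all of whose simplices have image in a member of the family `𝒰`. -/
def small (n : ℕ) (𝒰 : Set (Set X)) : Submodule ℤ (Chain n X) :=
  Finsupp.supported ℤ ℤ {σ | ∃ U ∈ 𝒰, range σ ⊆ U}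

/-- The submodule of chains in the subset `U`. -/
abbrev chainsIn (n : ℕ) (U : Set X) : Submodule ℤ (Chain n X) := small n {U}

theorem single_mem_small {n : ℕ} {𝒰 : Set (Set X)} {σ : Sing n X} {U : Set X} (hU : U ∈ 𝒰)
    (h : range σ ⊆ U) (a : ℤ) : Finsupp.single σ a ∈ small n 𝒰 :=
  Finsupp.single_mem_supported ℤ a ⟨U, hU, h⟩

theorem single_mem_chainsIn {n : ℕ} {σ : Sing n X} {U : Set X} (h : range σ ⊆ U) (a : ℤ) :
    Finsupp.single σ a ∈ chainsIn n U :=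
  single_mem_small (mem_singleton U) h a

/-- Linear maps out of the small chains are controlled on single simplices. -/
theorem small_induction {n : ℕ} {𝒰 : Set (Set X)} {N : Type*} [AddCommGroup N]
    (f : Chain n X →ₗ[ℤ] N) (P : Submodule ℤ N)
    (h : ∀ σ : Sing n X, (∃ U ∈ 𝒰, range σ ⊆ U) → f (Finsupp.single σ 1) ∈ P)
    {c : Chain n X} (hc : c ∈ small n 𝒰) : f c ∈ P := by
  rw [small, Finsupp.supported_eq_span_single] at hc
  refine Submodule.span_induction (p := fun x _ => f x ∈ P) ?_ ?_ ?_ ?_ hc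
  · rintro _ ⟨σ, hσ, rfl⟩
    exact h σ hσ
  · simp
  · intro x y _ _ hx hy
    rw [map_add]
    exact P.add_mem hx hy
  · intro a x _ hx
    rw [map_smul]
    exact P.smul_mem a hx

theorem bd_mem_small {n : ℕ} {𝒰 : Set (Set X)} {c : Chain (n + 1) X} (hc : c ∈ small (n + 1) 𝒰) :
    bd c ∈ small n 𝒰 := by
  refine small_induction bd _ ?_ hc
  rintro σ ⟨U, hU, h⟩
  rw [bd_single]
  refine Submodule.sum_mem _ fun i _ => Submodule.smul_mem _ _ (single_mem_small hU ?_ 1)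
  rintro _ ⟨t, rfl⟩
  exact h ⟨_, rfl⟩

theorem realize_mem_chainsIn {n m : ℕ} {U : Set X} {σ : Sing m X} (h : range σ ⊆ U)
    (c : LChain n m) : realize σ c ∈ chainsIn n U := by
  induction c using Finsupp.induction_linear with
  | zero => simp
  | add f g hf hg => rw [map_add]; exact Submodule.add_mem _ hf hg
  | single v a =>
    rw [realize_single]
    refine single_mem_chainsIn ?_ a
    rintro _ ⟨t, rfl⟩
    exact h ⟨_, rfl⟩

theorem small_mono {n : ℕ} {𝒰 𝒱 : Set (Set X)} (h : ∀ U ∈ 𝒰, ∃ V ∈ 𝒱, U ⊆ V) :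
    small n 𝒰 ≤ small n 𝒱 := by
  refine Finsupp.supported_mono ?_
  rintro σ ⟨U, hU, hσ⟩
  obtain ⟨V, hV, hUV⟩ := h U hU
  exact ⟨V, hV, hσ.trans hUV⟩

theorem chainsIn_mono {n : ℕ} {U V : Set X} (h : U ⊆ V) : chainsIn n U ≤ chainsIn n V :=
  small_mono (by simpa using h)

theorem chainsIn_le_small {n : ℕ} {𝒰 : Set (Set X)} {U : Set X} (h : U ∈ 𝒰) :
    chainsIn n U ≤ small n 𝒰 :=
  small_mono (by simpa using ⟨U, h, subset_rfl⟩)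

theorem mem_chainsIn_inter {n : ℕ} {U V : Set X} {c : Chain n X} (hU : c ∈ chainsIn n U)
    (hV : c ∈ chainsIn n V) : c ∈ chainsIn n (U ∩ V) := by
  rw [chainsIn, small, Finsupp.mem_supported] at *
  intro σ hσ
  have h1 := hU hσ
  have h2 := hV hσ
  simp only [mem_singleton_iff, exists_eq_left] at *
  exact subset_inter h1 h2

theorem sd_mem_small {n : ℕ} {𝒰 : Set (Set X)} {c : Chain n X} (hc : c ∈ small n 𝒰) :
    sd n c ∈ small n 𝒰 := by
  refine small_induction (sd n) _ ?_ hc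
  rintro σ ⟨U, hU, h⟩
  rw [sd_single]
  exact chainsIn_le_small hU (realize_mem_chainsIn h _)

theorem ht_mem_small {n : ℕ} {𝒰 : Set (Set X)} {c : Chain n X} (hc : c ∈ small n 𝒰) :
    ht n c ∈ small (n + 1) 𝒰 := by
  refine small_induction (ht n) _ ?_ hc
  rintro σ ⟨U, hU, h⟩
  rw [ht_single]
  exact chainsIn_le_small hU (realize_mem_chainsIn h _)

theorem iterate_sd_mem_small {n : ℕ} {𝒰 : Set (Set X)} {c : Chain n X} (hc : c ∈ small n 𝒰)
    (k : ℕ) : (sd n)^[k] c ∈ small n 𝒰 := by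
  induction k with
  | zero => exact hc
  | succ k ih => rw [Function.iterate_succ_apply']; exact sd_mem_small ih

theorem bd_iterate_sd {n : ℕ} (c : Chain (n + 1) X) (k : ℕ) :
    bd ((sd (n + 1))^[k] c) = (sd n)^[k] (bd c) := by
  induction k with
  | zero => rfl
  | succ k ih => rw [Function.iterate_succ_apply', Function.iterate_succ_apply', bd_sd, ih]

/-- A small cycle is homologous, through small chains, to its iterated subdivisions. -/
theorem exists_bd_eq_sub_iterate_sd {n : ℕ} {𝒰 : Set (Set X)} {c : Chain (n + 1) X}
    (hc : c ∈ small (n + 1) 𝒰) (hcycle : bd c = 0) (k : ℕ) :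
    ∃ y ∈ small (n + 2) 𝒰, bd y = c - (sd (n + 1))^[k] c := by
  induction k with
  | zero => exact ⟨0, Submodule.zero_mem _, by simp⟩
  | succ k ih =>
    obtain ⟨y, hy, hyb⟩ := ih
    refine ⟨y + ht (n + 1) ((sd (n + 1))^[k] c),
      Submodule.add_mem _ hy (ht_mem_small (iterate_sd_mem_small hc k)), ?_⟩
    rw [map_add, hyb, bd_ht, bd_iterate_sd, hcycle, Function.iterate_succ_apply']
    have : (sd n)^[k] (0 : Chain n X) = 0 := by
      clear * -
      induction k with
      | zero => rfl
      | succ k ih => rw [Function.iterate_succ_apply', ih, map_zero]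
    rw [this, map_zero]
    abel

end SingularChain

namespace SingularChain

variable {X : Type*} [TopologicalSpace X]

/-! #### Subdivisions become small -/

theorem dist_affineIn_le {n m : ℕ} {v : Fin (n + 1) → Simplex m} {p : Simplex m} {ρ : ℝ}
    (h : ∀ i, dist p (v i) ≤ ρ) (t : Simplex n) : dist p (affineIn v t) ≤ ρ := by
  rw [dist_comm, Subtype.dist_eq, affineIn_coe]
  refine (convex_closedBall p.1 ρ).sum_mem (fun i _ => t.2.1 i) t.2.2 fun i _ => ?_
  rw [Metric.mem_closedBall, dist_comm]
  exact h i

theorem dist_barycentre_le {n m : ℕ} {v : Fin (n + 1) → Simplex m} {r : ℝ}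
    (h : ∀ i j, dist (v i) (v j) ≤ r) (j : Fin (n + 1)) :
    dist (barycentre v) (v j) ≤ n / (n + 1) * r := by
  have hn : (n : ℝ) + 1 ≠ 0 := by positivity
  have h1 : (barycentre v).1 - (v j).1 = ∑ i, ((n : ℝ) + 1)⁻¹ • ((v i).1 - (v j).1) := by
    simp only [barycentre_coe, smul_sub, Finset.sum_sub_distrib, Finset.sum_const,
      Finset.card_univ, Fintype.card_fin, ← Nat.cast_smul_eq_nsmul ℝ, smul_smul]
    congr 1
    push_cast
    rw [mul_inv_cancel₀ hn, one_smul]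
  rw [Subtype.dist_eq, dist_eq_norm, h1, Fin.sum_univ_succAbove _ j, sub_self, smul_zero, zero_add]
  refine (norm_sum_le_of_le (n := fun _ => ((n : ℝ) + 1)⁻¹ * r) _ fun i _ => ?_).trans ?_
  · rw [norm_smul, Real.norm_of_nonneg (by positivity), ← dist_eq_norm, ← Subtype.dist_eq]
    exact mul_le_mul_of_nonneg_left (h _ _) (by positivity)
  · simp only [Finset.sum_const, Finset.card_univ, Fintype.card_fin, nsmul_eq_mul]
    rw [div_eq_mul_inv, mul_assoc]

/-- The simplices of the subdivision of `v` stay in every ball that contains `v`, and the distance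
of their vertices is at most `n / (n + 1)` times that of the vertices of `v`. -/
theorem lsd_single_mem_supported {n m : ℕ} {v : Fin (n + 1) → Simplex m} {r : ℝ}
    (h : ∀ i j, dist (v i) (v j) ≤ r) :
    lsd n (Finsupp.single v 1) ∈ Finsupp.supported ℤ ℤ {w : Fin (n + 1) → Simplex m |
      (∀ p ρ, (∀ j, dist p (v j) ≤ ρ) → ∀ i, dist p (w i) ≤ ρ) ∧
      ∀ i j, dist (w i) (w j) ≤ n / (n + 1) * r} := by
  have hr : 0 ≤ r := dist_nonneg.trans (h 0 0)
  induction n with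
  | zero =>
    refine Finsupp.single_mem_supported ℤ 1 ⟨fun p ρ hp => hp, fun i j => ?_⟩
    rw [Fin.fin_one_eq_zero i, Fin.fin_one_eq_zero j]
    simp
  | succ n ih =>
    rw [lsd_succ_single, lbd_single]
    simp only [map_sum, map_smul]
    refine Submodule.sum_mem _ fun i _ => Submodule.smul_mem _ _ ?_
    have h1 := ih (v := v ∘ i.succAbove) fun j k => h _ _
    rw [Finsupp.mem_supported] at h1 ⊢
    have h2 : ((n : ℝ) / (n + 1)) ≤ (((n + 1 : ℕ) : ℝ) / ((n + 1 : ℕ) + 1)) := by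
      rw [div_le_div_iff₀ (by positivity) (by positivity)]
      push_cast
      nlinarith
    have hb : ∀ p ρ, (∀ j, dist p (v j) ≤ ρ) → dist p (barycentre v) ≤ ρ :=
      fun p ρ hp => dist_affineIn_le hp _
    intro w hw
    classical
    obtain ⟨w', hw', rfl⟩ := Finset.mem_image.1 (Finsupp.mapDomain_support hw)
    obtain ⟨h3, h4⟩ := h1 hw'
    have hbw (i) : dist (barycentre v) (w' i) ≤ ((n + 1 : ℕ) : ℝ) / ((n + 1 : ℕ) + 1) * r :=
      h3 _ _ (fun j => dist_barycentre_le h _) i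
    refine ⟨fun p ρ hp j => ?_, fun j k => ?_⟩
    · refine Fin.cases ?_ (fun j => ?_) j
      · exact hb p ρ hp
      · exact h3 p ρ (fun j => hp _) j
    · refine Fin.cases ?_ (fun j => ?_) j <;> refine Fin.cases ?_ (fun k => ?_) k
      · simp only [Fin.cons_zero, dist_self]; positivity
      · exact hbw k
      · rw [dist_comm]; exact hbw j
      · exact (h4 j k).trans (mul_le_mul_of_nonneg_right h2 hr)

theorem iterate_lsd_mem_supported {n : ℕ} (k : ℕ) :
    (lsd n)^[k] (Finsupp.single (vertices n) 1) ∈ Finsupp.supported ℤ ℤ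
      {w : Fin (n + 1) → Simplex n | ∀ i j, dist (w i) (w j) ≤ ((n : ℝ) / (n + 1)) ^ k} := by
  induction k with
  | zero =>
    refine Finsupp.single_mem_supported ℤ 1 fun i j => ?_
    rw [pow_zero, Subtype.dist_eq]
    exact (Metric.dist_le_diam_of_mem (bounded_stdSimplex _) (vertices n i).2
      (vertices n j).2).trans diam_stdSimplex_le
  | succ k ih =>
    rw [Function.iterate_succ_apply']
    generalize (lsd n)^[k] (Finsupp.single (vertices n) 1) = c at ih
    rw [Finsupp.supported_eq_span_single] at ih
    refine Submodule.span_induction (p := fun x _ => lsd n x ∈ Finsupp.supported ℤ ℤ _)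
      ?_ (by simp) (fun x y _ _ hx hy => ?_) (fun a x _ hx => ?_) ih
    · rintro _ ⟨w, hw, rfl⟩
      refine Finsupp.supported_mono ?_ (lsd_single_mem_supported hw)
      rintro u ⟨-, hu⟩ i j
      rw [pow_succ, mul_comm]
      exact hu i j
    · rw [map_add]; exact Submodule.add_mem _ hx hy
    · rw [map_smul]; exact Submodule.smul_mem _ _ hx

theorem iterate_sd_realize {n m : ℕ} (σ : Sing m X) (c : LChain n m) (k : ℕ) :
    (sd n)^[k] (realize σ c) = realize σ ((lsd n)^[k] c) := by
  induction k with
  | zero => rfl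
  | succ k ih => rw [Function.iterate_succ_apply', Function.iterate_succ_apply', ih, sd_realize]

/-- Some iterated subdivision of a chain in the union of a family of open sets is subordinate to
the family. -/
theorem exists_iterate_sd_mem_small {n : ℕ} {𝒰 : Set (Set X)} (ho : ∀ U ∈ 𝒰, IsOpen U)
    {c : Chain n X} (hc : c ∈ chainsIn n (⋃₀ 𝒰)) : ∃ k, ∀ l ≥ k, (sd n)^[l] c ∈ small n 𝒰 := by
  have hlin (l : ℕ) (a b : Chain n X) : (sd n)^[l] (a + b) = (sd n)^[l] a + (sd n)^[l] b := by
    induction l with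
    | zero => rfl
    | succ l ih => simp only [Function.iterate_succ_apply', ih, map_add]
  have hlin' (l : ℕ) (a : ℤ) (b : Chain n X) : (sd n)^[l] (a • b) = a • (sd n)^[l] b := by
    induction l with
    | zero => rfl
    | succ l ih => simp only [Function.iterate_succ_apply', ih, map_smul]
  rw [chainsIn, small, Finsupp.supported_eq_span_single] at hc
  refine Submodule.span_induction (p := fun c _ => ∃ k, ∀ l ≥ k, (sd n)^[l] c ∈ small n 𝒰)
    ?_ ?_ (fun f g _ _ hf hg => ?_) (fun a f _ hf => ?_) hc
  rotate_left
  · exact ⟨0, fun l _ => iterate_sd_mem_small (Submodule.zero_mem _) l⟩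
  · obtain ⟨k, hk⟩ := hf
    obtain ⟨k', hk'⟩ := hg
    refine ⟨max k k', fun l hl => ?_⟩
    rw [hlin]
    exact Submodule.add_mem _ (hk l (le_trans (le_max_left _ _) hl))
      (hk' l (le_trans (le_max_right _ _) hl))
  · obtain ⟨k, hk⟩ := hf
    refine ⟨k, fun l hl => ?_⟩
    rw [hlin']
    exact Submodule.smul_mem _ _ (hk l hl)
  · rintro _ ⟨σ, ⟨_, rfl, hσ⟩, rfl⟩
    obtain ⟨δ, hδ, hleb⟩ := lebesgue_number_lemma_of_metric_sUnion (s := (univ : Set (Simplex n)))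
      (c := {V | ∃ U ∈ 𝒰, V = σ ⁻¹' U}) isCompact_univ
      (by rintro _ ⟨U, hU, rfl⟩; exact (ho U hU).preimage σ.continuous)
      (fun x _ => by
        obtain ⟨U, hU, hx⟩ : σ x ∈ ⋃₀ 𝒰 := hσ ⟨x, rfl⟩
        exact ⟨_, ⟨U, hU, rfl⟩, hx⟩)
    have hlt : ((n : ℝ) / (n + 1)) < 1 := by
      rw [div_lt_one (by positivity)]; linarith
    obtain ⟨k, hk⟩ := exists_pow_lt_of_lt_one hδ hlt
    refine ⟨k, fun l hl => ?_⟩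
    have hl' : ((n : ℝ) / (n + 1)) ^ l < δ :=
      (pow_le_pow_of_le_one (by positivity) hlt.le hl).trans_lt hk
    simp only
    rw [← realize_vertices, iterate_sd_realize]
    have h1 := iterate_lsd_mem_supported (n := n) l
    generalize (lsd n)^[l] (Finsupp.single (vertices n) 1) = b at h1
    rw [Finsupp.supported_eq_span_single] at h1
    refine Submodule.span_induction (p := fun x _ => realize σ x ∈ small n 𝒰)
      ?_ (by simp) (fun x y _ _ hx hy => ?_) (fun a x _ hx => ?_) h1
    · rintro _ ⟨w, hw, rfl⟩
      obtain ⟨_, ⟨U, hU, rfl⟩, hball⟩ := hleb (w 0) (mem_univ _)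
      simp only [realize_single]
      refine single_mem_small hU ?_ 1
      rintro _ ⟨t, rfl⟩
      refine hball ?_
      rw [Metric.mem_ball, dist_comm]
      exact (dist_affineIn_le (fun j => hw 0 j) t).trans_lt hl'
    · rw [map_add]; exact Submodule.add_mem _ hx hy
    · rw [map_smul]; exact Submodule.smul_mem _ _ hx

theorem chainsIn_univ {n : ℕ} : chainsIn n (univ : Set X) = ⊤ := by
  rw [chainsIn, small]
  refine (congrArg _ ?_).trans Finsupp.supported_univ
  ext σ
  simp

/-! #### Two consequences of subdivision -/

/-- Part of the Mayer–Vietoris sequence: if `H₂(X) = 0` and `X = U ∪ V`, then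
`H₁(U ∩ V) → H₁(U) ⊕ H₁(V)` is injective. -/
theorem exists_bd_eq_of_inter {U V : Set X} (hU : IsOpen U) (hV : IsOpen V) (hUV : U ∪ V = univ)
    (H2 : ∀ c : Chain 2 X, bd c = 0 → ∃ w, bd w = c) {z : Chain 1 X} (hz : bd z = 0)
    (hzUV : z ∈ chainsIn 1 (U ∩ V))
    (hzU : ∃ u ∈ chainsIn 2 U, bd u = z) (hzV : ∃ v ∈ chainsIn 2 V, bd v = z) :
    ∃ y ∈ chainsIn 2 (U ∩ V), bd y = z := by
  obtain ⟨u, huU, hu⟩ := hzU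
  obtain ⟨v, hvV, hv⟩ := hzV
  obtain ⟨w, hw⟩ := H2 (u - v) (by rw [map_sub, hu, hv, sub_self])
  obtain ⟨k, hk⟩ := exists_iterate_sd_mem_small (n := 3) (𝒰 := {U, V})
    (by rintro W (rfl | rfl) <;> assumption) (c := w)
    (by rw [sUnion_pair, hUV, chainsIn_univ]; trivial)
  have hsmall : small 3 {U, V} ≤ chainsIn 3 U ⊔ chainsIn 3 V := by
    rw [chainsIn, chainsIn, small, small, small, ← Finsupp.supported_union]
    refine Finsupp.supported_mono ?_
    rintro σ ⟨W, rfl | rfl, hσ⟩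
    · exact Or.inl ⟨_, rfl, hσ⟩
    · exact Or.inr ⟨_, rfl, hσ⟩
  obtain ⟨a, ha, b, hb, hab⟩ := Submodule.mem_sup.1 (hsmall (hk k le_rfl))
  have hsub : (sd 2)^[k] (u - v) = (sd 2)^[k] u - (sd 2)^[k] v := by
    clear * -
    induction k with
    | zero => rfl
    | succ k ih => simp only [Function.iterate_succ_apply', ih, map_sub]
  have e : (sd 2)^[k] u - bd a = (sd 2)^[k] v + bd b := by
    have : bd a + bd b = (sd 2)^[k] u - (sd 2)^[k] v := by
      rw [← map_add, hab, bd_iterate_sd, hw, hsub]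
    rw [sub_eq_iff_eq_add, add_assoc, add_comm (bd b), this]
    abel
  obtain ⟨y', hy', hy'b⟩ := exists_bd_eq_sub_iterate_sd hzUV hz k
  refine ⟨y' + ((sd 2)^[k] u - bd a), Submodule.add_mem _ hy' (mem_chainsIn_inter ?_ ?_), ?_⟩
  · exact Submodule.sub_mem _ (iterate_sd_mem_small huU k) (bd_mem_small ha)
  · rw [e]
    exact Submodule.add_mem _ (iterate_sd_mem_small hvV k) (bd_mem_small hb)
  · rw [map_add, hy'b, map_sub, bd_bd, bd_iterate_sd, hu]
    abel

/-- A 1-cochain that satisfies the cocycle condition on the 2-simplices subordinate to a family of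
open sets vanishes on the subordinate 1-cycles that bound in the union of the family. -/
theorem cocycle_eq_zero_of_small {A : Type*} [AddCommGroup A] {𝒰 : Set (Set X)}
    (ho : ∀ U ∈ 𝒰, IsOpen U) (F : Chain 1 X →ₗ[ℤ] A)
    (hF : ∀ τ : Sing 2 X, (∃ U ∈ 𝒰, range τ ⊆ U) → F (bd (Finsupp.single τ 1)) = 0)
    {y : Chain 2 X} (hyU : y ∈ chainsIn 2 (⋃₀ 𝒰)) (hy : bd y ∈ small 1 𝒰) : F (bd y) = 0 := by
  have hF' {c : Chain 2 X} (hc : c ∈ small 2 𝒰) : F (bd c) = 0 := by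
    have := small_induction (F ∘ₗ bd) ⊥ (fun τ hτ => by simpa using hF τ hτ) hc
    simpa using this
  obtain ⟨k, hk⟩ := exists_iterate_sd_mem_small ho hyU
  obtain ⟨y', hy', hy'b⟩ := exists_bd_eq_sub_iterate_sd hy (bd_bd y) k
  have h1 := hF' hy'
  have h2 := hF' (hk k le_rfl)
  rwa [hy'b, map_sub, ← bd_iterate_sd, h2, sub_zero] at h1

end SingularChain

/-! ### Comparison with singular homology -/

namespace SingularChain

open AlgebraicTopology Simplicial

theorem hom_apply_congr {A B : ModuleCat.{0} ℤ} {f g : A ⟶ B} (h : f = g) (x : A) :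
    f.hom x = g.hom x := by rw [h]

/-- The integral singular chain complex of a space, as a complex of `ℤ`-modules. -/
noncomputable abbrev singularComplex (X : Type) [TopologicalSpace X] :
    ChainComplex (ModuleCat.{0} ℤ) ℕ :=
  (TopCat.toSSet.obj (TopCat.of X)).chainComplex (ModuleCat.of ℤ ℤ)

variable {X Y : Type} [TopologicalSpace X] [TopologicalSpace Y]

/-- The map of singular complexes induced by a continuous map. -/
noncomputable abbrev singularMap (f : C(X, Y)) : singularComplex X ⟶ singularComplex Y :=
  SSet.chainComplexMap (TopCat.toSSet.map (TopCat.ofHom f)) (ModuleCat.of ℤ ℤ)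

/-- The generator of the singular complex given by a singular simplex. -/
noncomputable def gen {n : ℕ} (σ : Sing n X) : (singularComplex X).X n :=
  (SSet.ιChainComplex (TopCat.toSSet.obj (TopCat.of X)) (R := ModuleCat.of ℤ ℤ)
    (((TopCat.of X).toSSetObjEquiv (.op ⦋n⦌)).symm σ)).hom (1 : ℤ)

/-- The comparison map to the chains of the singular complex. -/
noncomputable def toComplex {n : ℕ} : Chain n X →ₗ[ℤ] (singularComplex X).X n :=
  Finsupp.linearCombination ℤ gen

@[simp] theorem toComplex_single {n : ℕ} (σ : Sing n X) :
    toComplex (Finsupp.single σ 1) = gen σ := by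
  rw [toComplex, Finsupp.linearCombination_single]
  exact (int_smul_eq_zsmul _ 1 (gen σ)).trans (one_zsmul _)

theorem toComplex_smul {n : ℕ} (k : ℤ) (c : Chain n X) : toComplex (k • c) = k • toComplex c :=
  (toComplex.map_smul k c).trans (int_smul_eq_zsmul _ _ _)

/-- The inverse of the comparison map. -/
noncomputable def ofComplex {n : ℕ} : (singularComplex X).X n ⟶ ModuleCat.of ℤ (Chain n X) :=
  Limits.Sigma.desc fun x => ModuleCat.ofHom
    (Finsupp.lsingle ((TopCat.of X).toSSetObjEquiv (.op ⦋n⦌) x))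

theorem ι_ofComplex {n : ℕ} (x) :
    SSet.ιChainComplex (TopCat.toSSet.obj (TopCat.of X)) (R := ModuleCat.of ℤ ℤ) x ≫
      ofComplex (n := n) = ModuleCat.ofHom
    (Finsupp.lsingle ((TopCat.of X).toSSetObjEquiv (.op ⦋n⦌) x)) :=
  Limits.Sigma.ι_desc _ _

theorem ofComplex_gen {n : ℕ} (σ : Sing n X) : ofComplex.hom (gen σ) = Finsupp.single σ 1 := by
  have := hom_apply_congr (ι_ofComplex (((TopCat.of X).toSSetObjEquiv (.op ⦋n⦌)).symm σ))
    (1 : ℤ)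
  refine Eq.trans this ?_
  simp

theorem ofComplex_toComplex {n : ℕ} (c : Chain n X) : ofComplex.hom (toComplex c) = c := by
  suffices h : ofComplex.hom ∘ₗ toComplex = LinearMap.id from LinearMap.congr_fun h c
  refine Finsupp.lhom_ext' fun σ => LinearMap.ext_ring ?_
  simp only [LinearMap.comp_apply, Finsupp.lsingle_apply, toComplex_single]
  exact ofComplex_gen σ

theorem toComplex_ofComplex {n : ℕ} (c : (singularComplex X).X n) :
    toComplex (ofComplex.hom c) = c := by
  suffices h : ofComplex ≫ ModuleCat.ofHom toComplex = 𝟙 ((singularComplex X).X n) from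
    hom_apply_congr h c
  refine SSet.chainComplex_hom_ext fun x => ?_
  rw [← Category.assoc, ι_ofComplex, Category.comp_id]
  ext
  refine (toComplex_single _).trans ?_
  simp [gen]

theorem d_gen {n : ℕ} (σ : Sing (n + 1) X) :
    ((singularComplex X).d (n + 1) n).hom (gen σ) =
      ∑ i : Fin (n + 2), (-1 : ℤ) ^ (i : ℕ) • gen (face i σ) := by
  have := hom_apply_congr (SSet.ιChainComplex_d (TopCat.toSSet.obj (TopCat.of X))
    (ModuleCat.of ℤ ℤ) (((TopCat.of X).toSSetObjEquiv (.op ⦋n + 1⦌)).symm σ)) (1 : ℤ)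
  refine Eq.trans this ?_
  rw [ModuleCat.hom_sum]
  simp only [LinearMap.sum_apply]
  refine Finset.sum_congr rfl fun i _ => ?_
  rfl

theorem d_toComplex {n : ℕ} (c : Chain (n + 1) X) :
    ((singularComplex X).d (n + 1) n).hom (toComplex c) = toComplex (bd c) := by
  suffices h : ((singularComplex X).d (n + 1) n).hom ∘ₗ toComplex = toComplex ∘ₗ bd from
    LinearMap.congr_fun h c
  refine Finsupp.lhom_ext' fun σ => LinearMap.ext_ring ?_
  simp only [LinearMap.comp_apply, Finsupp.lsingle_apply, toComplex_single, bd_single, d_gen,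
    map_sum]
  refine Finset.sum_congr rfl fun i _ => ?_
  rw [toComplex_smul, toComplex_single]

theorem singularMap_toComplex {n : ℕ} (f : C(X, Y)) (c : Chain n X) :
    ((singularMap f).f n).hom (toComplex c) = toComplex (push f c) := by
  suffices h : ((singularMap f).f n).hom ∘ₗ toComplex = toComplex ∘ₗ push f from
    LinearMap.congr_fun h c
  refine Finsupp.lhom_ext' fun σ => LinearMap.ext_ring ?_
  simp only [LinearMap.comp_apply, Finsupp.lsingle_apply, toComplex_single, push_single]
  exact hom_apply_congr (SSet.ι_chainComplexMap_f _ _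
    (TopCat.toSSet.map (TopCat.ofHom f)) (ModuleCat.of ℤ ℤ)
    (((TopCat.of X).toSSetObjEquiv (.op ⦋n⦌)).symm σ)) (1 : ℤ)

theorem toComplex_injective {n : ℕ} : Function.Injective (toComplex (n := n) (X := X)) :=
  Function.LeftInverse.injective ofComplex_toComplex

/-- If the homology vanishes then cycles are boundaries. -/
theorem exists_bd_eq_of_isZero {n : ℕ}
    (h : Limits.IsZero ((integralHomology (n + 1)).obj (TopCat.of X)))
    {c : Chain (n + 1) X} (hc : bd c = 0) : ∃ w, bd w = c := by
  have h1 : (singularComplex X).ExactAt (n + 1) := by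
    rw [HomologicalComplex.exactAt_iff_isZero_homology]
    exact h
  rw [HomologicalComplex.exactAt_iff' _ (n + 2) (n + 1) n (by simp) (by simp),
    ShortComplex.moduleCat_exact_iff] at h1
  obtain ⟨w, hw⟩ := h1 (toComplex c : (singularComplex X).X (n + 1)) (by
    refine (d_toComplex c).trans ?_
    rw [hc]
    exact map_zero _)
  have hw' : ((singularComplex X).d (n + 2) (n + 1)).hom w = toComplex c := hw
  refine ⟨ofComplex.hom w, toComplex_injective ?_⟩
  rw [← d_toComplex, ← hw']
  congr 1
  exact toComplex_ofComplex w

/-- Two maps of complexes of modules agree on homology if and only if they send every cycle to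
homologous cycles. -/
theorem homologyMap_eq_iff {C D : ChainComplex (ModuleCat.{0} ℤ) ℕ} (f g : C ⟶ D) (n : ℕ) :
    HomologicalComplex.homologyMap f (n + 1) = HomologicalComplex.homologyMap g (n + 1) ↔
      ∀ z : C.X (n + 1), (C.d (n + 1) n).hom z = 0 →
        ∃ w : D.X (n + 2), (D.d (n + 2) (n + 1)).hom w =
          (f.f (n + 1)).hom z - (g.f (n + 1)).hom z := by
  have hD : ∀ a : D.cycles (n + 1), (D.homologyπ (n + 1)).hom a = 0 ↔
      ∃ w : D.X (n + 2), (D.d (n + 2) (n + 1)).hom w = (D.iCycles (n + 1)).hom a := by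
    intro a
    have hex :
        (ShortComplex.mk (D.toCycles (n + 2) (n + 1)) (D.homologyπ (n + 1)) (by simp)).Exact :=
      ShortComplex.exact_of_g_is_cokernel _ (D.homologyIsCokernel (n + 2) (n + 1) (by simp))
    rw [ShortComplex.moduleCat_exact_iff] at hex
    have hcomp (w : D.X (n + 2)) : (D.iCycles (n + 1)).hom ((D.toCycles (n + 2) (n + 1)).hom w) =
        (D.d (n + 2) (n + 1)).hom w :=
      hom_apply_congr (D.toCycles_i (n + 2) (n + 1)) w
    constructor
    · intro h
      obtain ⟨w, hw⟩ := hex a h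
      have hw' : (D.toCycles (n + 2) (n + 1)).hom w = a := hw
      exact ⟨w, by rw [← hcomp, hw']⟩
    · rintro ⟨w, hw⟩
      have hinj : Function.Injective (D.iCycles (n + 1)).hom :=
        (ModuleCat.mono_iff_injective _).1 inferInstance
      have : (D.toCycles (n + 2) (n + 1)).hom w = a := hinj (by rw [hcomp, hw])
      rw [← this]
      exact hom_apply_congr (D.toCycles_comp_homologyπ (n + 2) (n + 1)) w
  have hπ (f : C ⟶ D) (a : C.cycles (n + 1)) :
      (HomologicalComplex.homologyMap f (n + 1)).hom ((C.homologyπ (n + 1)).hom a) =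
        (D.homologyπ (n + 1)).hom ((HomologicalComplex.cyclesMap f (n + 1)).hom a) :=
    hom_apply_congr (HomologicalComplex.homologyπ_naturality f (n + 1)) a
  have hi (f : C ⟶ D) (a : C.cycles (n + 1)) :
      (D.iCycles (n + 1)).hom ((HomologicalComplex.cyclesMap f (n + 1)).hom a) =
        (f.f (n + 1)).hom ((C.iCycles (n + 1)).hom a) :=
    hom_apply_congr (HomologicalComplex.cyclesMap_i f (n + 1)) a
  have key (a : C.cycles (n + 1)) :
      (HomologicalComplex.homologyMap f (n + 1)).hom ((C.homologyπ (n + 1)).hom a) =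
        (HomologicalComplex.homologyMap g (n + 1)).hom ((C.homologyπ (n + 1)).hom a) ↔
      ∃ w : D.X (n + 2), (D.d (n + 2) (n + 1)).hom w =
        (f.f (n + 1)).hom ((C.iCycles (n + 1)).hom a) -
          (g.f (n + 1)).hom ((C.iCycles (n + 1)).hom a) := by
    rw [hπ, hπ, ← sub_eq_zero, ← map_sub, hD, map_sub, hi, hi]
  constructor
  · intro h z hz
    have hexact : (ShortComplex.mk (C.iCycles (n + 1)) (C.d (n + 1) n) (by simp)).Exact :=
      ShortComplex.exact_of_f_is_kernel _ (C.cyclesIsKernel (n + 1) n (by simp))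
    rw [ShortComplex.moduleCat_exact_iff] at hexact
    obtain ⟨a, ha⟩ := hexact z hz
    have ha' : (C.iCycles (n + 1)).hom a = z := ha
    rw [← ha', ← key, h]
  · intro h
    ext x
    have hsurj : Function.Surjective (C.homologyπ (n + 1)).hom :=
      (ModuleCat.epi_iff_surjective _).1 inferInstance
    obtain ⟨a, rfl⟩ := hsurj x
    refine (key a).2 (h _ ?_)
    exact hom_apply_congr (C.iCycles_d (n + 1) n) a

/-- The maps on `H₁` induced by two maps agree up to a factor `k` if and only if the images of
every cycle are homologous up to the factor `k`. -/
theorem integralHomology_map_eq_smul_iff (f g : C(X, Y)) (k : ℤ) :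
    (integralHomology 1).map (TopCat.ofHom f) = k • (integralHomology 1).map (TopCat.ofHom g) ↔
      ∀ z : Chain 1 X, bd z = 0 → ∃ w, bd w = push f z - k • push g z := by
  have h1 : k • (integralHomology 1).map (TopCat.ofHom g) =
      HomologicalComplex.homologyMap (k • singularMap g) 1 :=
    ((HomologicalComplex.homologyFunctor (ModuleCat.{0} ℤ) (ComplexShape.down ℕ) 1).map_zsmul).symm
  have h2 : (integralHomology 1).map (TopCat.ofHom f) =
      HomologicalComplex.homologyMap (singularMap f) 1 := rfl
  refine Iff.trans (Eq.to_iff (by rw [h1, h2]; rfl))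
    ((homologyMap_eq_iff (singularMap f) (k • singularMap g) 0).trans ?_)
  have e (z : Chain 1 X) : ((k • singularMap g).f 1).hom (toComplex z) =
      toComplex (k • push g z) := by
    rw [toComplex_smul, ← singularMap_toComplex]
    rfl
  constructor
  · intro h z hz
    obtain ⟨w, hw⟩ := h (toComplex z) (by rw [d_toComplex, hz]; exact map_zero _)
    rw [e, singularMap_toComplex, ← map_sub] at hw
    refine ⟨ofComplex.hom w, toComplex_injective ?_⟩
    rw [← d_toComplex, ← hw]
    congr 1
    exact toComplex_ofComplex w
  · intro h z hz
    obtain ⟨w, hw⟩ := h (ofComplex.hom z) (toComplex_injective (by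
      rw [← d_toComplex, map_zero, ← hz]
      congr 1
      exact toComplex_ofComplex z))
    refine ⟨toComplex w, ?_⟩
    rw [d_toComplex, hw, map_sub, ← e, ← singularMap_toComplex]
    have : toComplex (ofComplex.hom z) = z := toComplex_ofComplex z
    rw [this]

/-- Homotopic maps send cycles to homologous cycles. -/
theorem exists_bd_eq_push_sub_push {f g : C(X, Y)} (h : f.Homotopic g) {z : Chain 1 X}
    (hz : bd z = 0) : ∃ w, bd w = push f z - push g z := by
  obtain ⟨H⟩ := h
  have h1 : (integralHomology 1).map (TopCat.ofHom f) =
      (1 : ℤ) • (integralHomology 1).map (TopCat.ofHom g) := by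
    rw [one_smul]
    exact TopCat.Homotopy.congr_homologyMap_singularChainComplexFunctor
      (f := TopCat.ofHom f) (g := TopCat.ofHom g) H (ModuleCat.of ℤ ℤ) 1
  simpa using (integralHomology_map_eq_smul_iff f g 1).1 h1 z hz

end SingularChain

/-! ### Paths and the homology of the circle -/

namespace SingularChain

section Paths

variable {X Y : Type*} [TopologicalSpace X] [TopologicalSpace Y]

/-- The 0-simplex at a point. -/
def pt (x : X) : Sing 0 X := ContinuousMap.const _ x

/-- The initial vertex of a singular 1-simplex. -/
noncomputable def src (σ : Sing 1 X) : X := σ (vertices 1 0)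

/-- The final vertex of a singular 1-simplex. -/
noncomputable def tgt (σ : Sing 1 X) : X := σ (vertices 1 1)

instance : Unique (Simplex 0) := inferInstanceAs (Unique (stdSimplex ℝ (Fin 1)))

theorem eq_pt (σ : Sing 0 X) (t : Simplex 0) : σ = pt (σ t) := by
  ext s
  rw [Subsingleton.elim s t]
  rfl

theorem faceMap_vertices {n : ℕ} (i : Fin (n + 2)) (j : Fin (n + 1)) :
    faceMap i (vertices n j) = vertices (n + 1) (i.succAbove j) := by
  rw [faceMap_eq_affineIn, affineIn_apply_vertices]
  rfl

theorem bd_single_one (σ : Sing 1 X) :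
    bd (Finsupp.single σ 1) = Finsupp.single (pt (tgt σ)) 1 - Finsupp.single (pt (src σ)) 1 := by
  rw [bd_single, Fin.sum_univ_two, eq_pt (face 0 σ) (vertices 0 0), eq_pt (face 1 σ) (vertices 0 0)]
  simp only [face, ContinuousMap.comp_apply, faceMap_vertices]
  simp [src, tgt, sub_eq_add_neg]

theorem bd_single_two (τ : Sing 2 X) :
    bd (Finsupp.single τ 1) = Finsupp.single (face 0 τ) 1 - Finsupp.single (face 1 τ) 1 +
      Finsupp.single (face 2 τ) 1 := by
  rw [bd_single, Fin.sum_univ_three]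
  simp [sub_eq_add_neg]

/-- The singular 1-simplex that runs along the restriction of `g` to the segment from `a` to `b`. -/
noncomputable def seg (g : C(ℝ, X)) (a b : ℝ) : Sing 1 X := g.comp (affine ![a, b])

theorem affine_apply_vertices {E : Type*} [AddCommGroup E] [Module ℝ E] [TopologicalSpace E]
    [ContinuousAdd E] [ContinuousSMul ℝ E] {n : ℕ} (v : Fin (n + 1) → E) (i : Fin (n + 1)) :
    affine v (vertices n i) = v i := by
  change ∑ j, (vertices n i).1 j • v j = v i
  simp [vertices, Pi.single_apply]

@[simp] theorem src_seg (g : C(ℝ, X)) (a b : ℝ) : src (seg g a b) = g a := by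
  simp [src, seg, affine_apply_vertices]

@[simp] theorem tgt_seg (g : C(ℝ, X)) (a b : ℝ) : tgt (seg g a b) = g b := by
  simp [tgt, seg, affine_apply_vertices]

theorem comp_seg (f : C(X, Y)) (g : C(ℝ, X)) (a b : ℝ) :
    f.comp (seg g a b) = seg (f.comp g) a b := rfl

theorem affine_pair_apply (a b : ℝ) (t : Simplex 1) :
    affine ![a, b] t = t.1 0 * a + t.1 1 * b := by
  change ∑ j, t.1 j • ![a, b] j = _
  simp

theorem bd_triangle (g : C(ℝ, X)) (a b c : ℝ) :
    bd (Finsupp.single (g.comp (affine ![a, b, c])) 1) =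
      Finsupp.single (seg g b c) 1 - Finsupp.single (seg g a c) 1 +
        Finsupp.single (seg g a b) 1 := by
  rw [bd_single_two]
  have h (i : Fin 3) : face i (g.comp (affine ![a, b, c])) =
      g.comp (affine (![a, b, c] ∘ i.succAbove)) := by
    rw [← affine_faceMap]; rfl
  have e0 : ![a, b, c] ∘ Fin.succAbove 0 = ![b, c] := by ext j; fin_cases j <;> rfl
  have e1 : ![a, b, c] ∘ Fin.succAbove 1 = ![a, c] := by ext j; fin_cases j <;> rfl
  have e2 : ![a, b, c] ∘ Fin.succAbove 2 = ![a, b] := by ext j; fin_cases j <;> rfl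
  rw [h, h, h, e0, e1, e2]
  rfl

theorem range_affine_pair_subset {a b : ℝ} (hab : a ≤ b) : range (affine ![a, b]) ⊆ Icc a b := by
  rintro _ ⟨t, rfl⟩
  refine (convex_Icc a b).sum_mem (fun i _ => t.2.1 i) t.2.2 fun i _ => ?_
  fin_cases i <;> constructor <;> simp <;> linarith

theorem single_const_mem_range_bd (x : X) (a : ℤ) :
    Finsupp.single (ContinuousMap.const (Simplex 1) x) a ∈
      LinearMap.range (bd (n := 1) (X := X)) := by
  refine ⟨a • Finsupp.single (ContinuousMap.const (Simplex 2) x) 1, ?_⟩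
  rw [map_smul, bd_single_two]
  have h (i : Fin 3) : face i (ContinuousMap.const (Simplex 2) x) =
    ContinuousMap.const (Simplex 1) x := rfl
  simp [h]

/-- A 1-cocycle that is the difference of a function at the end points of every simplex vanishes
on cycles. -/
theorem eq_zero_of_eq_sub {A : Type*} [AddCommGroup A] (F : Chain 1 X →ₗ[ℤ] A) (g : X → A)
    (P : Set (Sing 1 X))
    (h : ∀ σ ∈ P, F (Finsupp.single σ 1) = g (tgt σ) - g (src σ)) {z : Chain 1 X}
    (hzP : z ∈ Finsupp.supported ℤ ℤ P) (hz : bd z = 0) : F z = 0 := by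
  let G : Chain 0 X →ₗ[ℤ] A := Finsupp.linearCombination ℤ fun σ => g (σ (vertices 0 0))
  have h1 : (F - G ∘ₗ bd) z = 0 := by
    rw [Finsupp.supported_eq_span_single] at hzP
    refine Submodule.span_induction (p := fun x _ => (F - G ∘ₗ bd) x = 0) ?_ (by simp)
      (fun x y _ _ hx hy => by rw [map_add, hx, hy, add_zero])
      (fun a x _ hx => by rw [map_smul, hx, smul_zero]) hzP
    rintro _ ⟨σ, hσ, rfl⟩
    simp only [LinearMap.sub_apply, LinearMap.comp_apply, h σ hσ, bd_single_one, map_sub]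
    simp [G, pt]
  simpa [hz] using h1

end Paths

/-- In a convex subset of the line every 1-cycle bounds. -/
theorem exists_bd_eq_real {z : Chain 1 ℝ} (hz : bd z = 0) : ∃ w, bd w = z := by
  have h : (ContinuousMap.id ℝ).Homotopic (ContinuousMap.const ℝ 0) :=
    ⟨ContinuousMap.Homotopy.affine _ _⟩
  obtain ⟨w, hw⟩ := exists_bd_eq_push_sub_push h hz
  have h1 : push (ContinuousMap.id ℝ) z = z := by
    simp only [push, Finsupp.lmapDomain_apply, ContinuousMap.id_comp]
    exact Finsupp.mapDomain_id
  have h2 : push (ContinuousMap.const ℝ (0 : ℝ)) z ∈ LinearMap.range (bd (n := 1) (X := ℝ)) := by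
    clear * -
    induction z using Finsupp.induction_linear with
    | zero => simp
    | add f g hf hg => rw [map_add]; exact Submodule.add_mem _ hf hg
    | single σ a =>
      rw [push_single]
      exact single_const_mem_range_bd (0 : ℝ) a
  obtain ⟨w', hw'⟩ := h2
  exact ⟨w + w', by rw [map_add, hw, hw', h1]; abel⟩

/-- The covering of the circle by the line. -/
def toCircle : C(ℝ, UnitAddCircle) where
  toFun t := (t : UnitAddCircle)
  continuous_toFun := AddCircle.continuous_mk' 1

theorem toCircle_apply (t : ℝ) : toCircle t = (t : UnitAddCircle) := rfl

theorem toCircle_add_one (t : ℝ) : toCircle (t + 1) = toCircle t := by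
  rw [toCircle_apply, AddCircle.coe_add_period, toCircle_apply]

/-- The fundamental cycle of the circle. -/
noncomputable def circleCycle : Chain 1 UnitAddCircle := Finsupp.single (seg toCircle 0 1) 1

theorem bd_circleCycle : bd circleCycle = 0 := by
  rw [circleCycle, bd_single_one]
  have : toCircle 1 = toCircle 0 := by rw [← toCircle_add_one 0, zero_add]
  simp [this]

theorem exists_lift_toCircle (σ : Sing 1 UnitAddCircle) :
    ∃ σ' : Sing 1 ℝ, toCircle.comp σ' = σ := by
  have cov : IsCoveringMap ((↑) : ℝ → UnitAddCircle) := AddCircle.isCoveringMap_coe 1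
  let e := stdSimplexHomeomorphUnitInterval
  obtain ⟨x, hx⟩ := QuotientAddGroup.mk_surjective (σ (e.symm 0))
  obtain ⟨Γ, hΓ, -⟩ := cov.exists_path_lifts (σ.comp ⟨e.symm, e.symm.continuous⟩) x hx.symm
  refine ⟨Γ.comp ⟨e, e.continuous⟩, ContinuousMap.ext fun t => ?_⟩
  have h : toCircle (Γ (e t)) = σ (e.symm (e t)) := congrFun hΓ (e t)
  rw [e.symm_apply_apply] at h
  exact h

/-- `H₁` of the circle is generated by the fundamental cycle. -/
theorem exists_bd_eq_sub_smul_circleCycle {z : Chain 1 UnitAddCircle} (hz : bd z = 0) :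
    ∃ (k : ℤ) (w : Chain 2 UnitAddCircle), bd w = z - k • circleCycle := by
  let B : Submodule ℤ (Chain 1 UnitAddCircle) := LinearMap.range bd ⊔ Submodule.span ℤ {circleCycle}
  let F := B.mkQ
  have hFbd (w) : F (bd w) = 0 :=
    (Submodule.Quotient.mk_eq_zero B).2 (Submodule.mem_sup_left ⟨w, rfl⟩)
  have hFc : F circleCycle = 0 :=
    (Submodule.Quotient.mk_eq_zero B).2
      (Submodule.mem_sup_right (Submodule.mem_span_singleton_self _))
  let g : ℝ → Chain 1 UnitAddCircle ⧸ B := fun s => F (Finsupp.single (seg toCircle 0 s) 1)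
  have hg : Function.Periodic g 1 := by
    intro s
    have h1 := hFbd (Finsupp.single (toCircle.comp (affine ![0, 1, s + 1])) 1)
    rw [bd_triangle, map_add, map_sub] at h1
    have h2 : seg toCircle 1 (s + 1) = seg toCircle 0 s := by
      ext t
      simp only [seg, ContinuousMap.comp_apply, affine_pair_apply]
      have : t.1 0 * 1 + t.1 1 * (s + 1) = t.1 0 * 0 + t.1 1 * s + 1 := by
        have : t.1 0 + t.1 1 = 1 := by simpa using t.2.2
        linear_combination this
      rw [this, toCircle_add_one]
    rw [h2, ← circleCycle, hFc, add_zero, sub_eq_zero] at h1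
    exact h1.symm
  have key (σ : Sing 1 UnitAddCircle) :
      F (Finsupp.single σ 1) = hg.lift (tgt σ) - hg.lift (src σ) := by
    obtain ⟨σ', rfl⟩ := exists_lift_toCircle σ
    have h1 : hg.lift (tgt (toCircle.comp σ')) = g (tgt σ') := rfl
    have h2 : hg.lift (src (toCircle.comp σ')) = g (src σ') := rfl
    rw [h1, h2]
    obtain ⟨w, hw⟩ := exists_bd_eq_real (z := Finsupp.single σ' 1 -
      Finsupp.single (affine ![0, tgt σ']) 1 + Finsupp.single (affine ![0, src σ']) 1) (by
        simp only [map_add, map_sub, bd_single_one]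
        have h (a b : ℝ) : tgt (affine ![a, b]) = b ∧ src (affine ![a, b]) = a :=
          ⟨affine_apply_vertices _ _, affine_apply_vertices _ _⟩
        simp [h])
    have h3 := hFbd (push toCircle w)
    rw [bd_push, hw] at h3
    simp only [map_add, map_sub, push_single] at h3
    rw [sub_add, sub_eq_zero] at h3
    exact h3
  have hz0 : F z = 0 := eq_zero_of_eq_sub F hg.lift univ (fun σ _ => key σ)
    (by simp [Finsupp.supported_univ]) hz
  have hzB : z ∈ B := (Submodule.Quotient.mk_eq_zero B).1 hz0
  obtain ⟨_, ⟨w, rfl⟩, b, hb, hab⟩ := Submodule.mem_sup.1 hzB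
  obtain ⟨k, rfl⟩ := Submodule.mem_span_singleton.1 hb
  exact ⟨k, w, by rw [← hab]; abel⟩

end SingularChain

/-! ### Cocycles from local primitives -/

namespace SingularChain

section Cochains

variable {X : Type*} [TopologicalSpace X] {A : Type*} [AddCommGroup A]

/-- Functions on the members of a family of sets whose differences are locally constant define a
cochain: locally, its value is the difference of the function at the end points. -/
theorem exists_cochain {ι : Type*} (O : ι → Set X) (f : ι → X → A)
    (hloc : ∀ i j, ∀ x ∈ O i ∩ O j, ∀ᶠ q in 𝓝 x, q ∈ O i → q ∈ O j →
      f i q - f j q = f i x - f j x) :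
    ∃ F : Chain 1 X →ₗ[ℤ] A, ∀ i (σ : Sing 1 X), range σ ⊆ O i →
      F (Finsupp.single σ 1) = f i (tgt σ) - f i (src σ) := by
  classical
  have key (i j) (σ : Sing 1 X) (hi : range σ ⊆ O i) (hj : range σ ⊆ O j) :
      f i (tgt σ) - f i (src σ) = f j (tgt σ) - f j (src σ) := by
    have hc : IsLocallyConstant fun t => f i (σ t) - f j (σ t) := by
      rw [IsLocallyConstant.iff_eventually_eq]
      intro t
      filter_upwards [σ.continuous.continuousAt.eventually
        (hloc i j (σ t) ⟨hi ⟨t, rfl⟩, hj ⟨t, rfl⟩⟩)] with s hs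
      exact hs (hi ⟨s, rfl⟩) (hj ⟨s, rfl⟩)
    have := hc.apply_eq_of_preconnectedSpace (vertices 1 1) (vertices 1 0)
    rw [sub_eq_sub_iff_sub_eq_sub]
    exact this
  let F₀ : Sing 1 X → A := fun σ =>
    if h : ∃ i, range σ ⊆ O i then f h.choose (tgt σ) - f h.choose (src σ) else 0
  refine ⟨Finsupp.linearCombination ℤ F₀, fun i σ hi => ?_⟩
  have h : ∃ i, range σ ⊆ O i := ⟨i, hi⟩
  rw [Finsupp.linearCombination_single, one_smul]
  simp only [F₀, dif_pos h]
  exact key _ _ σ h.choose_spec hi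

theorem range_face_subset {n : ℕ} (σ : Sing (n + 1) X) (i : Fin (n + 2)) :
    range (face i σ) ⊆ range σ := by
  rintro _ ⟨t, rfl⟩
  exact ⟨_, rfl⟩

theorem bd_single_mem_supported {n : ℕ} (τ : Sing (n + 1) X) {P : Set (Sing n X)}
    (h : ∀ i, face i τ ∈ P) : bd (Finsupp.single τ 1) ∈ Finsupp.supported ℤ ℤ P := by
  rw [bd_single]
  exact Submodule.sum_mem _ fun i _ =>
    Submodule.smul_mem _ _ (Finsupp.single_mem_supported ℤ 1 (h i))

theorem _root_.JoinedIn.exists_sing {S : Set X} {a b : X} (h : JoinedIn S a b) :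
    ∃ σ : Sing 1 X, src σ = a ∧ tgt σ = b ∧ range σ ⊆ S := by
  obtain ⟨γ, hγ⟩ := h
  refine ⟨γ.toContinuousMap.comp ⟨stdSimplexHomeomorphUnitInterval,
    stdSimplexHomeomorphUnitInterval.continuous⟩, ?_, ?_, ?_⟩
  · change γ (stdSimplexHomeomorphUnitInterval ⟨_, single_mem_stdSimplex ℝ 0⟩) = a
    rw [stdSimplexHomeomorphUnitInterval_zero, γ.source]
  · change γ (stdSimplexHomeomorphUnitInterval ⟨_, single_mem_stdSimplex ℝ 1⟩) = b
    rw [stdSimplexHomeomorphUnitInterval_one, γ.target]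
  · rintro _ ⟨t, rfl⟩
    exact hγ _

/-- Suppose that `H₁(X) = 0`, and that every point of the closed subset `K` has arbitrarily small
neighbourhoods `W` such that `W ∖ K` is path connected and the image of `H₁(W ∖ K)` in `H₁(X ∖ K)`
is generated by `m`. Then `H₁(X ∖ K)` is generated by `m`.

The quotient map from the chains of `X ∖ K` to their quotient by the boundaries and by `m` is a
cocycle; it has a primitive on each `W ∖ K`, hence extends to a cocycle on `X`, which vanishes on
cycles. -/
theorem exists_bd_eq_sub_smul_of_local [LocallyPathConnectedSpace X]
    (H1 : ∀ c : Chain 1 X, bd c = 0 → ∃ w, bd w = c) {K : Set X} (hK : IsClosed K) (m : Chain 1 X)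
    (hloc : ∀ y ∈ K, ∀ O ∈ 𝓝 y, ∃ W ⊆ O, IsOpen W ∧ y ∈ W ∧ IsPathConnected (W \ K) ∧
      ∀ c ∈ chainsIn 1 (W \ K), bd c = 0 → ∃ (n : ℤ), ∃ u ∈ chainsIn 2 Kᶜ, bd u = c - n • m)
    {z : Chain 1 X} (hz : bd z = 0) (hzK : z ∈ chainsIn 1 Kᶜ) :
    ∃ (n : ℤ), ∃ u ∈ chainsIn 2 Kᶜ, bd u = z - n • m := by
  classical
  let B : Submodule ℤ (Chain 1 X) := (chainsIn 2 Kᶜ).map bd ⊔ Submodule.span ℤ {m}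
  let F := B.mkQ
  have hFbd (w) (hw : w ∈ chainsIn 2 Kᶜ) : F (bd w) = 0 :=
    (Submodule.Quotient.mk_eq_zero B).2 (Submodule.mem_sup_left ⟨w, hw, rfl⟩)
  have hFm : F m = 0 :=
    (Submodule.Quotient.mk_eq_zero B).2
      (Submodule.mem_sup_right (Submodule.mem_span_singleton_self _))
  choose W hW using fun y : K => hloc y y.2 univ Filter.univ_mem
  have hF1 (y : K) (c) (hc : c ∈ chainsIn 1 (W y \ K)) (hc0 : bd c = 0) : F c = 0 := by
    obtain ⟨n, u, hu, hub⟩ := (hW y).2.2.2.2 c hc hc0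
    rw [eq_add_of_sub_eq hub.symm, map_add, hFbd u hu, map_smul, hFm, smul_zero, add_zero]
  choose b hb using fun y : K => (hW y).2.2.2.1.nonempty
  have hex (y : K) (x : X) (hx : x ∈ W y \ K) :
      ∃ σ : Sing 1 X, src σ = b y ∧ tgt σ = x ∧ range σ ⊆ W y \ K :=
    ((hW y).2.2.2.1.joinedIn _ (hb y) _ hx).exists_sing
  choose s hs using hex
  -- the primitive of `F` on `W y ∖ K`
  let f : K → X → Chain 1 X ⧸ B := fun y x =>
    if h : x ∈ W y \ K then F (Finsupp.single (s y x h) 1) else 0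
  have hf (y : K) (σ : Sing 1 X) (hσ : range σ ⊆ W y \ K) :
      F (Finsupp.single σ 1) = f y (tgt σ) - f y (src σ) := by
    have h1 : tgt σ ∈ W y \ K := hσ ⟨_, rfl⟩
    have h0 : src σ ∈ W y \ K := hσ ⟨_, rfl⟩
    have := hF1 y (Finsupp.single σ 1 - Finsupp.single (s y _ h1) 1 + Finsupp.single (s y _ h0) 1)
      (Submodule.add_mem _ (Submodule.sub_mem _ (single_mem_chainsIn hσ 1)
        (single_mem_chainsIn (hs y _ h1).2.2 1)) (single_mem_chainsIn (hs y _ h0).2.2 1)) (by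
        simp only [map_add, map_sub, bd_single_one, (hs y _ h1).1, (hs y _ h1).2.1,
          (hs y _ h0).1, (hs y _ h0).2.1]
        abel)
    simp only [map_add, map_sub] at this
    simp only [f, dif_pos h1, dif_pos h0]
    rw [sub_add, sub_eq_zero] at this
    exact this
  -- differences of primitives are constant near `K`
  have hconst (y y' : K) (x : X) (hx : x ∈ W y ∩ W y') : ∃ V ∈ 𝓝 x, ∃ c,
      ∀ q ∈ V \ K, f y q - f y' q = c := by
    have hO : W y ∩ W y' ∈ 𝓝 x := ((hW y).2.1.inter (hW y').2.1).mem_nhds hx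
    obtain ⟨V, hVO, hV, hVp⟩ : ∃ V ⊆ W y ∩ W y', V ∈ 𝓝 x ∧ IsPathConnected (V \ K) := by
      by_cases hxK : x ∈ K
      · obtain ⟨V, hVO, hVo, hxV, hVp, -⟩ := hloc x hxK _ hO
        exact ⟨V, hVO, hVo.mem_nhds hxV, hVp⟩
      · obtain ⟨V, ⟨hV, hVp⟩, hVO⟩ := (path_connected_basis x).mem_iff.1
          (Filter.inter_mem hO (hK.isOpen_compl.mem_nhds hxK))
        refine ⟨V, fun q hq => (hVO hq).1, hV, ?_⟩
        have : V \ K = V := by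
          rw [sdiff_eq_left, Set.disjoint_left]
          exact fun q hq => (hVO hq).2
        rwa [this]
    obtain ⟨q₀, hq₀⟩ := hVp.nonempty
    refine ⟨V, hV, f y q₀ - f y' q₀, fun q hq => ?_⟩
    obtain ⟨σ, rfl, rfl, hσ⟩ := (hVp.joinedIn _ hq₀ _ hq).exists_sing
    have h1 := hf y σ fun q hq => ⟨(hVO (hσ hq).1).1, (hσ hq).2⟩
    have h2 := hf y' σ fun q hq => ⟨(hVO (hσ hq).1).2, (hσ hq).2⟩
    rw [h1] at h2
    rwa [sub_eq_sub_iff_sub_eq_sub]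
  have hne (x : X) (hx : x ∈ K) : (𝓝[Kᶜ] x).NeBot := by
    rw [← mem_closure_iff_nhdsWithin_neBot, mem_closure_iff_nhds]
    intro O hO
    obtain ⟨V, hVO, -, -, hVp, -⟩ := hloc x hx O hO
    obtain ⟨q, hq⟩ := hVp.nonempty
    exact ⟨q, hVO hq.1, hq.2⟩
  have hlim (y : K) (x : X) (hx : x ∈ K) (hxy : x ∈ W y) :
      ∃ c, ∀ᶠ q in 𝓝[Kᶜ] x, f y q - f ⟨x, hx⟩ q = c := by
    obtain ⟨V, hV, c, hc⟩ := hconst y ⟨x, hx⟩ x ⟨hxy, (hW ⟨x, hx⟩).2.2.1⟩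
    refine ⟨c, ?_⟩
    filter_upwards [mem_nhdsWithin_of_mem_nhds hV, self_mem_nhdsWithin] with q h1 h2
    exact hc q ⟨h1, h2⟩
  choose l hl using hlim
  -- the extension of the primitive to `W y`
  let g : K → X → Chain 1 X ⧸ B := fun y x =>
    if h : x ∈ K then (if h' : x ∈ W y then l y x h h' else 0) else f y x
  have hg (y : K) (x : X) (hx : x ∉ K) : g y x = f y x := dif_neg hx
  have hgloc : ∀ y y' : K, ∀ x ∈ W y ∩ W y', ∀ᶠ q in 𝓝 x, q ∈ W y → q ∈ W y' →
      g y q - g y' q = g y x - g y' x := by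
    intro y y' x hx
    obtain ⟨V, hV, c, hc⟩ := hconst y y' x hx
    have hc' : ∀ q, V ∈ 𝓝 q → q ∈ W y → q ∈ W y' → g y q - g y' q = c := by
      intro q hq h1 h2
      by_cases hqK : q ∈ K
      · simp only [g, dif_pos hqK, dif_pos h1, dif_pos h2]
        have := hne q hqK
        obtain ⟨p, ⟨⟨hp1, hp2⟩, hp3⟩, hp4⟩ := (((hl y q hqK h1).and (hl y' q hqK h2)).and
          (mem_nhdsWithin_of_mem_nhds hq)).and self_mem_nhdsWithin |>.exists
        rw [← hp1, ← hp2, sub_sub_sub_cancel_right, hc p ⟨hp3, hp4⟩]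
      · rw [hg y q hqK, hg y' q hqK, hc q ⟨mem_of_mem_nhds hq, hqK⟩]
    filter_upwards [eventually_mem_nhds_iff.2 hV] with q hq h1 h2
    rw [hc' q hq h1 h2, hc' x hV hx.1 hx.2]
  obtain ⟨G, hG⟩ := exists_cochain W g hgloc
  let F' : Chain 1 X →ₗ[ℤ] Chain 1 X ⧸ B := Finsupp.linearCombination ℤ fun σ =>
    if range σ ⊆ Kᶜ then F (Finsupp.single σ 1) else G (Finsupp.single σ 1)
  have hF'1 (σ : Sing 1 X) (hσ : range σ ⊆ Kᶜ) :
      F' (Finsupp.single σ 1) = F (Finsupp.single σ 1) := by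
    simp only [F', Finsupp.linearCombination_single, one_smul, if_pos hσ]
  have hF'2 (y : K) (σ : Sing 1 X) (hσ : range σ ⊆ W y) :
      F' (Finsupp.single σ 1) = g y (tgt σ) - g y (src σ) := by
    by_cases h : range σ ⊆ Kᶜ
    · rw [hF'1 σ h, hf y σ fun q hq => ⟨hσ hq, h hq⟩, hg, hg]
      · exact h ⟨_, rfl⟩
      · exact h ⟨_, rfl⟩
    · simp only [F', Finsupp.linearCombination_single, one_smul, if_neg h]
      exact hG y σ hσ
  have hF'K {c : Chain 1 X} (hc : c ∈ chainsIn 1 Kᶜ) : F' c = F c := by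
    have := small_induction (F' - F) ⊥ (𝒰 := {Kᶜ}) (fun σ hσ => by
      obtain ⟨_, rfl, h⟩ := hσ
      simp [hF'1 σ h]) hc
    rwa [LinearMap.sub_apply, Submodule.mem_bot, sub_eq_zero] at this
  obtain ⟨w, rfl⟩ := H1 z hz
  have hF'z : F' (bd w) = 0 := by
    refine cocycle_eq_zero_of_small (𝒰 := insert Kᶜ (range W)) ?_ F' ?_ ?_
      (chainsIn_le_small (mem_insert _ _) hzK)
    · rintro U (rfl | ⟨y, rfl⟩)
      · exact hK.isOpen_compl
      · exact (hW y).2.1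
    · rintro τ ⟨U, rfl | ⟨y, rfl⟩, hτ⟩
      · have h1 := single_mem_chainsIn hτ 1
        rw [hF'K (bd_mem_small h1), hFbd _ h1]
      · exact eq_zero_of_eq_sub F' (g y) {σ | range σ ⊆ W y} (hF'2 y)
          (bd_single_mem_supported τ fun i => (range_face_subset τ i).trans hτ) (bd_bd _)
    · have : ⋃₀ insert Kᶜ (range W) = univ := by
        rw [sUnion_insert, eq_univ_iff_forall]
        intro x
        by_cases hx : x ∈ K
        · exact Or.inr ⟨W ⟨x, hx⟩, ⟨_, rfl⟩, (hW ⟨x, hx⟩).2.2.1⟩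
        · exact Or.inl hx
      rw [this, chainsIn_univ]
      trivial
  rw [hF'K hzK] at hF'z
  obtain ⟨_, ⟨u, hu, rfl⟩, b, hb, hab⟩ :=
    Submodule.mem_sup.1 ((Submodule.Quotient.mk_eq_zero B).1 hF'z)
  obtain ⟨k, rfl⟩ := Submodule.mem_span_singleton.1 hb
  exact ⟨k, u, hu, by rw [← hab]; abel⟩

end Cochains

/-! ### Chains in a subspace -/

section Subspace

variable {X : Type*} [TopologicalSpace X]

/-- The inclusion of a subset. -/
def incl (p : X → Prop) : C({x // p x}, X) := ⟨Subtype.val, continuous_subtype_val⟩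

theorem push_incl_mem {n : ℕ} (p : X → Prop) (c : Chain n {x // p x}) :
    push (incl p) c ∈ chainsIn n {x | p x} := by
  induction c using Finsupp.induction_linear with
  | zero => simp
  | add f g hf hg => rw [map_add]; exact Submodule.add_mem _ hf hg
  | single σ a =>
    rw [push_single]
    refine single_mem_chainsIn ?_ a
    rintro _ ⟨t, rfl⟩
    exact (σ t).2

theorem push_mem {Y : Type*} [TopologicalSpace Y] {n : ℕ} (f : C(Y, X)) {U : Set X}
    (h : ∀ y, f y ∈ U) (c : Chain n Y) : push f c ∈ chainsIn n U := by
  induction c using Finsupp.induction_linear with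
  | zero => simp
  | add f g hf hg => rw [map_add]; exact Submodule.add_mem _ hf hg
  | single σ a =>
    rw [push_single]
    refine single_mem_chainsIn ?_ a
    rintro _ ⟨t, rfl⟩
    exact h _

theorem exists_push_incl_eq {n : ℕ} {p : X → Prop} {c : Chain n X}
    (hc : c ∈ chainsIn n {x | p x}) : ∃ c' : Chain n {x // p x}, push (incl p) c' = c := by
  refine small_induction (LinearMap.id) (LinearMap.range (push (incl p))) ?_ hc
  rintro σ ⟨_, rfl, hσ⟩
  exact ⟨Finsupp.single ⟨fun t => ⟨σ t, hσ ⟨t, rfl⟩⟩, σ.continuous.subtype_mk _⟩ 1, by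
    rw [push_single]; rfl⟩

theorem push_incl_injective {n : ℕ} (p : X → Prop) :
    Function.Injective (push (n := n) (incl p)) := by
  refine Finsupp.mapDomain_injective fun σ τ h => ContinuousMap.ext fun t => Subtype.ext ?_
  exact DFunLike.congr_fun h t

/-- Cycles in `U` are homologous in `V` if they correspond under a homotopy in `V`. -/
theorem exists_bd_eq_push_sub_push_of_homotopic {Y M : Type} [TopologicalSpace Y]
    [TopologicalSpace M] {p : M → Prop}
    {f g : C(Y, {x // p x})} (h : f.Homotopic g) {z : Chain 1 Y} (hz : bd z = 0) :
    ∃ w ∈ chainsIn 2 {x | p x},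
      bd w = push ((incl p).comp f) z - push ((incl p).comp g) z := by
  obtain ⟨w, hw⟩ := exists_bd_eq_push_sub_push h hz
  refine ⟨push (incl p) w, push_incl_mem p w, ?_⟩
  rw [bd_push, hw, map_sub, push_push, push_push]

end Subspace

end SingularChain

/-! ### Linking numbers in terms of chains -/

namespace OrientedKnot

open SingularChain

variable {M : Type} [TopologicalSpace M] [ChartedSpace (EuclideanSpace ℝ (Fin 3)) M]

theorem exists_bd_eq_of_hasLinkingNumber_zero {α : ∀ x : M, TangentSpace (𝓡 3) x →L[ℝ] ℝ}
    {K : OrientedKnot M} {c : C(UnitAddCircle, M)} (h : K.HasLinkingNumber α c 0) :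
    ∃ u ∈ chainsIn 2 K.carrierᶜ, bd u = push c circleCycle := by
  obtain ⟨c', m', hc', -, h⟩ := h
  obtain ⟨w, hw⟩ := (integralHomology_map_eq_smul_iff c' m' 0).1 h circleCycle bd_circleCycle
  refine ⟨push (incl _) w, push_incl_mem _ w, ?_⟩
  rw [bd_push, hw, zero_smul, sub_zero, push_push]
  congr 2
  exact ContinuousMap.ext hc'

theorem hasLinkingNumber_of_bd_eq {α : ∀ x : M, TangentSpace (𝓡 3) x →L[ℝ] ℝ}
    {K : OrientedKnot M} {c m : C(UnitAddCircle, M)} (hc : ∀ θ, c θ ∉ K.carrier)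
    (hmK : ∀ θ, m θ ∉ K.carrier) (hm : K.IsPositiveMeridian α m) {n : ℤ}
    (h : ∃ u ∈ chainsIn 2 K.carrierᶜ, bd u = push c circleCycle - n • push m circleCycle) :
    K.HasLinkingNumber α c n := by
  let c' : C(UnitAddCircle, {x : M // x ∉ K.carrier}) := ⟨fun θ => ⟨c θ, hc θ⟩, by fun_prop⟩
  let m' : C(UnitAddCircle, {x : M // x ∉ K.carrier}) := ⟨fun θ => ⟨m θ, hmK θ⟩, by fun_prop⟩
  refine ⟨c', m', fun _ => rfl, hm, (integralHomology_map_eq_smul_iff c' m' n).2 fun z hz => ?_⟩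
  obtain ⟨u, hu, hub⟩ := h
  obtain ⟨u', rfl⟩ := exists_push_incl_eq (p := fun x => x ∉ K.carrier) hu
  have hu' : bd u' = push c' circleCycle - n • push m' circleCycle := by
    apply push_incl_injective
    rw [← bd_push, hub, map_sub, map_smul, push_push, push_push]
    rfl
  obtain ⟨k, w, hw⟩ := exists_bd_eq_sub_smul_circleCycle hz
  refine ⟨k • u' + push c' w - n • push m' w, ?_⟩
  simp only [map_sub, map_add, map_smul, bd_push, hw, hu', smul_sub]
  rw [smul_comm k n]
  abel

end OrientedKnot

/-! ### Meridians generate the homology of a knot complement -/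

namespace SingularChain

/-- The circle of radius `r` about the third axis in the plane `z = 0`. -/
noncomputable def axisCircle (r : ℝ) : C(UnitAddCircle, E3) where
  toFun θ := !₂[r * (AddCircle.toCircle θ : ℂ).re, r * (AddCircle.toCircle θ : ℂ).im, 0]
  continuous_toFun := by
    have h : Continuous fun θ : UnitAddCircle => (AddCircle.toCircle θ : ℂ) :=
      continuous_subtype_val.comp AddCircle.continuous_toCircle
    refine (PiLp.continuous_toLp 2 _).comp (continuous_pi fun i => ?_)
    fin_cases i
    · exact continuous_const.mul (Complex.continuous_re.comp h)
    · exact continuous_const.mul (Complex.continuous_im.comp h)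
    · exact continuous_const

theorem axisCircle_coe (t : ℝ) : axisCircle 1 (t : UnitAddCircle) =
    !₂[Real.cos (2 * Real.pi * t), Real.sin (2 * Real.pi * t), 0] := by
  simp only [axisCircle, ContinuousMap.coe_mk, AddCircle.toCircle_apply_mk, div_one, one_mul,
    Circle.coe_exp]
  rw [Complex.exp_ofReal_mul_I_re, Complex.exp_ofReal_mul_I_im]

theorem axisCircle_eq_smul (r : ℝ) (θ : UnitAddCircle) : axisCircle r θ = r • axisCircle 1 θ := by
  ext i
  fin_cases i <;> simp [axisCircle]

theorem norm_axisCircle (r : ℝ) (θ : UnitAddCircle) : ‖axisCircle r θ‖ = |r| := by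
  rw [axisCircle_eq_smul, norm_smul, Real.norm_eq_abs, EuclideanSpace.norm_eq]
  have h : ‖(AddCircle.toCircle θ : ℂ)‖ = 1 := Circle.norm_coe _
  have h2 := Complex.sq_norm (AddCircle.toCircle θ : ℂ)
  rw [h, Complex.normSq_apply] at h2
  simp only [Fin.sum_univ_three]
  simp only [axisCircle, ContinuousMap.coe_mk, Real.norm_eq_abs, sq_abs]
  simp only [one_mul]
  have h3 : (AddCircle.toCircle θ : ℂ).re ^ 2 + (AddCircle.toCircle θ : ℂ).im ^ 2 = 1 := by
    linarith
  simp [h3]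

/-- The open ball of radius `ρ` in the coordinate space, with the third axis removed. -/
abbrev PuncturedBall (ρ : ℝ) : Type := {y : E3 // ‖y‖ < ρ ∧ ¬(y 0 = 0 ∧ y 1 = 0)}

theorem axisCircle_ne {r : ℝ} (hr : r ≠ 0) (θ : UnitAddCircle) :
    ¬(axisCircle r θ 0 = 0 ∧ axisCircle r θ 1 = 0) := by
  rintro ⟨h0, h1⟩
  have : ‖axisCircle r θ‖ = 0 := by
    rw [norm_eq_zero]
    ext i
    fin_cases i
    · exact h0
    · exact h1
    · rfl
  rw [norm_axisCircle, abs_eq_zero] at this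
  exact hr this

/-- The core circle of the punctured ball. -/
noncomputable def coreCircle {ρ : ℝ} (hρ : 0 < ρ) : C(UnitAddCircle, PuncturedBall ρ) where
  toFun θ := ⟨axisCircle (ρ / 2) θ, by
    rw [norm_axisCircle, abs_of_pos (by positivity)]; linarith, axisCircle_ne (by positivity) θ⟩
  continuous_toFun := (axisCircle _).continuous.subtype_mk _

/-- The projection of the complement of the third axis to the complex plane. -/
noncomputable def axisProj {ρ : ℝ} (y : PuncturedBall ρ) : ℂ := ⟨y.1 0, y.1 1⟩

theorem axisProj_ne_zero {ρ : ℝ} (y : PuncturedBall ρ) : axisProj y ≠ 0 := fun h =>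
  y.2.2 ⟨congrArg Complex.re h, congrArg Complex.im h⟩

theorem continuous_axisProj {ρ : ℝ} : Continuous (axisProj (ρ := ρ)) := by
  have h (i : Fin 3) : Continuous fun y : PuncturedBall ρ => y.1 i :=
    (EuclideanSpace.proj (𝕜 := ℝ) i).continuous.comp continuous_subtype_val
  exact Complex.equivRealProdCLM.symm.continuous.comp ((h 0).prodMk (h 1))

/-- The direction of the projection to the complex plane. -/
noncomputable def axisDir {ρ : ℝ} (y : PuncturedBall ρ) : Circle :=
  ⟨axisProj y / ‖axisProj y‖, by
    rw [Submonoid.unitSphere, ← SetLike.mem_coe]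
    simp [axisProj_ne_zero y]⟩

theorem axisDir_coe {ρ : ℝ} (y : PuncturedBall ρ) :
    (axisDir y : ℂ) = (‖axisProj y‖⁻¹ : ℝ) • axisProj y := by
  change axisProj y / ‖axisProj y‖ = _
  rw [Complex.real_smul, div_eq_inv_mul]
  push_cast
  rfl

/-- The angular coordinate about the third axis. -/
noncomputable def angle {ρ : ℝ} : C(PuncturedBall ρ, UnitAddCircle) where
  toFun y := (AddCircle.homeomorphCircle one_ne_zero).symm (axisDir y)
  continuous_toFun := (Homeomorph.continuous _).comp <| Continuous.subtype_mk
    (continuous_axisProj.div (Complex.continuous_ofReal.comp continuous_axisProj.norm) fun y => by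
      simpa using axisProj_ne_zero y) _

theorem axisCircle_angle {ρ : ℝ} (r : ℝ) (y : PuncturedBall ρ) :
    axisCircle r (angle y) = !₂[r * ‖axisProj y‖⁻¹ * y.1 0, r * ‖axisProj y‖⁻¹ * y.1 1, 0] := by
  have h : (AddCircle.toCircle (angle y) : ℂ) = (‖axisProj y‖⁻¹ : ℝ) • axisProj y := by
    rw [← axisDir_coe, ← AddCircle.homeomorphCircle_apply one_ne_zero]
    exact congrArg _ ((AddCircle.homeomorphCircle one_ne_zero).apply_symm_apply _)
  simp only [axisCircle, ContinuousMap.coe_mk, h, Complex.smul_re, Complex.smul_im, smul_eq_mul,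
    ← mul_assoc]
  rfl

/-- The punctured ball retracts to its core circle: slide a point along the segment to the point of
the core circle with the same angle. -/
theorem coreCircle_comp_angle_homotopic {ρ : ℝ} (hρ : 0 < ρ) :
    ((coreCircle hρ).comp angle).Homotopic (ContinuousMap.id (PuncturedBall ρ)) := by
  refine ⟨⟨⟨fun p => ⟨(1 - p.1.1) • axisCircle (ρ / 2) (angle p.2) + p.1.1 • p.2.1, ?_, ?_⟩,
    ?_⟩, fun y => ?_, fun y => ?_⟩⟩
  · rw [← mem_ball_zero_iff]
    refine convex_ball (0 : E3) ρ ?_ ?_ ?_ ?_ ?_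
    · exact mem_ball_zero_iff.2 ((coreCircle hρ) (angle p.2)).2.1
    · exact mem_ball_zero_iff.2 p.2.2.1
    · linarith [p.1.2.2]
    · exact p.1.2.1
    · ring
  · rintro ⟨h0, h1⟩
    rw [axisCircle_angle] at h0 h1
    have hpos : 0 < (1 - p.1.1) * (ρ / 2 * ‖axisProj p.2‖⁻¹) + p.1.1 := by
      have h2 : 0 < ρ / 2 * ‖axisProj p.2‖⁻¹ := by
        have := norm_pos_iff.2 (axisProj_ne_zero p.2)
        positivity
      have h3 := p.1.2.1
      rcases h3.eq_or_lt with h3 | h3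
      · rw [← h3]; simpa using h2
      · have : 0 ≤ (1 - p.1.1) := by linarith [p.1.2.2]
        positivity
    refine p.2.2.2 ⟨?_, ?_⟩
    · have : ((1 - p.1.1) * (ρ / 2 * ‖axisProj p.2‖⁻¹) + p.1.1) * p.2.1 0 = 0 := by
        refine Eq.trans ?_ h0
        simp
        ring
      exact (mul_eq_zero.1 this).resolve_left hpos.ne'
    · have : ((1 - p.1.1) * (ρ / 2 * ‖axisProj p.2‖⁻¹) + p.1.1) * p.2.1 1 = 0 := by
        refine Eq.trans ?_ h1
        simp
        ring
      exact (mul_eq_zero.1 this).resolve_left hpos.ne'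
  · refine Continuous.subtype_mk ?_ _
    fun_prop
  · exact Subtype.ext (by simp [coreCircle])
  · exact Subtype.ext (by simp)

instance pathConnectedSpace_puncturedBall {ρ : ℝ} [hρ : Fact (0 < ρ)] :
    PathConnectedSpace (PuncturedBall ρ) := by
  obtain ⟨H⟩ := coreCircle_comp_angle_homotopic hρ.out
  refine ⟨⟨coreCircle hρ.out 0⟩, fun x y => ?_⟩
  have h (x : PuncturedBall ρ) : Joined (coreCircle hρ.out (angle x)) x := ⟨H.evalAt x⟩
  have h2 : Joined (angle x) (angle y) := PathConnectedSpace.joined _ _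
  exact (h x).symm.trans ((h2.map (coreCircle hρ.out).continuous).trans (h y))

/-- In a chart that straightens a set `K` to the third axis, the homology of a small ball minus `K`
is generated by the unit circle about the axis. -/
theorem exists_bd_eq_sub_smul_of_chart {M : Type} [TopologicalSpace M] {K : Set M}
    (e : OpenPartialHomeomorph M E3)
    (hdisc : ∀ y : E3, y 2 = 0 → ‖y‖ ≤ 1 → y ∈ e.target)
    (hK : ∀ q ∈ e.source, q ∈ K ↔ e q 0 = 0 ∧ e q 1 = 0)
    {m : C(UnitAddCircle, M)} (hm : ∀ θ, m θ = e.symm (axisCircle 1 θ))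
    {ρ : ℝ} (hρ : 0 < ρ) (hρ1 : ρ ≤ 1) (hball : Metric.ball 0 ρ ⊆ e.target)
    {W : Set M} (hW : W = e.source ∩ e ⁻¹' Metric.ball 0 ρ) :
    IsPathConnected (W \ K) ∧ ∀ c ∈ chainsIn 1 (W \ K), bd c = 0 →
      ∃ (n : ℤ), ∃ u ∈ chainsIn 2 Kᶜ, bd u = c - n • push m circleCycle := by
  have hKs (y : E3) (hy : y ∈ e.target) : e.symm y ∈ K ↔ y 0 = 0 ∧ y 1 = 0 := by
    rw [hK _ (e.map_target hy), e.right_inv hy]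
  have htgt (y : PuncturedBall ρ) : y.1 ∈ e.target := hball (mem_ball_zero_iff.2 y.2.1)
  let j : C(PuncturedBall ρ, {x : M // x ∈ Kᶜ}) :=
    ⟨fun y => ⟨e.symm y.1, fun h => y.2.2 ((hKs _ (htgt y)).1 h)⟩,
      (e.continuousOn_symm.comp_continuous continuous_subtype_val htgt).subtype_mk _⟩
  have hrange : range (fun y => (j y : M)) = W \ K := by
    ext x
    constructor
    · rintro ⟨y, rfl⟩
      refine ⟨?_, (j y).2⟩
      rw [hW]
      refine ⟨e.map_target (htgt y), ?_⟩
      change e (e.symm y.1) ∈ Metric.ball (0 : E3) ρ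
      rw [e.right_inv (htgt y)]
      exact mem_ball_zero_iff.2 y.2.1
    · rintro ⟨hx, hxK⟩
      rw [hW] at hx
      refine ⟨⟨e x, mem_ball_zero_iff.1 hx.2, fun h => hxK ((hK x hx.1).2 h)⟩, ?_⟩
      exact e.left_inv hx.1
  constructor
  · have : Fact (0 < ρ) := ⟨hρ⟩
    rw [← hrange, ← image_univ]
    exact isPathConnected_univ.image (by fun_prop)
  intro c hc hc0
  -- the chain comes from the punctured ball
  obtain ⟨c', hc'⟩ : ∃ c' : Chain 1 (PuncturedBall ρ), push ((incl (· ∈ Kᶜ)).comp j) c' = c := by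
    refine small_induction LinearMap.id (LinearMap.range (push ((incl (· ∈ Kᶜ)).comp j))) ?_ hc
    rintro σ ⟨_, rfl, hσ⟩
    have hσ' (t) : σ t ∈ e.source ∩ e ⁻¹' Metric.ball 0 ρ := hW ▸ (hσ ⟨t, rfl⟩).1
    refine ⟨Finsupp.single ⟨fun t => ⟨e (σ t), mem_ball_zero_iff.1 (hσ' t).2,
      fun h => (hσ ⟨t, rfl⟩).2 ((hK _ (hσ' t).1).2 h)⟩,
      (e.continuousOn.comp_continuous σ.continuous fun t => (hσ' t).1).subtype_mk _⟩ 1, ?_⟩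
    rw [push_single]
    congr 1
    ext t
    exact e.left_inv (hσ' t).1
  have hcyc : bd c' = 0 := by
    have hinj : Function.Injective (push (n := 0) ((incl (· ∈ Kᶜ)).comp j)) := by
      refine Finsupp.mapDomain_injective fun σ τ h => ContinuousMap.ext fun t => Subtype.ext ?_
      exact e.symm.injOn (htgt _) (htgt _) (DFunLike.congr_fun h t)
    apply hinj
    rw [← bd_push, hc', hc0, map_zero]
  obtain ⟨k, w, hw⟩ := exists_bd_eq_sub_smul_circleCycle (z := push angle c')
    (by rw [bd_push, hcyc, map_zero])
  -- retraction to the core circle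
  have h1 : (j.comp ((coreCircle hρ).comp angle)).Homotopic (j.comp (ContinuousMap.id _)) :=
    (ContinuousMap.Homotopic.refl j).comp (coreCircle_comp_angle_homotopic hρ)
  obtain ⟨w1, hw1, hw1b⟩ := exists_bd_eq_push_sub_push_of_homotopic h1 hcyc
  -- the core circle is isotopic to the unit circle
  have hr {r : ℝ} (h0 : 0 < r) (h1 : r ≤ 1) (θ) : axisCircle r θ ∈ e.target :=
    hdisc _ rfl (by rw [norm_axisCircle, abs_of_pos h0]; exact h1)
  have hrK {r : ℝ} (h0 : 0 < r) (h1 : r ≤ 1) (θ) : e.symm (axisCircle r θ) ∈ Kᶜ := fun h =>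
    axisCircle_ne h0.ne' θ ((hKs _ (hr h0 h1 θ)).1 h)
  have hmK (θ) : m θ ∈ Kᶜ := by rw [hm]; exact hrK one_pos le_rfl θ
  let m' : C(UnitAddCircle, {x : M // x ∈ Kᶜ}) :=
    ⟨fun θ => ⟨m θ, hmK θ⟩, m.continuous.subtype_mk hmK⟩
  have h2 : (j.comp (coreCircle hρ)).Homotopic m' := by
    have hpos (p : unitInterval) :
        0 < (1 - p.1) * (ρ / 2) + p.1 ∧ (1 - p.1) * (ρ / 2) + p.1 ≤ 1 := by
      obtain ⟨h0, h1⟩ := p.2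
      constructor
      · rcases h0.eq_or_lt with h0 | h0
        · rw [← h0]; linarith
        · have : 0 ≤ 1 - p.1 := by linarith
          positivity
      · nlinarith
    have hcont : Continuous fun p : unitInterval × UnitAddCircle =>
        e.symm (axisCircle ((1 - p.1.1) * (ρ / 2) + p.1.1) p.2) := by
      refine e.continuousOn_symm.comp_continuous ?_ fun p => hr (hpos p.1).1 (hpos p.1).2 _
      simp_rw [axisCircle_eq_smul ((1 - _) * (ρ / 2) + _)]
      fun_prop
    let H : C(unitInterval × UnitAddCircle, {x : M // x ∈ Kᶜ}) :=
      ⟨fun p => ⟨_, hrK (hpos p.1).1 (hpos p.1).2 p.2⟩,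
        hcont.subtype_mk fun p => hrK (hpos p.1).1 (hpos p.1).2 p.2⟩
    have H0 (θ) : H (0, θ) = j (coreCircle hρ θ) := Subtype.ext <| by
      change e.symm (axisCircle ((1 - (0 : ℝ)) * (ρ / 2) + 0) θ) = e.symm (axisCircle (ρ / 2) θ)
      rw [sub_zero, one_mul, add_zero]
    have H1 (θ) : H (1, θ) = m' θ := Subtype.ext <| by
      change e.symm (axisCircle ((1 - (1 : ℝ)) * (ρ / 2) + 1) θ) = m θ
      rw [sub_self, zero_mul, zero_add, hm]
    exact ⟨⟨H, H0, H1⟩⟩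
  obtain ⟨w2, hw2, hw2b⟩ := exists_bd_eq_push_sub_push_of_homotopic h2 bd_circleCycle
  refine ⟨k, -w1 + push ((incl (· ∈ Kᶜ)).comp (j.comp (coreCircle hρ))) w + k • w2, ?_, ?_⟩
  · refine Submodule.add_mem _ (Submodule.add_mem _ (Submodule.neg_mem _ hw1) ?_)
      (Submodule.smul_mem _ _ hw2)
    exact push_mem _ (fun y => (j (coreCircle hρ y)).2) w
  · simp only [map_add, map_neg, map_smul, hw1b, hw2b, bd_push, hw, map_sub, push_push]
    have e1 : (incl (· ∈ Kᶜ)).comp m' = m := rfl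
    have e2 : push ((incl (· ∈ Kᶜ)).comp (j.comp (ContinuousMap.id _))) c' = c := hc'
    have e3 : ((incl (· ∈ Kᶜ)).comp (j.comp (coreCircle hρ))).comp (angle (ρ := ρ)) =
      (incl (· ∈ Kᶜ)).comp (j.comp ((coreCircle hρ).comp (angle (ρ := ρ)))) := rfl
    rw [e1, e2, e3, smul_sub]
    abel

end SingularChain

namespace OrientedKnot

open SingularChain

variable {M : Type} [TopologicalSpace M] [ChartedSpace (EuclideanSpace ℝ (Fin 3)) M]

/-- If `H₁(M) = 0` and the knot `K` is an orbit of a flow, then every loop in the complement of `K`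
is homologous there to a multiple of a meridian. Since the flow moves every point of `K` to every
other one, one straightening chart is enough to describe `K` near all of its points. -/
theorem exists_hasLinkingNumber (H1 : ∀ c : Chain 1 M, bd c = 0 → ∃ w, bd w = c)
    {α : ∀ x : M, TangentSpace (𝓡 3) x →L[ℝ] ℝ} {K : OrientedKnot M} (hKc : IsClosed K.carrier)
    (φ : Flow ℝ M) {p : M} (hp : K.carrier = range fun t => φ t p)
    {m : C(UnitAddCircle, M)} (hm : K.IsPositiveMeridian α m)
    {c : C(UnitAddCircle, M)} (hc : ∀ θ, c θ ∉ K.carrier) : ∃ n : ℤ, K.HasLinkingNumber α c n := by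
  have hm' := hm
  obtain ⟨e, -, hdisc, hK, -, -, hm⟩ := hm
  have hmc (θ) : m θ = e.symm (axisCircle 1 θ) := by
    obtain ⟨t, rfl⟩ := QuotientAddGroup.mk_surjective θ
    rw [axisCircle_coe]
    exact hm t
  have h0 : (0 : E3) ∈ e.target := hdisc 0 rfl (by simp)
  have hmK (θ) : m θ ∉ K.carrier := by
    have ht : axisCircle 1 θ ∈ e.target := hdisc _ rfl (by rw [norm_axisCircle, abs_one])
    rw [hmc, hK _ (e.map_target ht), e.right_inv ht]
    exact axisCircle_ne one_ne_zero θ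
  have hz0 : e.symm 0 ∈ K.carrier := by
    rw [hK _ (e.map_target h0), e.right_inv h0]
    exact ⟨rfl, rfl⟩
  have hinv (t : ℝ) (x : M) : φ t x ∈ K.carrier ↔ x ∈ K.carrier := by
    rw [hp]
    constructor
    · rintro ⟨s, hs⟩
      refine ⟨-t + s, ?_⟩
      simp only at hs ⊢
      rw [φ.map_add, hs, ← φ.map_add, neg_add_cancel, φ.map_zero_apply]
    · rintro ⟨s, rfl⟩
      exact ⟨t + s, φ.map_add _ _ _⟩
  have : LocallyPathConnectedSpace M := ChartedSpace.locallyPathConnectedSpace E3 M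
  have hzc : bd (push c circleCycle) = 0 := by rw [bd_push, bd_circleCycle, map_zero]
  suffices hloc : _ by
    obtain ⟨n, hn⟩ := exists_bd_eq_sub_smul_of_local H1 hKc (push m circleCycle) hloc hzc
      (push_mem c hc _)
    exact ⟨n, hasLinkingNumber_of_bd_eq hc hmK hm' hn⟩
  intro y hy O hO
  -- move `y` to the centre of the chart
  obtain ⟨t, rfl⟩ : ∃ t, φ t (e.symm 0) = y := by
    rw [hp] at hz0 hy
    obtain ⟨s, hs⟩ := hz0
    obtain ⟨s', rfl⟩ := hy
    refine ⟨s' - s, ?_⟩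
    simp only at hs ⊢
    rw [← hs, ← φ.map_add, sub_add_cancel]
  have hcont (t : ℝ) : Continuous (φ t) := φ.continuous continuous_const continuous_id
  have hO' : e.target ∩ e.symm ⁻¹' (φ t ⁻¹' O) ∈ 𝓝 (0 : E3) :=
    Filter.inter_mem (e.open_target.mem_nhds h0)
      ((e.continuousAt_symm h0).preimage_mem_nhds ((hcont t).continuousAt.preimage_mem_nhds hO))
  obtain ⟨ρ', hρ', hball'⟩ := Metric.mem_nhds_iff.1 hO'
  let ρ := min ρ' 1
  have hρ : 0 < ρ := lt_min hρ' one_pos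
  have hball : Metric.ball 0 ρ ⊆ e.target ∩ e.symm ⁻¹' (φ t ⁻¹' O) :=
    (Metric.ball_subset_ball (min_le_left _ _)).trans hball'
  set W₀ : Set M := e.source ∩ e ⁻¹' Metric.ball 0 ρ with hW₀
  obtain ⟨hpc, hcyc⟩ := exists_bd_eq_sub_smul_of_chart e hdisc hK hmc hρ (min_le_right _ _)
    (hball.trans inter_subset_left) hW₀
  have hflow (s : ℝ) (x : M) : φ s (φ (-s) x) = x := by
    rw [← φ.map_add, add_neg_cancel, φ.map_zero_apply]
  have hflow' (s : ℝ) (x : M) : φ (-s) (φ s x) = x := by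
    rw [← φ.map_add, neg_add_cancel, φ.map_zero_apply]
  refine ⟨φ (-t) ⁻¹' W₀, ?_, ?_, ?_, ?_, ?_⟩
  · intro x hx
    have := (hball hx.2).2
    rw [mem_preimage, e.left_inv hx.1, mem_preimage, hflow] at this
    exact this
  · exact (e.isOpen_inter_preimage Metric.isOpen_ball).preimage (hcont _)
  · rw [mem_preimage, hflow']
    refine ⟨e.map_target h0, ?_⟩
    rw [mem_preimage, e.right_inv h0]
    exact Metric.mem_ball_self hρ
  · have : φ (-t) ⁻¹' W₀ \ K.carrier = φ t '' (W₀ \ K.carrier) := by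
      ext x
      constructor
      · rintro ⟨h1, h2⟩
        exact ⟨φ (-t) x, ⟨h1, fun h => h2 ((hinv _ _).1 h)⟩, hflow t x⟩
      · rintro ⟨x, ⟨h1, h2⟩, rfl⟩
        exact ⟨by rwa [mem_preimage, hflow'], fun h => h2 ((hinv _ _).1 h)⟩
    rw [this]
    exact hpc.image (hcont t)
  · intro c hc hc0
    let ψ : C(M, M) := ⟨φ (-t), hcont _⟩
    have h1 : push ψ c ∈ chainsIn 1 (W₀ \ K.carrier) := by
      refine small_induction (push ψ) _ ?_ hc
      rintro σ ⟨_, rfl, hσ⟩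
      rw [push_single]
      refine single_mem_chainsIn ?_ 1
      rintro _ ⟨s, rfl⟩
      have := hσ ⟨s, rfl⟩
      exact ⟨this.1, fun h => this.2 ((hinv _ _).1 h)⟩
    obtain ⟨n, u, hu, hub⟩ := hcyc _ h1 (by rw [bd_push, hc0, map_zero])
    obtain ⟨c', rfl⟩ := exists_push_incl_eq (p := (· ∈ K.carrierᶜ))
      (chainsIn_mono (fun x hx => hx.2) hc)
    have hc0' : bd c' = 0 := by
      apply push_incl_injective
      rw [← bd_push, hc0, map_zero]
    let ψ' : C({x : M // x ∈ K.carrierᶜ}, {x : M // x ∈ K.carrierᶜ}) :=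
      ⟨fun x => ⟨φ (-t) x, fun h => x.2 ((hinv _ _).1 h)⟩,
        ((hcont _).comp continuous_subtype_val).subtype_mk _⟩
    have hhom : (ContinuousMap.id {x : M // x ∈ K.carrierᶜ}).Homotopic ψ' := by
      refine ⟨⟨⟨fun p => ⟨φ (-(p.1.1 * t)) p.2, fun h => p.2.2 ((hinv _ _).1 h)⟩,
        Continuous.subtype_mk ?_ _⟩, fun x => ?_, fun x => ?_⟩⟩
      · exact φ.continuous (by fun_prop) (by fun_prop)
      · exact Subtype.ext (by simp)
      · exact Subtype.ext (by simp [ψ'])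
    obtain ⟨w, hw, hwb⟩ := exists_bd_eq_push_sub_push_of_homotopic hhom hc0'
    refine ⟨n, u + w, Submodule.add_mem _ hu hw, ?_⟩
    rw [map_add, hub, hwb, push_push]
    have e1 : (incl (· ∈ K.carrierᶜ)).comp ψ' = ψ.comp (incl (· ∈ K.carrierᶜ)) := rfl
    rw [e1]
    have e2 : (incl (· ∈ K.carrierᶜ)).comp (ContinuousMap.id _) = incl (· ∈ K.carrierᶜ) := rfl
    rw [e2]
    abel

end OrientedKnot

/-! ### Counting crossings of a transverse section -/

/-- `h` defines the set `Z` inside the open set `O`, and increases along the flow `φ`: in `O`, the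
set `Z` is a level set that the flow crosses in one direction. -/
structure IsFlowSlice {M : Type*} [TopologicalSpace M] (φ : Flow ℝ M) (Z O : Set M) (h : M → ℝ) :
    Prop where
  isOpen : IsOpen O
  continuousOn : ContinuousOn h O
  mem_iff : ∀ x ∈ O, x ∈ Z ↔ h x = 0
  deriv_pos : ∀ x ∈ O, ∃ d > 0, HasDerivAt (fun t => h (φ t x)) d 0

namespace IsFlowSlice

variable {M : Type*} [TopologicalSpace M] {φ : Flow ℝ M} {Z O : Set M} {h : M → ℝ}

theorem strictMonoOn (H : IsFlowSlice φ Z O h) {x : M} {a b : ℝ}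
    (hab : ∀ t ∈ Icc a b, φ t x ∈ O) : StrictMonoOn (fun t => h (φ t x)) (Icc a b) := by
  have hc : Continuous fun t => φ t x := φ.continuous continuous_id continuous_const
  refine strictMonoOn_of_deriv_pos (convex_Icc a b)
    (H.continuousOn.comp hc.continuousOn hab) fun t ht => ?_
  obtain ⟨d, hd, hd'⟩ := H.deriv_pos _ (hab t (interior_subset ht))
  have h1 : HasDerivAt (fun s => s - t) 1 t := (hasDerivAt_id t).sub_const t
  have h2 := HasDerivAt.comp (h₂ := fun s => h (φ s (φ t x))) t (by simpa using hd') h1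
  have h3 : ((fun s => h (φ s (φ t x))) ∘ fun s => s - t) = fun s => h (φ s x) := by
    funext s
    simp only [Function.comp_apply, ← φ.map_add, sub_add_cancel]
  rw [h3, mul_one] at h2
  rw [h2.deriv]
  exact hd

/-- Two functions that define the section near one of its points are positive on the same side,
which is the side that the flow enters. -/
theorem eventually_nonneg_iff {O' : Set M} {h' : M → ℝ} (H : IsFlowSlice φ Z O h)
    (H' : IsFlowSlice φ Z O' h') {x : M} (hx : x ∈ O) (hx' : x ∈ O') (hZ : x ∈ Z) :
    ∀ᶠ q in 𝓝 x, 0 ≤ h q ↔ 0 ≤ h' q := by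
  have hφ : Continuous fun p : ℝ × M => φ p.1 p.2 := φ.continuous continuous_fst continuous_snd
  have h0 : φ 0 x = x := φ.map_zero_apply x
  have hn : (fun p : ℝ × M => φ p.1 p.2) ⁻¹' (O ∩ O') ∈ 𝓝 ((0 : ℝ), x) := by
    refine hφ.continuousAt.preimage_mem_nhds ?_
    simp only [h0]
    exact (H.isOpen.inter H'.isOpen).mem_nhds ⟨hx, hx'⟩
  obtain ⟨u, hu, v, hv, huv⟩ := mem_nhds_prod_iff.1 hn
  obtain ⟨ε, hε, hεu⟩ := Metric.nhds_basis_closedBall.mem_iff.1 hu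
  rw [Real.closedBall_eq_Icc, zero_sub, zero_add] at hεu
  have hO {q : M} (hq : q ∈ v) {t : ℝ} (ht : t ∈ Icc (-ε) ε) : φ t q ∈ O ∩ O' :=
    huv (show (t, q) ∈ u ×ˢ v from ⟨hεu ht, hq⟩)
  have hε0 : (0 : ℝ) ∈ Icc (-ε) ε := ⟨by linarith, hε.le⟩
  have hεl : -ε ∈ Icc (-ε) ε := ⟨le_rfl, by linarith⟩
  have hεr : ε ∈ Icc (-ε) ε := ⟨by linarith, le_rfl⟩
  have hxv : x ∈ v := mem_of_mem_nhds hv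
  -- near `x`, the section is crossed between the times `-ε` and `ε`
  have hm := H.strictMonoOn (x := x) fun t ht => (hO hxv ht).1
  have hl : h (φ (-ε) x) < 0 := by
    have := hm hεl hε0 (by linarith)
    simp only [h0, (H.mem_iff x hx).1 hZ] at this
    exact this
  have hr : 0 < h (φ ε x) := by
    have := hm hε0 hεr hε
    simp only [h0, (H.mem_iff x hx).1 hZ] at this
    exact this
  have hφt (t : ℝ) : Continuous (φ t) := φ.continuous continuous_const continuous_id
  have hcl : ∀ᶠ q in 𝓝 x, h (φ (-ε) q) < 0 :=
    ((H.continuousOn.continuousAt (H.isOpen.mem_nhds (hO hxv hεl).1)).comp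
      (hφt (-ε)).continuousAt).eventually_lt_const hl
  have hcr : ∀ᶠ q in 𝓝 x, 0 < h (φ ε q) :=
    ((H.continuousOn.continuousAt (H.isOpen.mem_nhds (hO hxv hεr).1)).comp
      (hφt ε).continuousAt).eventually_const_lt hr
  filter_upwards [hv, hcl, hcr] with q hq hql hqr
  have hcont : Continuous fun t => φ t q := φ.continuous continuous_id continuous_const
  have hq0 : φ 0 q = q := φ.map_zero_apply q
  obtain ⟨τ, hτ, hτ0⟩ : (0 : ℝ) ∈ (fun t => h (φ t q)) '' Icc (-ε) ε :=
    intermediate_value_Icc (by linarith)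
      (H.continuousOn.comp hcont.continuousOn fun t ht => (hO hq ht).1) ⟨hql.le, hqr.le⟩
  have hτ0' : h' (φ τ q) = 0 :=
    (H'.mem_iff _ (hO hq hτ).2).1 ((H.mem_iff _ (hO hq hτ).1).2 hτ0)
  have e1 := (H.strictMonoOn (x := q) fun t ht => (hO hq ht).1).le_iff_le hτ hε0
  have e2 := (H'.strictMonoOn (x := q) fun t ht => (hO hq ht).2).le_iff_le hτ hε0
  simp only [hq0, hτ0', hτ0] at e1 e2
  rw [e1, e2]

open SingularChain

/-- A closed orbit that crosses the section `Z` does not bound in any open set covered by flow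
slices and the complement of `Z`: the number of crossings is a cocycle, to which every crossing
contributes `+1`. -/
theorem _root_.SingularChain.bd_ne_of_flowSlices {M : Type} [TopologicalSpace M] {φ : Flow ℝ M}
    {Z V : Set M} (hZ : IsClosed Z) (hslice : ∀ x ∈ Z ∩ V, ∃ O h, x ∈ O ∧ IsFlowSlice φ Z O h)
    (γ : PeriodicOrbit φ) (hγV : γ.carrier ⊆ V) {t₀ : ℝ} (ht₀ : φ t₀ γ.pt ∈ Z)
    {y : Chain 2 M} (hy : y ∈ chainsIn 2 V) : bd y ≠ push γ.loop circleCycle := by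
  classical
  intro hyb
  -- the cochain that counts crossings
  let ι := Option {p : Set M × (M → ℝ) // IsFlowSlice φ Z p.1 p.2}
  let O : ι → Set M := fun i => i.elim Zᶜ fun p => p.1.1
  let f : ι → M → ℤ := fun i x => i.elim 0 fun p => if 0 ≤ p.1.2 x then 1 else 0
  have hO (i : ι) : IsOpen (O i) := by
    cases i with
    | none => exact hZ.isOpen_compl
    | some p => exact p.2.isOpen
  have hf (i : ι) (x : M) (hx : x ∈ O i) (hxZ : x ∉ Z) : ∀ᶠ q in 𝓝 x, f i q = f i x := by
    cases i with
    | none => exact Filter.Eventually.of_forall fun _ => rfl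
    | some p =>
      have hne : p.1.2 x ≠ 0 := fun h => hxZ ((p.2.mem_iff x hx).2 h)
      have hc := p.2.continuousOn.continuousAt (p.2.isOpen.mem_nhds hx)
      rcases hne.lt_or_gt with h | h
      · filter_upwards [hc.eventually_lt_const h] with q hq
        simp only [f, Option.elim, if_neg hq.not_ge, if_neg h.not_ge]
      · filter_upwards [hc.eventually_const_lt h] with q hq
        simp only [f, Option.elim, if_pos hq.le, if_pos h.le]
  obtain ⟨F, hF⟩ := exists_cochain O f (by
    rintro i j x ⟨hi, hj⟩
    by_cases hxZ : x ∈ Z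
    · cases i with
      | none => exact absurd hxZ hi
      | some p =>
        cases j with
        | none => exact absurd hxZ hj
        | some p' =>
          have hev := eventually_nonneg_iff p.2 p'.2 hi hj hxZ
          have hq {q} (hq : 0 ≤ p.1.2 q ↔ 0 ≤ p'.1.2 q) : f (some p) q - f (some p') q = 0 := by
            simp only [f, Option.elim, hq, sub_self]
          filter_upwards [hev] with q hq' _ _
          rw [hq hq', hq hev.self_of_nhds]
    · filter_upwards [hf i x hi hxZ, hf j x hj hxZ] with q h1 h2 _ _
      rw [h1, h2])
  have hVO : V ⊆ ⋃₀ range O := by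
    intro x hx
    by_cases hxZ : x ∈ Z
    · obtain ⟨U, h, hxU, hU⟩ := hslice x ⟨hxZ, hx⟩
      exact ⟨_, ⟨some ⟨(U, h), hU⟩, rfl⟩, hxU⟩
    · exact ⟨_, ⟨none, rfl⟩, hxZ⟩
  -- the orbit, divided into small pieces
  let g : C(ℝ, M) := γ.loop.comp toCircle
  have hg (t : ℝ) : g t = φ (γ.period * t) γ.pt := rfl
  have hgV (t : ℝ) : g t ∈ V := hγV ⟨_, rfl⟩
  have hgseg : push γ.loop circleCycle = Finsupp.single (seg g 0 1) 1 := by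
    rw [circleCycle, push_single, comp_seg]
  obtain ⟨t, ht0, htm, ⟨N, hN⟩, ht⟩ := exists_monotone_Icc_subset_open_cover_unitInterval
    (c := fun i => (fun s : unitInterval => g s) ⁻¹' O i)
    (fun i => (hO i).preimage (g.continuous.comp continuous_subtype_val)) (by
      intro s _
      obtain ⟨_, ⟨i, rfl⟩, hi⟩ := hVO (hgV s)
      exact mem_iUnion.2 ⟨i, hi⟩)
  have htO (n) : ∃ i, ∀ s ∈ Icc (t n : ℝ) (t (n + 1)), g s ∈ O i := by
    obtain ⟨i, hi⟩ := ht n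
    refine ⟨i, fun s hs => ?_⟩
    have hs' : (⟨s, (t n).2.1.trans hs.1, hs.2.trans (t (n + 1)).2.2⟩ : unitInterval) ∈
      Icc (t n) (t (n + 1)) := hs
    exact hi hs'
  choose i hi using htO
  let z : ℕ → Chain 1 M := fun n =>
    ∑ k ∈ Finset.range n, Finsupp.single (seg g (t k) (t (k + 1))) 1
  have hrange (a b c : ℝ) : range (g.comp (affine ![a, b, c])) ⊆ V := by
    rintro _ ⟨s, rfl⟩
    exact hgV _
  have hz (n) : ∃ w ∈ chainsIn 2 V, bd w = z n - Finsupp.single (seg g 0 (t n)) 1 := by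
    induction n with
    | zero =>
      refine ⟨-Finsupp.single (g.comp (affine ![0, 0, 0])) 1,
        Submodule.neg_mem _ (single_mem_chainsIn (hrange _ _ _) 1), ?_⟩
      rw [map_neg, bd_triangle]
      simp [z, ht0]
    | succ n ih =>
      obtain ⟨w, hw, hwb⟩ := ih
      refine ⟨w + Finsupp.single (g.comp (affine ![0, (t n : ℝ), t (n + 1)])) 1,
        Submodule.add_mem _ hw (single_mem_chainsIn (hrange _ _ _) 1), ?_⟩
      rw [map_add, hwb, bd_triangle]
      simp only [z, Finset.sum_range_succ]
      abel
  have hmono (n) : (t n : ℝ) ≤ t (n + 1) := htm n.le_succ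
  have hsegO (n) : range (seg g (t n) (t (n + 1))) ⊆ O (i n) := by
    rintro _ ⟨s, rfl⟩
    exact hi n _ (range_affine_pair_subset (hmono n) ⟨s, rfl⟩)
  have hFz : F (z N) = 0 := by
    obtain ⟨w, hw, hwb⟩ := hz N
    have hb : bd (w + y) = z N := by
      rw [map_add, hwb, hyb, hgseg, hN N le_rfl]
      simp
    rw [← hb]
    refine cocycle_eq_zero_of_small (𝒰 := range O) ?_ F ?_
      (chainsIn_mono hVO (Submodule.add_mem _ hw hy)) ?_
    · rintro _ ⟨i, rfl⟩
      exact hO i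
    · rintro τ ⟨_, ⟨i, rfl⟩, hτ⟩
      exact eq_zero_of_eq_sub F (f i) {σ | range σ ⊆ O i} (fun σ hσ => hF i σ hσ)
        (bd_single_mem_supported τ fun j => (range_face_subset τ j).trans hτ) (bd_bd _)
    · rw [hb]
      exact Submodule.sum_mem _ fun k _ => single_mem_small (mem_range_self (i k)) (hsegO k) 1
  have hFn (n) : F (Finsupp.single (seg g (t n) (t (n + 1))) 1) =
      f (i n) (g (t (n + 1))) - f (i n) (g (t n)) := by
    rw [hF _ _ (hsegO n), src_seg, tgt_seg]
  have hstrict (n) (p) (hp : i n = some p) :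
      StrictMonoOn (fun s => p.1.2 (g s)) (Icc (t n : ℝ) (t (n + 1))) := by
    have h1 := p.2.strictMonoOn (x := γ.pt) (a := γ.period * t n) (b := γ.period * t (n + 1)) (by
      intro s hs
      have h2 := hi n (s / γ.period) ⟨(le_div_iff₀' γ.period_pos).2 hs.1,
        (div_le_iff₀' γ.period_pos).2 hs.2⟩
      rw [hp, hg, mul_div_cancel₀ _ γ.period_pos.ne'] at h2
      exact h2)
    intro a ha b hb hab
    exact h1 ⟨mul_le_mul_of_nonneg_left ha.1 γ.period_pos.le,
      mul_le_mul_of_nonneg_left ha.2 γ.period_pos.le⟩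
      ⟨mul_le_mul_of_nonneg_left hb.1 γ.period_pos.le,
      mul_le_mul_of_nonneg_left hb.2 γ.period_pos.le⟩ (mul_lt_mul_of_pos_left hab γ.period_pos)
  have hnonneg (n) : 0 ≤ F (Finsupp.single (seg g (t n) (t (n + 1))) 1) := by
    rw [hFn]
    rcases hin : i n with _ | p
    · simp [f]
    · have h1 := (hstrict n p hin).monotoneOn ⟨le_rfl, hmono n⟩ ⟨hmono n, le_rfl⟩ (hmono n)
      simp only [f, Option.elim] at h1 ⊢
      split_ifs <;> first | omega | linarith
  -- the piece that contains a crossing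
  obtain ⟨s, hs0, hs1, hsZ⟩ : ∃ s : ℝ, 0 < s ∧ s ≤ 1 ∧ g s ∈ Z := by
    have hper : Function.Periodic g 1 := γ.periodic
    have h1 := toIocMod_mem_Ioc one_pos 0 (t₀ / γ.period)
    rw [zero_add] at h1
    refine ⟨_, h1.1, h1.2, ?_⟩
    have h2 : g (toIocMod one_pos 0 (t₀ / γ.period)) = g (t₀ / γ.period) := by
      rw [toIocMod]
      exact hper.sub_zsmul_eq _
    rw [h2, hg, mul_div_cancel₀ _ γ.period_pos.ne']
    exact ht₀
  have hex : ∃ n, s ≤ t n := ⟨N, by rw [hN N le_rfl]; exact hs1⟩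
  obtain ⟨n, hn⟩ : ∃ n, Nat.find hex = n + 1 := by
    refine Nat.exists_eq_succ_of_ne_zero fun h => ?_
    have := Nat.find_spec hex
    rw [h, ht0] at this
    exact hs0.not_ge this
  have hsn : s ≤ t (n + 1) := hn ▸ Nat.find_spec hex
  have hsn' : (t n : ℝ) < s := not_le.1 (Nat.find_min hex (hn ▸ n.lt_succ_self))
  have hnN : n < N := by
    by_contra h
    have := hN n (not_lt.1 h)
    rw [this] at hsn'
    exact hsn'.not_ge hs1
  have hone : F (Finsupp.single (seg g (t n) (t (n + 1))) 1) = 1 := by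
    rw [hFn]
    have hsO := hi n s ⟨hsn'.le, hsn⟩
    have hst := hstrict n
    revert hsO hst
    rcases i n with _ | p
    · intro hsO _
      exact absurd hsZ hsO
    · intro hsO hst
      have h0 : p.1.2 (g s) = 0 := (p.2.mem_iff _ hsO).1 hsZ
      have h1 := hst p rfl ⟨le_rfl, hmono n⟩ ⟨hsn'.le, hsn⟩ hsn'
      have h2 := (hst p rfl).monotoneOn ⟨hsn'.le, hsn⟩ ⟨hmono n, le_rfl⟩ hsn
      simp only [h0] at h1 h2
      simp only [f, Option.elim, if_pos h2, if_neg h1.not_ge, sub_zero]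
  have hge : 1 ≤ F (z N) := by
    rw [map_sum]
    refine hone.symm.le.trans ?_
    exact Finset.single_le_sum (fun k _ => hnonneg k) (Finset.mem_range.2 hnN)
  omega

end IsFlowSlice

/-! ### The Reeb field in a chart -/

section

variable {E : Type} [NormedAddCommGroup E] [NormedSpace ℝ E]

/-- The exterior derivative of 1-forms commutes with pullback, because the second derivative of the
map `τ` is symmetric. -/
theorem fderiv_pullback_sub {A A' : E → E →L[ℝ] ℝ} {τ : E → E} {y : E} (hτ : ContDiffAt ℝ 2 τ y)
    (hA : DifferentiableAt ℝ A (τ y)) (hA' : A' =ᶠ[𝓝 y] fun z => (A (τ z)).comp (fderiv ℝ τ z))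
    (u v : E) : fderiv ℝ A' y u v - fderiv ℝ A' y v u =
      fderiv ℝ A (τ y) (fderiv ℝ τ y u) (fderiv ℝ τ y v) -
        fderiv ℝ A (τ y) (fderiv ℝ τ y v) (fderiv ℝ τ y u) := by
  have h1 : HasFDerivAt τ (fderiv ℝ τ y) y := (hτ.differentiableAt (by norm_num)).hasFDerivAt
  have h2 : HasFDerivAt (fderiv ℝ τ) (fderiv ℝ (fderiv ℝ τ) y) y :=
    ((hτ.fderiv_right (m := 1) (by norm_num)).differentiableAt (by norm_num)).hasFDerivAt
  have h3 := (hA.hasFDerivAt.comp y h1).clm_comp h2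
  have hs : IsSymmSndFDerivAt ℝ τ y := hτ.isSymmSndFDerivAt (by simp)
  rw [hA'.fderiv_eq]
  have h4 := h3.fderiv
  simp only [Function.comp_def] at h4
  rw [h4]
  simp [hs u v]

end

section

variable {M : Type} [TopologicalSpace M] [ChartedSpace (EuclideanSpace ℝ (Fin 3)) M]
  [IsManifold (𝓡 3) ∞ M]

theorem mfderiv_extChartAt_eq_fderiv {x₀ x : M} (hx : x ∈ (chartAt E3 x₀).source) :
    (mfderiv (𝓡 3) 𝓘(ℝ, E3) (extChartAt (𝓡 3) x₀) x : E3 →L[ℝ] E3) =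
      fderiv ℝ (extChartAt (𝓡 3) x₀ ∘ (extChartAt (𝓡 3) x).symm) (extChartAt (𝓡 3) x x) := by
  refine (mdifferentiableAt_extChartAt hx).mfderiv.trans ?_
  simp only [writtenInExtChartAt, fderivWithin_univ, extChartAt_model_space_eq_id,
    ModelWithCorners.range_eq_univ]
  rfl

theorem contDiffAt_coordChange {x₀ x : M} (hx : x ∈ (chartAt E3 x₀).source) :
    ContDiffAt ℝ ∞ (extChartAt (𝓡 3) x₀ ∘ (extChartAt (𝓡 3) x).symm) (extChartAt (𝓡 3) x x) := by
  have := contDiffWithinAt_ext_coord_change (I := 𝓡 3) (n := ∞) x₀ x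
    (y := extChartAt (𝓡 3) x x) (by
      rw [PartialEquiv.trans_source]
      simp [hx])
  rw [ModelWithCorners.range_eq_univ] at this
  exact contDiffWithinAt_univ.1 this

/-- The local expressions of a 1-form in two charts are pullbacks of each other. -/
theorem formInChart_eventuallyEq (α : ∀ x : M, TangentSpace (𝓡 3) x →L[ℝ] ℝ) {x₀ x : M}
    (hx : x ∈ (chartAt E3 x₀).source) :
    let τ := extChartAt (𝓡 3) x₀ ∘ (extChartAt (𝓡 3) x).symm
    formInChart α x =ᶠ[𝓝 (extChartAt (𝓡 3) x x)]
      fun y => (formInChart α x₀ (τ y)).comp (fderiv ℝ τ y) := by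
  intro τ
  let c := extChartAt (𝓡 3) x
  let c₀ := extChartAt (𝓡 3) x₀
  have ht : c.target ∈ 𝓝 (c x) := extChartAt_target_mem_nhds x
  have hs : c.symm ⁻¹' c₀.source ∈ 𝓝 (c x) := by
    refine (continuousAt_extChartAt_symm x).preimage_mem_nhds ?_
    rw [extChartAt_to_inv]
    exact (isOpen_extChartAt_source x₀).mem_nhds (by rwa [extChartAt_source])
  filter_upwards [eventually_eventually_nhds.2 ht, eventually_eventually_nhds.2 hs] with y hy hy'
  have hyt : y ∈ c.target := hy.self_of_nhds
  have hys : c.symm y ∈ c₀.source := hy'.self_of_nhds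
  have e : c.symm =ᶠ[𝓝 y] c₀.symm ∘ τ := by
    filter_upwards [hy'] with z hz
    exact (c₀.left_inv hz).symm
  have hτ : MDifferentiableAt 𝓘(ℝ, E3) 𝓘(ℝ, E3) τ y := by
    have h1 : MDifferentiableAt (𝓡 3) 𝓘(ℝ, E3) c₀ (c.symm y) :=
      mdifferentiableAt_extChartAt (by rwa [← extChartAt_source (𝓡 3)])
    have h2 : MDifferentiableAt 𝓘(ℝ, E3) (𝓡 3) c.symm y := by
      have := mdifferentiableWithinAt_extChartAt_symm (I := 𝓡 3) hyt
      rw [ModelWithCorners.range_eq_univ] at this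
      exact mdifferentiableWithinAt_univ.1 this
    exact h1.comp y h2
  have hτt : τ y ∈ c₀.target := c₀.map_source hys
  have h2 : MDifferentiableAt 𝓘(ℝ, E3) (𝓡 3) c₀.symm (τ y) := by
    have := mdifferentiableWithinAt_extChartAt_symm (I := 𝓡 3) hτt
    rw [ModelWithCorners.range_eq_univ] at this
    exact mdifferentiableWithinAt_univ.1 this
  have hpt : c₀.symm (τ y) = c.symm y := c₀.left_inv hys
  let α' : M → E3 →L[ℝ] ℝ := α
  have h3 : (mfderiv 𝓘(ℝ, E3) (𝓡 3) c.symm y : E3 →L[ℝ] E3) =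
      (mfderiv 𝓘(ℝ, E3) (𝓡 3) c₀.symm (τ y) : E3 →L[ℝ] E3).comp (fderiv ℝ τ y) := by
    have h4 : mfderiv 𝓘(ℝ, E3) 𝓘(ℝ, E3) τ y = fderiv ℝ τ y := mfderiv_eq_fderiv
    exact e.mfderiv_eq.trans ((mfderiv_comp y h2 hτ).trans (congrArg (fun B : E3 →L[ℝ] E3 =>
      (mfderiv 𝓘(ℝ, E3) (𝓡 3) c₀.symm (τ y) : E3 →L[ℝ] E3).comp B) h4))
  change (α' (c.symm y)).comp (mfderiv 𝓘(ℝ, E3) (𝓡 3) c.symm y : E3 →L[ℝ] E3) =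
    ((α' (c₀.symm (τ y))).comp (mfderiv 𝓘(ℝ, E3) (𝓡 3) c₀.symm (τ y) : E3 →L[ℝ] E3)).comp
      (fderiv ℝ τ y)
  rw [h3, hpt]
  rfl

/-- The exterior derivative at `x`, which is defined in the preferred chart at `x`, is computed in
the same way in every other chart. -/
theorem extDerivForm_eq {α : ∀ x : M, TangentSpace (𝓡 3) x →L[ℝ] ℝ} (hα : IsSmoothForm α)
    {x₀ x : M} (hx : x ∈ (chartAt E3 x₀).source) (u v : E3) :
    let D : E3 →L[ℝ] E3 := mfderiv (𝓡 3) 𝓘(ℝ, E3) (extChartAt (𝓡 3) x₀) x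
    extDerivForm α x u v =
      fderiv ℝ (formInChart α x₀) (extChartAt (𝓡 3) x₀ x) (D u) (D v) -
        fderiv ℝ (formInChart α x₀) (extChartAt (𝓡 3) x₀ x) (D v) (D u) := by
  intro D
  have hD : D = _ := mfderiv_extChartAt_eq_fderiv hx
  have hτx : (extChartAt (𝓡 3) x₀ ∘ (extChartAt (𝓡 3) x).symm) (extChartAt (𝓡 3) x x) =
      extChartAt (𝓡 3) x₀ x := by
    rw [Function.comp_apply, extChartAt_to_inv]
  have hA : DifferentiableAt ℝ (formInChart α x₀)
      ((extChartAt (𝓡 3) x₀ ∘ (extChartAt (𝓡 3) x).symm) (extChartAt (𝓡 3) x x)) := by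
    rw [hτx]
    exact ((hα x₀).contDiffAt (extChartAt_target_mem_nhds'
      ((extChartAt (𝓡 3) x₀).map_source (by rwa [extChartAt_source])))).differentiableAt
      (by simp)
  have := fderiv_pullback_sub ((contDiffAt_coordChange hx).of_le ENat.LEInfty.out) hA
    (formInChart_eventuallyEq α hx) u v
  rw [hτx, ← hD] at this
  exact this

theorem mfderiv_extChartAt_symm_self (x : M) :
    (mfderiv 𝓘(ℝ, E3) (𝓡 3) (extChartAt (𝓡 3) x).symm (extChartAt (𝓡 3) x x) : E3 →L[ℝ] E3) =
      ContinuousLinearMap.id ℝ E3 := by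
  have := mfderivWithin_range_extChartAt_symm (I := 𝓡 3) (x := x)
  rw [ModelWithCorners.range_eq_univ, mfderivWithin_univ] at this
  exact this

theorem formInChart_self (α : ∀ x : M, TangentSpace (𝓡 3) x →L[ℝ] ℝ) (x : M) :
    formInChart α x (extChartAt (𝓡 3) x x) = (α x : E3 →L[ℝ] ℝ) := by
  let α' : M → E3 →L[ℝ] ℝ := α
  change (α' _).comp (mfderiv 𝓘(ℝ, E3) (𝓡 3) (extChartAt (𝓡 3) x).symm (extChartAt (𝓡 3) x x) :
      E3 →L[ℝ] E3) = α' x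
  rw [mfderiv_extChartAt_symm_self, extChartAt_to_inv]
  rfl

theorem form_eq (α : ∀ x : M, TangentSpace (𝓡 3) x →L[ℝ] ℝ) {x₀ x : M}
    (hx : x ∈ (chartAt E3 x₀).source) (u : E3) :
    (α x : E3 →L[ℝ] ℝ) u = formInChart α x₀ (extChartAt (𝓡 3) x₀ x)
      ((mfderiv (𝓡 3) 𝓘(ℝ, E3) (extChartAt (𝓡 3) x₀) x : E3 →L[ℝ] E3) u) := by
  have h := (formInChart_self α x).symm.trans (formInChart_eventuallyEq α hx).self_of_nhds
  refine (congrArg (fun B : E3 →L[ℝ] ℝ => B u) h).trans ?_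
  simp only [← mfderiv_extChartAt_eq_fderiv hx, Function.comp_apply, extChartAt_to_inv]
  rfl

/-- A covector `a` and the antisymmetrization of `B`, seen as a 2-form, determine a vector `r` with
`a r = 1` in the kernel of the 2-form: it is proportional to the cross product. -/
theorem eq_smul_cross {a : E3 →L[ℝ] ℝ} {B : E3 →L[ℝ] E3 →L[ℝ] ℝ} {r : E3} (har : a r = 1)
    (hr : ∀ v, B r v - B v r = 0) :
    let b (i j : Fin 3) : ℝ := B (EuclideanSpace.single i 1) (EuclideanSpace.single j 1) -
      B (EuclideanSpace.single j 1) (EuclideanSpace.single i 1)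
    let w : E3 := !₂[b 1 2, b 2 0, b 0 1]
    w = a w • r := by
  intro b w
  have hsum (v : E3) : v = v 0 • EuclideanSpace.single 0 (1 : ℝ) +
      v 1 • EuclideanSpace.single 1 (1 : ℝ) + v 2 • EuclideanSpace.single 2 (1 : ℝ) := by
    ext i
    fin_cases i <;> simp
  have hB (i : Fin 3) : r 0 * b 0 i + r 1 * b 1 i + r 2 * b 2 i = 0 := by
    have h := hr (EuclideanSpace.single i 1)
    rw [hsum r] at h
    simp only [map_add, map_smul, add_apply, smul_apply,
      smul_eq_mul] at h
    simp only [b]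
    linear_combination h
  have hanti (i j : Fin 3) : b i j = -b j i := by simp only [b]; ring
  have h00 (i : Fin 3) : b i i = 0 := sub_self _
  have haw (v : E3) : a v = v 0 * a (EuclideanSpace.single 0 1) +
      v 1 * a (EuclideanSpace.single 1 1) + v 2 * a (EuclideanSpace.single 2 1) := by
    conv_lhs => rw [hsum v]
    simp only [map_add, map_smul, smul_eq_mul]
  have e0 : w 0 = b 1 2 := rfl
  have e1 : w 1 = b 2 0 := rfl
  have e2 : w 2 = b 0 1 := rfl
  have har' := haw r
  rw [har] at har'
  have h0 := hB 0
  have h1 := hB 1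
  have h2 := hB 2
  rw [h00, hanti 1 0] at h0
  rw [h00, hanti 2 1] at h1
  rw [h00, hanti 0 2] at h2
  ext i
  rw [PiLp.smul_apply, smul_eq_mul, haw w, e0, e1, e2]
  fin_cases i
  · change b 1 2 = _ * r 0
    linear_combination b 1 2 * har' + a (EuclideanSpace.single 1 1) * h2 -
      a (EuclideanSpace.single 2 1) * h1
  · change b 2 0 = _ * r 1
    linear_combination b 2 0 * har' + a (EuclideanSpace.single 2 1) * h0 -
      a (EuclideanSpace.single 0 1) * h2
  · change b 0 1 = _ * r 2
    linear_combination b 0 1 * har' + a (EuclideanSpace.single 0 1) * h1 -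
      a (EuclideanSpace.single 1 1) * h0

/-- The local expression of the Reeb field in a chart is continuous. -/
theorem IsReebField.continuousAt {α : ∀ x : M, TangentSpace (𝓡 3) x →L[ℝ] ℝ}
    (hα : IsContactForm α) {R : ∀ x : M, TangentSpace (𝓡 3) x} (hR : IsReebField α R) (x₀ : M) :
    ContinuousAt (fun x => (mfderiv (𝓡 3) 𝓘(ℝ, E3) (extChartAt (𝓡 3) x₀) x (R x) : E3)) x₀ := by
  let A := formInChart α x₀
  let b (i j : Fin 3) (y : E3) : ℝ :=
    fderiv ℝ A y (EuclideanSpace.single i 1) (EuclideanSpace.single j 1) -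
      fderiv ℝ A y (EuclideanSpace.single j 1) (EuclideanSpace.single i 1)
  let w (y : E3) : E3 := !₂[b 1 2 y, b 2 0 y, b 0 1 y]
  let c := extChartAt (𝓡 3) x₀
  let r (x : M) : E3 := mfderiv (𝓡 3) 𝓘(ℝ, E3) c x (R x)
  have hw (x : M) (hx : x ∈ (chartAt E3 x₀).source) :
      w (c x) = A (c x) (w (c x)) • r x ∧ A (c x) (w (c x)) ≠ 0 := by
    let D : E3 →L[ℝ] E3 := mfderiv (𝓡 3) 𝓘(ℝ, E3) c x
    have hD : Function.Surjective D :=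
      (isInvertible_mfderiv_extChartAt (by rwa [extChartAt_source])).surjective
    have h1 : A (c x) (r x) = 1 := (form_eq α hx (R x)).symm.trans (hR x).1
    have h2 (v : E3) : fderiv ℝ A (c x) (r x) v - fderiv ℝ A (c x) v (r x) = 0 := by
      obtain ⟨v, rfl⟩ := hD v
      exact (extDerivForm_eq hα.smooth hx (R x) v).symm.trans ((hR x).2 v)
    have h3 : w (c x) = A (c x) (w (c x)) • r x := eq_smul_cross h1 h2
    refine ⟨h3, fun h0 => ?_⟩
    -- otherwise `dα` vanishes at `x`
    rw [h0, zero_smul] at h3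
    have hb (i j : Fin 3) : b i j (c x) = 0 := by
      have e0 : b 1 2 (c x) = 0 := congrArg (fun v : E3 => v 0) h3
      have e1 : b 2 0 (c x) = 0 := congrArg (fun v : E3 => v 1) h3
      have e2 : b 0 1 (c x) = 0 := congrArg (fun v : E3 => v 2) h3
      simp only [b] at e0 e1 e2 ⊢
      fin_cases i <;> fin_cases j <;> simp only [Fin.zero_eta, Fin.mk_one, Fin.reduceFinMk] <;>
        linarith
    have hbil (u v : E3) : fderiv ℝ A (c x) u v - fderiv ℝ A (c x) v u = 0 := by
      have h (L : E3 →L[ℝ] E3 →L[ℝ] ℝ) (hL : ∀ i j : Fin 3, L (EuclideanSpace.single i 1)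
          (EuclideanSpace.single j 1) = 0) : L = 0 := by
        refine ContinuousLinearMap.coe_injective ?_
        refine (EuclideanSpace.basisFun (Fin 3) ℝ).toBasis.ext fun i => ?_
        refine ContinuousLinearMap.coe_injective ?_
        refine (EuclideanSpace.basisFun (Fin 3) ℝ).toBasis.ext fun j => ?_
        simpa using hL i j
      have h4 := h (fderiv ℝ A (c x) - (fderiv ℝ A (c x)).flip) fun i j => by
        simpa using hb i j
      simpa using congrArg (fun L : E3 →L[ℝ] E3 →L[ℝ] ℝ => L u v) h4
    have hd (u v : TangentSpace (𝓡 3) x) : extDerivForm α x u v = 0 :=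
      (extDerivForm_eq hα.smooth hx u v).trans (hbil _ _)
    obtain ⟨u, v, t, h⟩ := hα.nondegenerate x
    exact h (by simp [contactVolume, hd])
  have hev : (fun x => (A (c x) (w (c x)))⁻¹ • w (c x)) =ᶠ[𝓝 x₀] r := by
    filter_upwards [chart_source_mem_nhds E3 x₀] with x hx
    obtain ⟨h1, h2⟩ := hw x hx
    rw [inv_smul_eq_iff₀ h2]
    exact h1
  refine ContinuousAt.congr ?_ hev
  have hc : ContinuousAt c x₀ := continuousAt_extChartAt x₀
  have hA : ContDiffAt ℝ ∞ A (c x₀) := (hα.smooth x₀).contDiffAt (extChartAt_target_mem_nhds x₀)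
  have hA' : ContinuousAt (fderiv ℝ A) (c x₀) :=
    (hA.fderiv_right (m := 0) (by simp)).continuousAt
  have hbc (i j) : ContinuousAt (b i j) (c x₀) :=
    ((hA'.clm_apply continuousAt_const).clm_apply continuousAt_const).sub
      ((hA'.clm_apply continuousAt_const).clm_apply continuousAt_const)
  have hwc : ContinuousAt w (c x₀) := by
    have : ContinuousAt (fun y => ![b 1 2 y, b 2 0 y, b 0 1 y]) (c x₀) := by
      refine continuousAt_pi.2 fun i => ?_
      fin_cases i
      exacts [hbc 1 2, hbc 2 0, hbc 0 1]
    exact (PiLp.continuous_toLp 2 _).continuousAt.comp this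
  have h1 : ContinuousAt (fun y => (A y (w y))⁻¹ • w y) (c x₀) :=
    ((hA.continuousAt.clm_apply hwc).inv₀ (hw x₀ (mem_chart_source E3 x₀)).2).smul hwc
  exact h1.comp hc

end

/-! ### The surface as a transverse level set -/

section

theorem OpenPartialHomeomorph.mdifferentiable_of_mem_maximalAtlas {E H N : Type*}
    [NormedAddCommGroup E] [NormedSpace ℝ E] [TopologicalSpace H] {I : ModelWithCorners ℝ E H}
    [TopologicalSpace N] [ChartedSpace H N] [IsManifold I ∞ N] {e : OpenPartialHomeomorph N H}
    (he : e ∈ IsManifold.maximalAtlas I ∞ N) : e.MDifferentiable I I :=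
  ⟨(contMDiffOn_of_mem_maximalAtlas he).mdifferentiableOn (by simp),
    (contMDiffOn_symm_of_mem_maximalAtlas he).mdifferentiableOn (by simp)⟩

/-- An interior point is in the interior of the image of every chart, since the chart has a
surjective derivative. -/
theorem ModelWithCorners.IsInteriorPoint.mem_interior_extend_target {E H N : Type*}
    [NormedAddCommGroup E] [NormedSpace ℝ E] [TopologicalSpace H] {I : ModelWithCorners ℝ E H}
    [TopologicalSpace N] [ChartedSpace H N] [IsManifold I ∞ N] {e : OpenPartialHomeomorph N H}
    (he : e ∈ IsManifold.maximalAtlas I ∞ N) {s : N} (hs : s ∈ e.source)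
    (hi : I.IsInteriorPoint s) : e.extend I s ∈ interior (e.extend I).target := by
  have hd := OpenPartialHomeomorph.mdifferentiable_of_mem_maximalAtlas he
  have h := (hd.mdifferentiableAt hs).isInteriorPoint_of_surjective_mfderiv
    (hd.mfderiv_surjective hs) hi
  refine e.mem_interior_extend_target (e.map_source hs) ?_
  rw [ModelWithCorners.IsInteriorPoint, extChartAt_self_eq] at h
  exact h

section

variable {M : Type} [TopologicalSpace M] [ChartedSpace (EuclideanSpace ℝ (Fin 3)) M]

theorem hasDerivAt_comp_flow {α : ∀ x : M, TangentSpace (𝓡 3) x →L[ℝ] ℝ}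
    {R : ∀ x : M, TangentSpace (𝓡 3) x} {φ : Flow ℝ M} (hφ : IsReebFlow α R φ) {h : M → ℝ} {x : M}
    (hh : MDifferentiableAt (𝓡 3) 𝓘(ℝ, ℝ) h x) :
    HasDerivAt (fun t => h (φ t x)) (mfderiv (𝓡 3) 𝓘(ℝ, ℝ) h x (R x) : ℝ) 0 := by
  let d : M → ℝ := fun x => mfderiv (𝓡 3) 𝓘(ℝ, ℝ) h x (R x)
  have h0 : φ 0 x = x := φ.map_zero_apply x
  have h1 := hφ.generated x 0
  have h2 : MDifferentiableAt (𝓡 3) 𝓘(ℝ, ℝ) h (φ 0 x) := by rwa [h0]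
  have aux {L : E3 →L[ℝ] ℝ} {r : E3} {g : ℝ → ℝ}
      (hg : HasFDerivAt g (L.comp (ContinuousLinearMap.smulRight (1 : ℝ →L[ℝ] ℝ) r)) 0) :
      HasDerivAt g (L r) 0 := by
    simpa using hg.hasDerivAt
  have h4 : HasDerivAt (fun t => h (φ t x)) (d (φ 0 x)) 0 :=
    aux (h2.hasMFDerivAt.comp 0 h1).hasFDerivAt
  rw [h0] at h4
  exact h4

theorem extDerivForm_self (α : ∀ x : M, TangentSpace (𝓡 3) x →L[ℝ] ℝ) (x : M)
    (u : TangentSpace (𝓡 3) x) : extDerivForm α x u u = 0 := sub_self _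

theorem extDerivForm_swap (α : ∀ x : M, TangentSpace (𝓡 3) x →L[ℝ] ℝ) (x : M)
    (u v : TangentSpace (𝓡 3) x) : extDerivForm α x u v = -extDerivForm α x v u :=
  (neg_sub _ _).symm

theorem extDerivForm_add_left (α : ∀ x : M, TangentSpace (𝓡 3) x →L[ℝ] ℝ) (x : M)
    (u u' v : TangentSpace (𝓡 3) x) :
    extDerivForm α x (u + u') v = extDerivForm α x u v + extDerivForm α x u' v := by
  let B := fderiv ℝ (formInChart α x) (extChartAt 𝓘(ℝ, E3) x x)
  have h (u u' v : E3) : B (u + u') v - B v (u + u') = B u v - B v u + (B u' v - B v u') := by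
    rw [map_add, map_add, add_apply]
    ring
  exact h u u' v

theorem extDerivForm_smul_left (α : ∀ x : M, TangentSpace (𝓡 3) x →L[ℝ] ℝ) (x : M)
    (a : ℝ) (u v : TangentSpace (𝓡 3) x) :
    extDerivForm α x (a • u) v = a * extDerivForm α x u v := by
  let B := fderiv ℝ (formInChart α x) (extChartAt 𝓘(ℝ, E3) x x)
  have h (u v : E3) : B (a • u) v - B v (a • u) = a * (B u v - B v u) := by
    rw [map_smul, map_smul, smul_apply, smul_eq_mul, smul_eq_mul]
    ring
  exact h u v

/-- The Reeb field is transverse to a plane on which `dα` does not vanish. -/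
theorem IsReebField.linearIndependent {α : ∀ x : M, TangentSpace (𝓡 3) x →L[ℝ] ℝ}
    {R : ∀ x : M, TangentSpace (𝓡 3) x} (hR : IsReebField α R) {x : M}
    {u v : TangentSpace (𝓡 3) x} (h : extDerivForm α x u v ≠ 0) :
    LinearIndependent ℝ ![R x, u, v] := by
  rw [Fintype.linearIndependent_iff]
  intro g hg
  rw [Fin.sum_univ_three] at hg
  simp only [Matrix.cons_val] at hg
  have e (w : TangentSpace (𝓡 3) x) :
      g 1 * extDerivForm α x u w + g 2 * extDerivForm α x v w = 0 := by
    have h0 : extDerivForm α x 0 w = 0 := by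
      have := extDerivForm_smul_left α x 0 0 w
      rwa [zero_smul, zero_mul] at this
    rw [← hg, extDerivForm_add_left, extDerivForm_add_left, extDerivForm_smul_left,
      extDerivForm_smul_left, extDerivForm_smul_left, (hR x).2] at h0
    linarith
  have e1 := e v
  rw [extDerivForm_self, mul_zero, add_zero] at e1
  have g1 := (mul_eq_zero.1 e1).resolve_right h
  have e2 := e u
  rw [extDerivForm_self, mul_zero, zero_add, extDerivForm_swap] at e2
  have g2 := (mul_eq_zero.1 e2).resolve_right (neg_ne_zero.2 h)
  have g0 : g 0 = 0 := by
    rw [g1, g2, zero_smul, zero_smul, add_zero, add_zero] at hg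
    have := congrArg (α x) hg
    rw [map_smul, (hR x).1, map_zero] at this
    simpa using this
  intro i
  fin_cases i
  exacts [g0, g1, g2]

end

variable {M : Type} [TopologicalSpace M] [ChartedSpace (EuclideanSpace ℝ (Fin 3)) M]
  [IsManifold (𝓡 3) ∞ M]

/-- Near an interior point, an embedded surface in a 3-manifold is a regular level set. -/
theorem exists_defining_function {S : Type*} [TopologicalSpace S]
    [ChartedSpace (EuclideanHalfSpace 2) S] [IsManifold (𝓡∂ 2) ∞ S] {f : S → M}
    (hf : IsSmoothEmbedding (𝓡∂ 2) (𝓡 3) ∞ f) {s₀ : S} (hs₀ : (𝓡∂ 2).IsInteriorPoint s₀) :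
    ∃ (O : Set M) (h : M → ℝ), IsOpen O ∧ f s₀ ∈ O ∧ ContMDiffOn (𝓡 3) 𝓘(ℝ, ℝ) ∞ h O ∧
      (∀ x ∈ O, x ∈ range f ↔ h x = 0) ∧ mfderiv (𝓡 3) 𝓘(ℝ, ℝ) h (f s₀) ≠ 0 := by
  have hi := hf.isImmersion.isImmersionAt s₀
  let F := hi.complement
  let dom := hi.domChart
  let cod := hi.codChart
  let T : (E2 × F) ≃L[ℝ] E3 := hi.equiv
  have hwr : ∀ u ∈ (dom.extend (𝓡∂ 2)).target,
      cod (f ((dom.extend (𝓡∂ 2)).symm u)) = T (u, 0) := hi.writtenInCharts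
  have hcod : cod.MDifferentiable (𝓡 3) (𝓡 3) :=
    OpenPartialHomeomorph.mdifferentiable_of_mem_maximalAtlas hi.codChart_mem_maximalAtlas
  -- the complement is a line
  have : FiniteDimensional ℝ F := Module.Finite.of_injective
    (T.toLinearMap ∘ₗ LinearMap.inr ℝ E2 F) (T.injective.comp LinearMap.inr_injective)
  have hrank : Module.finrank ℝ F = Module.finrank ℝ ℝ := by
    have h := T.toLinearEquiv.finrank_eq
    rw [Module.finrank_prod, finrank_euclideanSpace_fin, finrank_euclideanSpace_fin] at h
    rw [Module.finrank_self]
    omega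
  let ℓ : F ≃L[ℝ] ℝ := ContinuousLinearEquiv.ofFinrankEq hrank
  let Λ : E3 →L[ℝ] ℝ := (ℓ : F →L[ℝ] ℝ) ∘L ContinuousLinearMap.snd ℝ E2 F ∘L
    (T.symm : E3 →L[ℝ] E2 × F)
  have hΛ : Function.Surjective Λ :=
    ℓ.surjective.comp (Prod.snd_surjective.comp T.symm.surjective)
  have hΛ0 (y : E3) : Λ y = 0 ↔ (T.symm y).2 = 0 := ℓ.map_eq_zero_iff
  obtain ⟨W, hW, hWs⟩ := hf.isEmbedding.isInducing.isOpen_iff.1 dom.open_source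
  have hO : IsOpen (cod.source ∩ cod ⁻¹'
      ((fun y => (T.symm y).1) ⁻¹' interior (dom.extend (𝓡∂ 2)).target) ∩ W) :=
    (cod.isOpen_inter_preimage (isOpen_interior.preimage
      (continuous_fst.comp T.symm.continuous))).inter hW
  have hval (s : S) (hs : s ∈ dom.source) : T.symm (cod (f s)) = (dom.extend (𝓡∂ 2) s, 0) := by
    have h1 := hwr (dom.extend (𝓡∂ 2) s)
      ((dom.extend (𝓡∂ 2)).map_source (by rwa [dom.extend_source]))
    rw [dom.extend_left_inv hs] at h1
    rw [h1, T.symm_apply_apply]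
  refine ⟨_, fun x => Λ (cod x), hO, ⟨⟨hi.mem_codChart_source, ?_⟩, ?_⟩, ?_, ?_, ?_⟩
  · change (T.symm (cod (f s₀))).1 ∈ interior (dom.extend (𝓡∂ 2)).target
    rw [hval s₀ hi.mem_domChart_source]
    exact hs₀.mem_interior_extend_target hi.domChart_mem_maximalAtlas hi.mem_domChart_source
  · have : s₀ ∈ f ⁻¹' W := hWs ▸ hi.mem_domChart_source
    exact this
  · exact Λ.contMDiff.comp_contMDiffOn ((contMDiffOn_of_mem_maximalAtlas
      hi.codChart_mem_maximalAtlas).mono fun x hx => hx.1.1)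
  · rintro x ⟨⟨hx, hxt⟩, hxW⟩
    rw [hΛ0]
    constructor
    · rintro ⟨s, rfl⟩
      have hs : s ∈ dom.source := hWs ▸ hxW
      rw [hval s hs]
    · intro h0
      have hu := interior_subset hxt
      refine ⟨(dom.extend (𝓡∂ 2)).symm (T.symm (cod x)).1, ?_⟩
      have hs : (dom.extend (𝓡∂ 2)).symm (T.symm (cod x)).1 ∈ dom.source := by
        rw [← dom.extend_source (I := 𝓡∂ 2)]
        exact (dom.extend (𝓡∂ 2)).map_target hu
      refine cod.injOn (hi.source_subset_preimage_source hs) hx ?_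
      rw [hwr _ hu, ← h0]
      exact T.apply_symm_apply _
  · have h1 : mfderiv (𝓡 3) 𝓘(ℝ, ℝ) (Λ ∘ cod) (f s₀) = _ :=
      mfderiv_comp (I' := 𝓡 3) (f s₀) Λ.mdifferentiableAt
        (hcod.mdifferentiableAt hi.mem_codChart_source)
    have h2 : mfderiv (𝓡 3) 𝓘(ℝ, ℝ) Λ (cod (f s₀)) = Λ := Λ.mfderiv_eq
    rw [h2] at h1
    intro h0
    obtain ⟨v, hv⟩ := hΛ 1
    obtain ⟨v, rfl⟩ := hcod.mfderiv_surjective hi.mem_codChart_source v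
    have h3 := DFunLike.congr_fun (h1.symm.trans h0) v
    exact one_ne_zero (α := ℝ) (hv.symm.trans h3)

/-- The derivative of a smooth function along the Reeb field is continuous. -/
theorem IsReebField.continuousAt_mfderiv {α : ∀ x : M, TangentSpace (𝓡 3) x →L[ℝ] ℝ}
    (hα : IsContactForm α) {R : ∀ x : M, TangentSpace (𝓡 3) x} (hR : IsReebField α R) {h : M → ℝ}
    {x₀ : M} (hh : ContMDiffAt (𝓡 3) 𝓘(ℝ, ℝ) ∞ h x₀) :
    ContinuousAt (fun x => (mfderiv (𝓡 3) 𝓘(ℝ, ℝ) h x (R x) : ℝ)) x₀ := by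
  let c := extChartAt (𝓡 3) x₀
  let H : E3 → ℝ := h ∘ c.symm
  have hH : ContDiffAt ℝ ∞ H (c x₀) := by
    have h1 : ContMDiffAt 𝓘(ℝ, E3) (𝓡 3) ∞ c.symm (c x₀) :=
      (contMDiffOn_extChartAt_symm x₀).contMDiffAt (extChartAt_target_mem_nhds x₀)
    have h2 : ContMDiffAt (𝓡 3) 𝓘(ℝ, ℝ) ∞ h (c.symm (c x₀)) := by rwa [extChartAt_to_inv]
    exact (h2.comp _ h1).contDiffAt
  have hc : ContinuousAt c x₀ := continuousAt_extChartAt x₀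
  have hHd : ∀ᶠ y in 𝓝 (c x₀), DifferentiableAt ℝ H y := by
    filter_upwards [(hH.of_le (m := 1) (by simp)).eventually (by simp)] with y hy
    exact hy.differentiableAt (by simp)
  have hev : (fun x => fderiv ℝ H (c x) (mfderiv (𝓡 3) 𝓘(ℝ, E3) c x (R x) : E3)) =ᶠ[𝓝 x₀]
      fun x => (mfderiv (𝓡 3) 𝓘(ℝ, ℝ) h x (R x) : ℝ) := by
    filter_upwards [hc.eventually hHd, extChartAt_source_mem_nhds (I := 𝓡 3) x₀] with x hx hxs
    have e : h =ᶠ[𝓝 x] H ∘ c := by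
      filter_upwards [(isOpen_extChartAt_source x₀).mem_nhds hxs] with z hz
      exact congrArg h (c.left_inv hz).symm
    have h1 : mfderiv (𝓡 3) 𝓘(ℝ, ℝ) (H ∘ c) x = _ :=
      mfderiv_comp (I' := 𝓘(ℝ, E3)) x hx.mdifferentiableAt
        (mdifferentiableAt_extChartAt (by rwa [extChartAt_source] at hxs))
    have h2 : mfderiv 𝓘(ℝ, E3) 𝓘(ℝ, ℝ) H (c x) = fderiv ℝ H (c x) := mfderiv_eq_fderiv
    rw [h2] at h1
    exact (DFunLike.congr_fun (e.mfderiv_eq.trans h1) (R x)).symm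
  refine ContinuousAt.congr ?_ hev
  have h1 : ContinuousAt (fderiv ℝ H) (c x₀) := (hH.fderiv_right (m := 0) (by simp)).continuousAt
  exact (h1.comp hc).clm_apply (hR.continuousAt hα x₀)

/-- Near an interior point of a global surface of section, the surface is a level set of a function
that increases along the Reeb flow. -/
theorem IsGlobalSurfaceOfSection.exists_isFlowSlice {α : ∀ x : M, TangentSpace (𝓡 3) x →L[ℝ] ℝ}
    (hα : IsContactForm α) {R : ∀ x : M, TangentSpace (𝓡 3) x} {φ : Flow ℝ M}
    (hφ : IsReebFlow α R φ) {S : Type*} [TopologicalSpace S]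
    [ChartedSpace (EuclideanHalfSpace 2) S] [IsManifold (𝓡∂ 2) ∞ S] {f : S → M}
    (hS : IsGlobalSurfaceOfSection α R φ f) {s₀ : S} (hs₀ : s₀ ∈ (𝓡∂ 2).interior S) :
    ∃ O h, f s₀ ∈ O ∧ IsFlowSlice φ (range f) O h := by
  obtain ⟨O, h, hO, hfO, hh, hZ, hd⟩ := exists_defining_function hS.embedded hs₀
  have hhat {x} (hx : x ∈ O) : ContMDiffAt (𝓡 3) 𝓘(ℝ, ℝ) ∞ h x := hh.contMDiffAt (hO.mem_nhds hx)
  let d : M → ℝ := fun x => mfderiv (𝓡 3) 𝓘(ℝ, ℝ) h x (R x)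
  have hdc : ContinuousAt d (f s₀) := hφ.reeb.continuousAt_mfderiv hα (hhat hfO)
  have hderiv {x} (hx : x ∈ O) : HasDerivAt (fun t => h (φ t x)) (d x) 0 :=
    hasDerivAt_comp_flow hφ ((hhat hx).mdifferentiableAt (by simp))
  -- the flow is transverse to the surface
  have hd0 : d (f s₀) ≠ 0 := by
    obtain ⟨o, ho⟩ := hS.transverse
    intro h0
    have hrank : Module.finrank ℝ (TangentSpace (𝓡∂ 2) s₀) = 2 := finrank_euclideanSpace_fin
    obtain ⟨b, hb⟩ : ∃ b : Module.Basis (Fin 2) ℝ (TangentSpace (𝓡∂ 2) s₀),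
        b.orientation = o.at' s₀ := by
      let b : Module.Basis (Fin 2) ℝ (TangentSpace (𝓡∂ 2) s₀) :=
        (EuclideanSpace.basisFun (Fin 2) ℝ).toBasis
      exact ⟨b.adjustToOrientation (o.at' s₀), b.orientation_adjustToOrientation _⟩
    have hpos := ho s₀ hs₀ b hb
    have hdα : extDerivForm α (f s₀) (mfderiv (𝓡∂ 2) (𝓡 3) f s₀ (b 0))
        (mfderiv (𝓡∂ 2) (𝓡 3) f s₀ (b 1)) ≠ 0 := by
      rw [contactVolume, (hφ.reeb _).1, (hφ.reeb _).2, extDerivForm_swap α _ _ (R _),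
        (hφ.reeb _).2] at hpos
      intro h0
      rw [h0] at hpos
      simp at hpos
    have hli := hφ.reeb.linearIndependent hdα
    have hT (v : TangentSpace (𝓡∂ 2) s₀) :
        mfderiv (𝓡 3) 𝓘(ℝ, ℝ) h (f s₀) (mfderiv (𝓡∂ 2) (𝓡 3) f s₀ v) = 0 := by
      have h1 : mfderiv (𝓡∂ 2) 𝓘(ℝ, ℝ) (h ∘ f) s₀ = _ :=
        mfderiv_comp (I' := 𝓡 3) s₀ ((hhat hfO).mdifferentiableAt (by simp))
          (hS.embedded.contMDiff.mdifferentiableAt (by simp))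
      have e : h ∘ f =ᶠ[𝓝 s₀] fun _ => (0 : ℝ) := by
        filter_upwards [(hO.preimage hS.embedded.isEmbedding.continuous).mem_nhds hfO] with s hs
        exact (hZ _ hs).1 ⟨s, rfl⟩
      have h2 : mfderiv (𝓡∂ 2) 𝓘(ℝ, ℝ) (h ∘ f) s₀ = 0 := e.mfderiv_eq.trans mfderiv_const
      exact (DFunLike.congr_fun (h1.symm.trans h2) v)
    have hcard : Fintype.card (Fin 3) = Module.finrank ℝ (TangentSpace (𝓡 3) (f s₀)) := by
      rw [Fintype.card_fin]
      exact finrank_euclideanSpace_fin.symm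
    refine hd ?_
    refine ContinuousLinearMap.coe_injective ?_
    refine (basisOfLinearIndependentOfCardEqFinrank hli hcard).ext fun i => ?_
    rw [coe_basisOfLinearIndependentOfCardEqFinrank]
    fin_cases i
    · exact h0
    · exact hT (b 0)
    · exact hT (b 1)
  have key (ε : ℝ) (hε : ε ≠ 0) (hpos : 0 < ε * d (f s₀)) :
      ∃ O h, f s₀ ∈ O ∧ IsFlowSlice φ (range f) O h := by
    obtain ⟨V, hV, hVo, hfV⟩ := eventually_nhds_iff.1
      ((continuousAt_const.mul hdc).eventually_const_lt hpos)
    refine ⟨O ∩ V, fun x => ε * h x, ⟨hfO, hfV⟩, hO.inter hVo, ?_, ?_, ?_⟩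
    · exact continuousOn_const.mul (hh.continuousOn.mono inter_subset_left)
    · intro x hx
      rw [hZ x hx.1, mul_eq_zero, or_iff_right hε]
    · intro x hx
      exact ⟨_, hV x hx.2, (hderiv hx.1).const_mul ε⟩
  rcases hd0.lt_or_gt with h | h
  · exact key (-1) (by norm_num) (by linarith)
  · exact key 1 one_ne_zero (by linarith)

end

/-! ### A straightening chart of a knot -/

section

variable {E : Type*} [NormedAddCommGroup E] [NormedSpace ℝ E]

/-- The wedge product of a covector and the antisymmetrization of a bilinear form. -/
noncomputable def wedgeForm (a : E →L[ℝ] ℝ) (B : E →L[ℝ] E →L[ℝ] ℝ) : E [⋀^Fin 3]→ₗ[ℝ] ℝ where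
  toFun v := a (v 0) * (B (v 1) (v 2) - B (v 2) (v 1)) +
    a (v 1) * (B (v 2) (v 0) - B (v 0) (v 2)) + a (v 2) * (B (v 0) (v 1) - B (v 1) (v 0))
  map_update_add' {inst} m i x y := by
    obtain rfl := Subsingleton.elim inst (instDecidableEqFin 3)
    fin_cases i <;> simp <;> ring
  map_update_smul' {inst} m i c x := by
    obtain rfl := Subsingleton.elim inst (instDecidableEqFin 3)
    fin_cases i <;> simp <;> ring
  map_eq_zero_of_eq' v i j h hij := by
    have e (i j : Fin 3) (h : v i = v j) : B (v i) = B (v j) := congrArg B h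
    fin_cases i <;> fin_cases j <;> first | exact absurd rfl hij | (simp at h ⊢; rw [h]; ring)

end

section

variable {M : Type} [TopologicalSpace M] [ChartedSpace (EuclideanSpace ℝ (Fin 3)) M]

/-- Every nonzero vector is the last vector of a positive frame. -/
theorem IsContactForm.exists_positive_frame {α : ∀ x : M, TangentSpace (𝓡 3) x →L[ℝ] ℝ}
    (hα : IsContactForm α) (x : M) {c : E3} (hc : c ≠ 0) :
    ∃ a b : E3, LinearIndependent ℝ ![a, b, c] ∧ 0 < contactVolume α x a b c := by
  let vol := wedgeForm (α x : E3 →L[ℝ] ℝ) (fderiv ℝ (formInChart α x) (extChartAt 𝓘(ℝ, E3) x x))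
  have hrank : Module.finrank ℝ E3 = 3 := finrank_euclideanSpace_fin
  have h1 : LinearIndependent ℝ ![c] := by
    rw [linearIndependent_unique_iff]
    exact hc
  obtain ⟨b, hb⟩ := exists_linearIndependent_cons_of_lt_finrank h1 (by rw [hrank]; norm_num)
  obtain ⟨a, ha⟩ := exists_linearIndependent_cons_of_lt_finrank hb (by rw [hrank]; norm_num)
  have hli : LinearIndependent ℝ ![a, b, c] := ha
  have hvol : vol ≠ 0 := by
    obtain ⟨u, v, w, h⟩ := hα.nondegenerate x
    intro h0
    exact h (DFunLike.congr_fun h0 ![u, v, w])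
  have hne : vol ![a, b, c] ≠ 0 := by
    have h := (AlternatingMap.map_basis_ne_zero_iff
      (basisOfLinearIndependentOfCardEqFinrank hli (by rw [Fintype.card_fin, hrank])) vol).2 hvol
    rwa [coe_basisOfLinearIndependentOfCardEqFinrank] at h
  rcases hne.lt_or_gt with h | h
  · refine ⟨-a, b, ?_, ?_⟩
    · have := hli.units_smul ![-1, 1, 1]
      convert this using 1
      ext i j
      fin_cases i <;> simp [Units.smul_def]
    · have h2 : contactVolume α x (-a) b c = -vol ![a, b, c] := by
        have := vol.map_update_smul ![a, b, c] 0 (-1) a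
        have e1 : Function.update ![a, b, c] 0 ((-1 : ℝ) • a) = ![-a, b, c] := by
          ext i j
          fin_cases i <;> simp
        have e2 : Function.update ![a, b, c] 0 a = ![a, b, c] := by
          ext i j
          fin_cases i <;> simp
        rw [e1, e2, neg_smul, one_smul] at this
        exact this
      rw [h2]
      linarith
  · exact ⟨a, b, hli, h⟩

end

namespace OrientedKnot

variable {M : Type} [TopologicalSpace M] [ChartedSpace (EuclideanSpace ℝ (Fin 3)) M]

theorem toFun_add_int (K : OrientedKnot M) (t : ℝ) (n : ℤ) : K.toFun (t + n) = K.toFun t := by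
  have := K.periodic.int_mul n t
  rwa [mul_one] at this

theorem toFun_eq_toFun_zero_iff (K : OrientedKnot M) (t : ℝ) :
    K.toFun t = K.toFun 0 ↔ ∃ n : ℤ, t = n := by
  constructor
  · intro h
    rw [← Int.fract_add_floor t, toFun_add_int] at h
    have := K.injOn ⟨Int.fract_nonneg t, Int.fract_lt_one t⟩ ⟨le_rfl, one_pos⟩ h
    exact ⟨⌊t⌋, by rw [← Int.fract_add_floor t, this]; simp⟩
  · rintro ⟨n, rfl⟩
    rw [← zero_add (n : ℝ), toFun_add_int]

/-- A knot returns to a small neighbourhood of its initial point only at times close to integers. -/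
theorem exists_nhds_abs_sub_round_lt [T2Space M] (K : OrientedKnot M) {η : ℝ} (hη : 0 < η) :
    ∃ N : Set M, IsOpen N ∧ K.toFun 0 ∈ N ∧ ∀ t, K.toFun t ∈ N → |t - round t| < η := by
  have hC : IsCompact (K.toFun '' (Icc (-(1 / 2)) (1 / 2) ∩ {t | η ≤ |t|})) :=
    (isCompact_Icc.inter_right (isClosed_le continuous_const continuous_abs)).image
      K.smooth.continuous
  refine ⟨_, hC.isClosed.isOpen_compl, ?_, fun t ht => ?_⟩
  · rintro ⟨t, ⟨ht, htη⟩, h0⟩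
    obtain ⟨n, rfl⟩ := (K.toFun_eq_toFun_zero_iff t).1 h0
    have hn : n = 0 := by
      have h1 : (-1 : ℝ) < n := by linarith [ht.1]
      have h2 : (n : ℝ) < 1 := by linarith [ht.2]
      have h1' : (-1 : ℤ) < n := by exact_mod_cast h1
      have h2' : n < (1 : ℤ) := by exact_mod_cast h2
      omega
    rw [hn, mem_ofPred_eq] at htη
    simp at htη
    linarith
  · by_contra hlt
    refine ht ⟨t - round t, ⟨abs_le.1 (abs_sub_round t), not_lt.1 hlt⟩, ?_⟩
    have := K.toFun_add_int t (-round t)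
    rwa [Int.cast_neg, ← sub_eq_add_neg] at this

/-- The knot in the preferred chart at its initial point. -/
noncomputable def coord (K : OrientedKnot M) (t : ℝ) : E3 := chartAt E3 (K.toFun 0) (K.toFun t)

variable [IsManifold (𝓡 3) ∞ M]

theorem contDiffAt_coord (K : OrientedKnot M) {t : ℝ}
    (ht : K.toFun t ∈ (chartAt E3 (K.toFun 0)).source) : ContDiffAt ℝ ∞ K.coord t :=
  ((contMDiffAt_of_mem_maximalAtlas (I := 𝓡 3) (IsManifold.chart_mem_maximalAtlas _) ht).comp t
    (K.smooth t)).contDiffAt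

theorem deriv_coord_ne_zero (K : OrientedKnot M) : deriv K.coord 0 ≠ 0 := by
  have hs := mem_chart_source E3 (K.toFun 0)
  have hc := OpenPartialHomeomorph.mdifferentiable_of_mem_maximalAtlas
    (IsManifold.chart_mem_maximalAtlas (I := 𝓡 3) (n := ∞) (K.toFun 0))
  have h1 : mfderiv 𝓘(ℝ, ℝ) 𝓘(ℝ, E3) (chartAt E3 (K.toFun 0) ∘ K.toFun) 0 = _ :=
    mfderiv_comp (I' := 𝓡 3) 0 (hc.mdifferentiableAt hs) (K.smooth.mdifferentiableAt (by simp))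
  have h2 : mfderiv 𝓘(ℝ, ℝ) 𝓘(ℝ, E3) (chartAt E3 (K.toFun 0) ∘ K.toFun) 0 =
      fderiv ℝ K.coord 0 := mfderiv_eq_fderiv
  intro h0
  refine K.immersive 0 (ContinuousLinearMap.ext fun s => ?_)
  have h3 : fderiv ℝ K.coord 0 = 0 := by
    ext1
    simpa using h0
  apply hc.mfderiv_injective hs
  have h4 := DFunLike.congr_fun (h1.symm.trans (h2.trans h3)) s
  exact h4.trans (map_zero _).symm

/-- A chart in which `K` is the third axis, built from the frame `a`, `b` and the velocity of `K`:
its inverse is `v ↦ K(δ v₂) + δ v₀ a + δ v₁ b` in the preferred chart. -/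
theorem exists_straightening [T2Space M] (K : OrientedKnot M) {a b : E3}
    (hli : LinearIndependent ℝ ![a, b, deriv K.coord 0]) :
    ∃ e ∈ IsManifold.maximalAtlas (𝓡 3) ∞ M, ∃ δ > 0, e.target = Metric.ball 0 2 ∧
      (∀ q ∈ e.source, q ∈ K.carrier ↔ e q 0 = 0 ∧ e q 1 = 0) ∧
      (∀ s : ℝ, |s| < 2 → e.symm !₂[0, 0, s] = K.toFun (δ * s)) ∧
      ∀ v : E3, e.symm v = (chartAt E3 (K.toFun 0)).symm
        (K.coord (δ * v 2) + (δ * v 0) • a + (δ * v 1) • b) := by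
  let c₀ := chartAt E3 (K.toFun 0)
  have hc₀ : K.toFun 0 ∈ c₀.source := mem_chart_source E3 _
  let G : E3 → E3 := fun v => K.coord (v 2) + v 0 • a + v 1 • b
  have hGsmooth {v : E3} (hv : K.toFun (v 2) ∈ c₀.source) : ContDiffAt ℝ ∞ G v := by
    have hp (i : Fin 3) : ContDiffAt ℝ ∞ (fun v : E3 => v i) v := by fun_prop
    have h1 : ContDiffAt ℝ ∞ (fun v : E3 => K.coord (v 2)) v :=
      ContDiffAt.comp (g := K.coord) v (K.contDiffAt_coord hv) (hp 2)
    exact (h1.add ((hp 0).smul contDiffAt_const)).add ((hp 1).smul contDiffAt_const)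
  -- the derivative at the origin
  let p (i : Fin 3) : E3 →L[ℝ] ℝ := EuclideanSpace.proj i
  let c := deriv K.coord 0
  let L₀ : E3 →L[ℝ] E3 := (p 2).smulRight c + (p 0).smulRight a + (p 1).smulRight b
  have hinj : Function.Injective (L₀ : E3 →ₗ[ℝ] E3) := by
    refine (injective_iff_map_eq_zero _).2 fun v hv => ?_
    have h := Fintype.linearIndependent_iff.1 hli v (by
      rw [Fin.sum_univ_three]
      refine Eq.trans ?_ hv
      change v 0 • a + v 1 • b + v 2 • c = v 2 • c + v 0 • a + v 1 • b
      abel)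
    ext i
    exact h i
  let L : E3 ≃L[ℝ] E3 := (LinearEquiv.ofInjectiveEndo _ hinj).toContinuousLinearEquiv
  have hG0 : HasFDerivAt G (L : E3 →L[ℝ] E3) 0 := by
    have h1 : HasDerivAt K.coord c ((0 : E3) 2) :=
      ((K.contDiffAt_coord hc₀).differentiableAt (by simp)).hasDerivAt
    have hp (i : Fin 3) : HasFDerivAt (fun v : E3 => v i) (p i) 0 := (p i).hasFDerivAt
    have h2 : HasFDerivAt (fun v : E3 => K.coord (v 2)) ((p 2).smulRight c) 0 :=
      HasFDerivAt.congr_fderiv (HasFDerivAt.comp (g := K.coord) 0 h1.hasFDerivAt (hp 2))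
        (by ext v; simp)
    exact (h2.add ((hp 0).smul_const a)).add ((hp 1).smul_const b)
  have hG0' : ContDiffAt ℝ ∞ G 0 := hGsmooth hc₀
  let ψ : OpenPartialHomeomorph E3 E3 := hG0'.toOpenPartialHomeomorph G hG0 (by simp)
  have hψ0 : (0 : E3) ∈ ψ.source := hG0'.mem_toOpenPartialHomeomorph_source hG0 (by simp)
  have hψ (v : E3) : ψ v = G v := rfl
  have hG00 : G 0 = c₀ (K.toFun 0) := by simp [G, coord, c₀]
  -- the times at which the knot is near its initial point
  have hKc : Continuous K.toFun := K.smooth.continuous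
  let ax (s : ℝ) : E3 := !₂[0, 0, s]
  have hax : Continuous ax := by fun_prop
  have hGax (s : ℝ) : G (ax s) = K.coord s := by simp [G, ax]
  obtain ⟨η, hη, hηs⟩ : ∃ η > 0, ∀ t : ℝ, |t| < η → ax t ∈ ψ.source ∧ K.toFun t ∈ c₀.source := by
    have h1 : ax ⁻¹' ψ.source ∩ K.toFun ⁻¹' c₀.source ∈ 𝓝 (0 : ℝ) := by
      refine Filter.inter_mem ((ψ.open_source.preimage hax).mem_nhds ?_)
        ((c₀.open_source.preimage hKc).mem_nhds hc₀)
      have : ax 0 = 0 := by ext i; fin_cases i <;> rfl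
      rw [mem_preimage, this]
      exact hψ0
    obtain ⟨η, hη, h⟩ := Metric.mem_nhds_iff.1 h1
    exact ⟨η, hη, fun t ht => h (by simpa using ht)⟩
  obtain ⟨N, hN, hN0, hNt⟩ := K.exists_nhds_abs_sub_round_lt hη
  -- a ball on which everything is under control
  obtain ⟨r, hr, hball⟩ : ∃ r > 0, ∀ v ∈ Metric.ball (0 : E3) r, v ∈ ψ.source ∧
      K.toFun (v 2) ∈ c₀.source ∧ G v ∈ c₀.target ∧ c₀.symm (G v) ∈ N ∧
      fderiv ℝ G v ∈ range ((↑) : (E3 ≃L[ℝ] E3) → E3 →L[ℝ] E3) := by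
    refine Metric.mem_nhds_iff.1 ?_
    have hGc : ContinuousAt G 0 := hG0'.continuousAt
    have hGt : G 0 ∈ c₀.target := hG00 ▸ c₀.map_source hc₀
    have h1 : ∀ᶠ v in 𝓝 (0 : E3), G v ∈ c₀.target := hGc.eventually (c₀.open_target.mem_nhds hGt)
    have h2 : ∀ᶠ v in 𝓝 (0 : E3), c₀.symm (G v) ∈ N := by
      refine ((c₀.continuousAt_symm hGt).comp hGc).eventually (hN.mem_nhds ?_)
      rwa [Function.comp_apply, hG00, c₀.left_inv hc₀]
    have h3 : ∀ᶠ v : E3 in 𝓝 0, K.toFun (v 2) ∈ c₀.source := by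
      have : Continuous fun v : E3 => K.toFun (v 2) := hKc.comp (by fun_prop)
      exact (c₀.open_source.preimage this).mem_nhds hc₀
    have h4 : ∀ᶠ v in 𝓝 (0 : E3), fderiv ℝ G v ∈ range ((↑) : (E3 ≃L[ℝ] E3) → E3 →L[ℝ] E3) := by
      refine (hG0'.fderiv_right (m := 0) (by simp)).continuousAt.eventually ?_
      rw [hG0.fderiv]
      exact L.nhds
    filter_upwards [ψ.open_source.mem_nhds hψ0, h3, h1, h2, h4] with v g1 g2 g3 g4 g5
    exact ⟨g1, g2, g3, g4, g5⟩
  let δ := r / 2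
  have hδ : 0 < δ := half_pos hr
  have hδball {v : E3} (hv : v ∈ Metric.ball 0 2) : δ • v ∈ Metric.ball (0 : E3) r := by
    rw [mem_ball_zero_iff] at hv ⊢
    rw [norm_smul, Real.norm_of_nonneg hδ.le]
    calc δ * ‖v‖ < δ * 2 := mul_lt_mul_of_pos_left hv hδ
      _ = r := by simp [δ]
  let θ : OpenPartialHomeomorph E3 M :=
    (((Homeomorph.smulOfNeZero δ hδ.ne').toOpenPartialHomeomorph.trans ψ).trans c₀.symm).restrOpen
      (Metric.ball 0 2) Metric.isOpen_ball
  have hθ (v : E3) : θ v = c₀.symm (G (δ • v)) := rfl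
  have hθsymm (q : M) : θ.symm q = δ⁻¹ • ψ.symm (c₀ q) := rfl
  have hsource : θ.source = Metric.ball 0 2 := by
    ext v
    constructor
    · intro hv
      exact hv.2
    · intro hv
      obtain ⟨h1, -, h2, -⟩ := hball _ (hδball hv)
      exact ⟨⟨⟨trivial, h1⟩, h2⟩, hv⟩
  refine ⟨θ.symm, ?_, δ, hδ, hsource, ?_, ?_, ?_⟩
  · refine OpenPartialHomeomorph.mem_maximalAtlas_of_contMDiffOn _ ?_ ?_
    · intro q hq
      obtain ⟨v, hv, rfl⟩ : ∃ v ∈ θ.source, θ v = q := ⟨_, θ.map_target hq, θ.right_inv hq⟩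
      rw [hsource] at hv
      obtain ⟨h1, h2, h3, h4, ⟨L', hL'⟩⟩ := hball _ (hδball hv)
      have hq' : c₀ (θ v) = ψ (δ • v) := c₀.right_inv h3
      have g1 : ContMDiffAt (𝓡 3) (𝓡 3) ∞ c₀ (θ v) :=
        contMDiffAt_of_mem_maximalAtlas (IsManifold.chart_mem_maximalAtlas _) (c₀.map_target h3)
      have g2 : ContDiffAt ℝ ∞ ψ.symm (c₀ (θ v)) := by
        have g3 : ψ.symm (c₀ (θ v)) = δ • v := by rw [hq', ψ.left_inv h1]
        refine ψ.contDiffAt_symm (f₀' := L') (hq' ▸ ψ.map_source h1) ?_ ?_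
        · rw [g3, hL']
          exact ((hGsmooth h2).differentiableAt (by simp)).hasFDerivAt
        · rw [g3]
          exact hGsmooth h2
      have g4 : ContDiffAt ℝ ∞ (fun y => δ⁻¹ • ψ.symm y) (c₀ (θ v)) := g2.const_smul δ⁻¹
      exact (g4.contMDiffAt.comp (θ v) g1).contMDiffWithinAt
    · intro v hv
      have hv' : v ∈ Metric.ball 0 2 := hsource ▸ hv
      obtain ⟨h1, h2, h3, -⟩ := hball _ (hδball hv')
      have g1 : ContMDiffAt (𝓡 3) (𝓡 3) ∞ c₀.symm (G (δ • v)) :=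
        contMDiffAt_symm_of_mem_maximalAtlas (IsManifold.chart_mem_maximalAtlas _) h3
      have g2 : ContDiffAt ℝ ∞ (fun v => G (δ • v)) v :=
        ContDiffAt.comp (g := G) v (hGsmooth h2) (contDiffAt_id.const_smul δ)
      exact (g1.comp v g2.contMDiffAt).contMDiffWithinAt
  · intro q hq
    obtain ⟨v, hv, rfl⟩ : ∃ v ∈ θ.source, θ v = q := ⟨_, θ.map_target hq, θ.right_inv hq⟩
    have hv' : v ∈ Metric.ball 0 2 := hsource ▸ hv
    obtain ⟨h1, h2, h3, h4, -⟩ := hball _ (hδball hv')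
    rw [θ.left_inv hv]
    constructor
    · rintro ⟨t, ht⟩
      rw [hθ] at ht
      have htN : |t - round t| < η := hNt t (ht ▸ h4)
      obtain ⟨g1, g2⟩ := hηs _ htN
      have ht' : K.toFun (t - round t) = c₀.symm (G (δ • v)) := by
        have := K.toFun_add_int t (-round t)
        rw [Int.cast_neg, ← sub_eq_add_neg] at this
        rw [this, ht]
      have g3 : ψ (ax (t - round t)) = ψ (δ • v) := by
        rw [hψ, hGax, hψ, coord, ht']
        exact c₀.right_inv h3
      have g4 := ψ.injOn g1 h1 g3
      have e (i : Fin 3) : ax (t - round t) i = δ * v i := by rw [g4]; rfl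
      exact ⟨(mul_eq_zero.1 (e 0).symm).resolve_left hδ.ne',
        (mul_eq_zero.1 (e 1).symm).resolve_left hδ.ne'⟩
    · rintro ⟨e0, e1⟩
      refine ⟨δ * v 2, ?_⟩
      have g1 : δ • v = ax (δ * v 2) := by
        ext i
        fin_cases i <;> simp [ax, e0, e1]
      rw [hθ, g1, hGax]
      exact (c₀.left_inv h2).symm
  · intro s hs
    have hv : ax s ∈ Metric.ball 0 2 := by
      rw [mem_ball_zero_iff, EuclideanSpace.norm_eq, Fin.sum_univ_three]
      simpa [ax, Real.sqrt_sq_eq_abs] using hs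
    have g1 : δ • ax s = ax (δ * s) := by
      ext i
      fin_cases i <;> simp [ax]
    change c₀.symm (G (δ • ax s)) = _
    rw [g1, hGax]
    have h2 := (hball _ (hδball hv)).2.1
    rw [g1] at h2
    exact c₀.left_inv h2
  · exact fun v => rfl

open SingularChain in
theorem exists_isPositiveMeridian [T2Space M] {α : ∀ x : M, TangentSpace (𝓡 3) x →L[ℝ] ℝ}
    (hα : IsContactForm α) (K : OrientedKnot M) :
    ∃ m : C(UnitAddCircle, M), K.IsPositiveMeridian α m := by
  let z := K.toFun 0
  let c := deriv K.coord 0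
  obtain ⟨a, b, hli, hpos⟩ := hα.exists_positive_frame z K.deriv_coord_ne_zero
  obtain ⟨e, he, δ, hδ, htgt, hK, hax, hsymm⟩ := K.exists_straightening hli
  have hmem {y : E3} (hy : ‖y‖ ≤ 1) : y ∈ e.target := by
    rw [htgt, mem_ball_zero_iff]
    linarith
  have hcircle (θ) : axisCircle 1 θ ∈ e.target := hmem (by rw [norm_axisCircle, abs_one])
  have hax0 : e.symm 0 = z := by
    have h1 : (!₂[0, 0, 0] : E3) = 0 := by ext i; fin_cases i <;> rfl
    have h2 := hax 0 (by simp)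
    rwa [h1, mul_zero] at h2
  refine ⟨⟨fun θ => e.symm (axisCircle 1 θ),
    e.continuousOn_symm.comp_continuous (axisCircle 1).continuous hcircle⟩,
    e, he, fun y _ hy => hmem hy, hK, ?_, ?_, fun t => ?_⟩
  · intro t ht ht0
    have h1 : K.toFun t = K.toFun 0 := by rw [← e.left_inv ht, ht0, hax0]
    obtain ⟨n, rfl⟩ := (K.toFun_eq_toFun_zero_iff t).1 h1
    have h2 : (fun s => e (K.toFun s) 2) =ᶠ[𝓝 (n : ℝ)] fun s => (s - n) / δ := by
      filter_upwards [Metric.ball_mem_nhds (n : ℝ) (mul_pos two_pos hδ)] with s hs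
      have h3 : |(s - n) / δ| < 2 := by
        rwa [abs_div, abs_of_pos hδ, div_lt_iff₀ hδ]
      have h4 := hax _ h3
      have h5 : K.toFun (δ * ((s - n) / δ)) = K.toFun s := by
        have := K.toFun_add_int s (-n)
        rwa [mul_div_cancel₀ _ hδ.ne', sub_eq_add_neg, ← Int.cast_neg]
      rw [← h5, ← h4, e.right_inv]
      · simp
      · rw [htgt, mem_ball_zero_iff, EuclideanSpace.norm_eq, Fin.sum_univ_three]
        generalize (s - n) / δ = u at h3
        simpa [Real.sqrt_sq_eq_abs] using h3
    have h3 : HasDerivAt (fun s : ℝ => (s - n) / δ) (1 / δ) n :=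
      ((hasDerivAt_id _).sub_const _).div_const δ
    rw [h2.deriv_eq, h3.deriv]
    positivity
  · let cv : M → E3 → E3 → E3 → ℝ := contactVolume α
    let D : E3 →L[ℝ] E3 := mfderiv 𝓘(ℝ, E3) 𝓘(ℝ, E3) e.symm 0
    have hD (v : E3) : D v = δ • (v 0 • a + v 1 • b + v 2 • c) := by
      let c₀ := chartAt E3 z
      let g : E3 → E3 := fun v => K.coord (δ * v 2) + (δ * v 0) • a + (δ * v 1) • b
      have hg : HasFDerivAt g (δ • ((EuclideanSpace.proj 2).smulRight c +
          (EuclideanSpace.proj 0).smulRight a + (EuclideanSpace.proj 1).smulRight b) : E3 →L[ℝ] E3)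
          0 := by
        have hp (i : Fin 3) : HasFDerivAt (fun v : E3 => δ * v i)
            (δ • EuclideanSpace.proj i : E3 →L[ℝ] ℝ) 0 :=
          ((EuclideanSpace.proj i : E3 →L[ℝ] ℝ).hasFDerivAt (x := 0)).const_mul δ
        have h1 : HasDerivAt K.coord c (δ * (0 : E3) 2) := by
          have : δ * (0 : E3) 2 = 0 := mul_zero δ
          rw [this]
          exact ((K.contDiffAt_coord (mem_chart_source E3 z)).differentiableAt (by simp)).hasDerivAt
        have h2 := HasFDerivAt.comp (g := K.coord) 0 h1.hasFDerivAt (hp 2)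
        refine ((h2.add ((hp 0).smul_const a)).add ((hp 1).smul_const b)).congr_fderiv ?_
        ext v i
        simp
        ring
      have hg0 : g 0 = c₀ z := by simp [g, coord, z, c₀]
      have hc := (OpenPartialHomeomorph.mdifferentiable_of_mem_maximalAtlas
        (IsManifold.chart_mem_maximalAtlas (I := 𝓡 3) (n := ∞) z)).symm
      have h1 : MDifferentiableAt 𝓘(ℝ, E3) 𝓘(ℝ, E3) c₀.symm (g 0) :=
        hc.mdifferentiableAt (hg0 ▸ c₀.map_source (mem_chart_source E3 z))
      have h2 : e.symm = c₀.symm ∘ g := funext hsymm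
      have h3 : mfderiv 𝓘(ℝ, E3) 𝓘(ℝ, E3) (c₀.symm ∘ g) 0 = _ :=
        mfderiv_comp (I' := 𝓘(ℝ, E3)) 0 h1 hg.differentiableAt.mdifferentiableAt
      have h4 : (mfderiv 𝓘(ℝ, E3) 𝓘(ℝ, E3) c₀.symm (g 0) : E3 →L[ℝ] E3) =
          ContinuousLinearMap.id ℝ E3 := by
        rw [hg0]
        exact mfderiv_extChartAt_symm_self z
      have h5 : mfderiv 𝓘(ℝ, E3) 𝓘(ℝ, E3) g 0 = _ := mfderiv_eq_fderiv.trans hg.fderiv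
      have h6 : D = (mfderiv 𝓘(ℝ, E3) 𝓘(ℝ, E3) c₀.symm (g 0) : E3 →L[ℝ] E3).comp
          (mfderiv 𝓘(ℝ, E3) 𝓘(ℝ, E3) g 0 : E3 →L[ℝ] E3) := by
        refine Eq.trans ?_ h3
        rw [← h2]
      rw [h6, h4]
      refine (DFunLike.congr_fun h5 v).trans ?_
      change δ • (v 2 • c + v 0 • a + v 1 • b) = _
      congr 1
      abel
    change 0 < cv (e.symm 0) (D _) (D _) (D _)
    rw [hax0, hD, hD, hD]
    have h1 := (wedgeForm (α z : E3 →L[ℝ] ℝ)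
      (fderiv ℝ (formInChart α z) (extChartAt 𝓘(ℝ, E3) z z))).toMultilinearMap.map_smul_univ
        (fun _ => δ) ![a, b, c]
    have h2 : cv z (δ • a) (δ • b) (δ • c) = δ ^ 3 * cv z a b c := by
      rw [Finset.prod_const, Finset.card_univ, Fintype.card_fin] at h1
      exact h1
    have h3 : 0 < δ ^ 3 * cv z a b c := mul_pos (pow_pos hδ 3) hpos
    rw [← h2] at h3
    simpa using h3
  · change e.symm (axisCircle 1 (t : UnitAddCircle)) = _
    rw [axisCircle_coe]

end OrientedKnot

/-! ### Linking with the boundary of the section -/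

namespace PeriodicOrbit

variable {M : Type} [TopologicalSpace M] {φ : Flow ℝ M}

theorem range_loop (γ : PeriodicOrbit φ) : range γ.loop = γ.carrier := by
  have h (t : ℝ) : γ.loop (t : UnitAddCircle) = φ (γ.period * t) γ.pt := rfl
  ext x
  constructor
  · rintro ⟨θ, rfl⟩
    obtain ⟨t, rfl⟩ := QuotientAddGroup.mk_surjective θ
    exact ⟨_, (h t).symm⟩
  · rintro ⟨t, rfl⟩
    refine ⟨((t / γ.period : ℝ) : UnitAddCircle), ?_⟩
    rw [h, mul_div_cancel₀ _ γ.period_pos.ne']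

theorem isClosed_carrier [T2Space M] (γ : PeriodicOrbit φ) : IsClosed γ.carrier := by
  rw [← range_loop]
  exact (isCompact_range γ.loop.continuous).isClosed

theorem carrier_eq_or_disjoint (γ γ' : PeriodicOrbit φ) :
    γ.carrier = γ'.carrier ∨ Disjoint γ.carrier γ'.carrier := by
  have key {γ : PeriodicOrbit φ} {x : M} (hx : x ∈ γ.carrier) :
      γ.carrier = range fun t => φ t x := by
    obtain ⟨s, rfl⟩ := hx
    ext y
    constructor
    · rintro ⟨t, rfl⟩
      refine ⟨t - s, ?_⟩
      simp only
      rw [← φ.map_add, sub_add_cancel]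
    · rintro ⟨t, rfl⟩
      exact ⟨t + s, φ.map_add _ _ _⟩
  refine or_iff_not_imp_right.2 fun h => ?_
  obtain ⟨x, hx, hx'⟩ := not_disjoint_iff.1 h
  rw [key hx, key hx']

end PeriodicOrbit

open SingularChain

/-- In a space with `H₂ = 0`, a loop that bounds in the complement of each of finitely many closed
sets, any two of which are equal or disjoint, bounds in the complement of their union. -/
theorem exists_bd_eq_compl_iUnion {M : Type} [TopologicalSpace M]
    (H1 : ∀ c : Chain 1 M, bd c = 0 → ∃ w, bd w = c)
    (H2 : ∀ c : Chain 2 M, bd c = 0 → ∃ w, bd w = c) {ι : Type*} {K : ι → Set M}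
    (hK : ∀ i, IsClosed (K i)) (hd : ∀ i j, K i = K j ∨ Disjoint (K i) (K j)) {z : Chain 1 M}
    (hz : bd z = 0) (hzK : ∀ i, z ∈ chainsIn 1 (K i)ᶜ) (hb : ∀ i, ∃ u ∈ chainsIn 2 (K i)ᶜ, bd u = z)
    (s : Finset ι) : ∃ u ∈ chainsIn 2 (⋃ i ∈ s, K i)ᶜ, bd u = z := by
  classical
  suffices h : z ∈ chainsIn 1 (⋃ i ∈ s, K i)ᶜ ∧ ∃ u ∈ chainsIn 2 (⋃ i ∈ s, K i)ᶜ, bd u = z from h.2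
  induction s using Finset.induction_on with
  | empty =>
    obtain ⟨w, hw⟩ := H1 z hz
    simp only [Finset.notMem_empty, iUnion_of_empty, iUnion_empty, compl_empty, chainsIn_univ]
    exact ⟨trivial, w, trivial, hw⟩
  | insert i s _ ih =>
    obtain ⟨hzs, hbs⟩ := ih
    rw [Finset.set_biUnion_insert, compl_union]
    by_cases hj : ∃ j ∈ s, K i = K j
    · obtain ⟨j, hj, hij⟩ := hj
      have hsub : (⋃ i ∈ s, K i)ᶜ ⊆ (K i)ᶜ :=
        compl_subset_compl.2 (hij ▸ subset_biUnion_of_mem (u := K) hj)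
      rw [inter_eq_right.2 hsub]
      exact ⟨hzs, hbs⟩
    · have hclosed : IsClosed (⋃ i ∈ s, K i) := s.finite_toSet.isClosed_biUnion fun j _ => hK j
      have huniv : (K i)ᶜ ∪ (⋃ i ∈ s, K i)ᶜ = univ := by
        rw [← compl_inter, compl_univ_iff, ← disjoint_iff_inter_eq_empty]
        refine disjoint_iUnion₂_right.2 fun j hjs => ?_
        exact (hd i j).resolve_left fun h => hj ⟨j, hjs, h⟩
      have hzi : z ∈ chainsIn 1 ((K i)ᶜ ∩ (⋃ i ∈ s, K i)ᶜ) := mem_chainsIn_inter (hzK i) hzs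
      exact ⟨hzi, exists_bd_eq_of_inter (hK i).isOpen_compl hclosed.isOpen_compl huniv H2 hz hzi
        (hb i) hbs⟩

theorem mainTheorem4
    {M : Type} [TopologicalSpace M] [T2Space M] [CompactSpace M]
    [ChartedSpace (EuclideanSpace ℝ (Fin 3)) M] [IsManifold (𝓡 3) ∞ M]
    (hM : HasHomologyOfThreeSphere M)
    (α : ∀ x : M, TangentSpace (𝓡 3) x →L[ℝ] ℝ) (hα : IsContactForm α)
    (R : ∀ x : M, TangentSpace (𝓡 3) x) (φ : Flow ℝ M) (hφ : IsReebFlow α R φ)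
    {S : Type*} [TopologicalSpace S] [ChartedSpace (EuclideanHalfSpace 2) S]
    [IsManifold (𝓡∂ 2) ∞ S] (f : S → M) (hS : IsGlobalSurfaceOfSection α R φ f)
    {k : ℕ} (L : Fin k → OrientedKnot M)
    (hL : ∀ C : Set M, (∃ i, (L i).carrier = C) ↔
      ∃ q ∈ surfaceBoundary f, C = connectedComponentIn (surfaceBoundary f) q)
    (γ : PeriodicOrbit φ) (hγ : ∀ i, γ.carrier ≠ (L i).carrier) :
    ∃ i, (∃ n : ℤ, (L i).HasLinkingNumber α γ.loop n) ∧
      ∀ n : ℤ, (L i).HasLinkingNumber α γ.loop n → n ≠ 0 := by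
  have H1 (c : Chain 1 M) (hc : bd c = 0) : ∃ w, bd w = c :=
    exists_bd_eq_of_isZero (n := 0) (hM.other 1 (by norm_num) (by norm_num)) hc
  have H2 (c : Chain 2 M) (hc : bd c = 0) : ∃ w, bd w = c :=
    exists_bd_eq_of_isZero (n := 1) (hM.other 2 (by norm_num) (by norm_num)) hc
  -- the knots are closed orbits that form the boundary of the section
  have horbit (i : Fin k) : ∃ γ' : PeriodicOrbit φ, (L i).carrier = γ'.carrier := by
    obtain ⟨q, hq, hi⟩ := (hL _).1 ⟨i, rfl⟩
    obtain ⟨γ', hγ'⟩ := hS.boundary_periodic q hq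
    exact ⟨γ', hi.trans hγ'.symm⟩
  choose γ' hγ' using horbit
  have hbdry : surfaceBoundary f = ⋃ i ∈ (Finset.univ : Finset (Fin k)), (L i).carrier := by
    ext q
    simp only [Finset.mem_univ, iUnion_true, mem_iUnion]
    constructor
    · intro hq
      obtain ⟨i, hi⟩ := (hL _).2 ⟨q, hq, rfl⟩
      exact ⟨i, hi ▸ mem_connectedComponentIn hq⟩
    · rintro ⟨i, hi⟩
      obtain ⟨q', hq', h⟩ := (hL _).1 ⟨i, rfl⟩
      exact connectedComponentIn_subset _ _ (h ▸ hi)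
  have hclosed (i) : IsClosed (L i).carrier := hγ' i ▸ (γ' i).isClosed_carrier
  have hdisj (i) : Disjoint γ.carrier (L i).carrier := by
    have h := hγ i
    rw [hγ'] at h ⊢
    exact (γ.carrier_eq_or_disjoint _).resolve_left h
  have hloop (i) (θ) : γ.loop θ ∉ (L i).carrier :=
    disjoint_left.1 (hdisj i) (γ.range_loop ▸ mem_range_self θ)
  by_contra hcon
  -- all linking numbers vanish
  have hzero (i) : (L i).HasLinkingNumber α γ.loop 0 := by
    obtain ⟨m, hm⟩ := (L i).exists_isPositiveMeridian hα
    obtain ⟨n, hn⟩ := OrientedKnot.exists_hasLinkingNumber H1 (hclosed i) φ (hγ' i) hm (hloop i)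
    by_contra h0
    exact hcon ⟨i, ⟨n, hn⟩, fun n' hn' h => h0 (h ▸ hn')⟩
  obtain ⟨y, hy, hyb⟩ := exists_bd_eq_compl_iUnion H1 H2 hclosed
    (fun i j => by rw [hγ', hγ']; exact (γ' i).carrier_eq_or_disjoint (γ' j))
    (z := push γ.loop circleCycle) (by rw [bd_push, bd_circleCycle, map_zero])
    (fun i => push_mem _ (hloop i) _)
    (fun i => OrientedKnot.exists_bd_eq_of_hasLinkingNumber_zero (hzero i)) Finset.univ
  rw [← hbdry] at hy
  have := hS.compact
  obtain ⟨t₀, -, ht₀⟩ := hS.forward γ.pt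
  refine bd_ne_of_flowSlices (isCompact_range hS.embedded.isEmbedding.continuous).isClosed
    ?_ γ ?_ ht₀ hy hyb
  · rintro _ ⟨⟨s, rfl⟩, hs⟩
    refine hS.exists_isFlowSlice hα hφ ?_
    rw [← ModelWithCorners.compl_boundary]
    exact fun h => hs ⟨s, h, rfl⟩
  · -- the orbit avoids the boundary of the section
    rw [hbdry]
    intro x hx hxK
    obtain ⟨i, -, hi⟩ := mem_iUnion₂.1 hxK
    exact disjoint_left.1 (hdisj i) hx hi
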